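/- \textbf{Corollary (Convergence for delay tending to zero).} Let $R,V,L>0$ and assume: \begin{itemize} \item $v\in C^2([0,R];[0,V])$, $v'\le 0$, $v(0)=V$, $v(R)=0$; \item $f\in C^1([0,R];[0,1])$, $f'\le 0$, $f(0)=1$, $f(R)=0$, extended by $f(\rho)=1$ for $\rho<0$ and $f(\rho)=0$ for $\rho>R$; \item $\omega\in C^1([0,L];[0,\infty))$, $\omega'\le 0$, $\int_0^L\omega(s)\,ds=1$. \end{itemize} For $u:\mathbb R\to\mathbb R$ put $(u*\omega)(x)=\int_0^L u(x+s)\,\omega(s)\,ds$. Let $\rho^0\in \mathbf{BV}(\mathbb R;[0,R])$, that is, $\rho^0\in L^1(\mathbb R)$ takes values in $[0,R]$ a.e. and has finite total variation, and let $T>0$ be arbitrary. For $A:[0,T]\times\mathbb R\to\mathbb R$, we say that $\rho\in L^1([0,T]\times\mathbb R;\mathbb R)$ is an entropy weak solution on $[0,T]$ of $\partial_t\rho+\partial_x\big(\rho f(\rho)\,v(A)\big)=0$ with initial datum $\rho^0$ if, for a.e. $t\in[0,T]$, $A(t,x)\in[0,R]$ for all $x$ (so that $v(A)$ is defined) and,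 for every $\phi\in C^1_c([0,T)\times\mathbb R;[0,\infty))$ and every $\kappa\in\mathbb R$, \begin{align*} \int_0^T\!\!\int_{\mathbb R}\Big(&|\rho-\kappa|\,\partial_t\phi+\operatorname{sgn}(\rho-\kappa)\big(\rho f(\rho)-\kappa f(\kappa)\big)v(A)\,\partial_x\phi\\ &-\operatorname{sgn}(\rho-\kappa)\,\kappa f(\kappa)\,\partial_x\big(v(A)\big)\,\phi\Big)\,dx\,dt+\int_{\mathbb R}|\rho^0(x)-\kappa|\,\phi(0,x)\,dx\ \ge\ 0 . \end{align*} For every $\tau>0$ let $\rho_\tau\in L^1([0,T]\times\mathbb R;\mathbb R)$ be an entropy weak solution on $[0,T]$ of the delayed problem $$\partial_t\rho_\tau(t,x)+\partial_x\big(\rho_\tau(t,x) f(\rho_\tau(t,x))\,v((\rho_\tau*\omega)(t-\tau,x))\big)=0,\qquad \rho_\tau(t,x)=\rho^0(x)\ \text{ for } t\in[-\tau,0],$$ that is, with $A(t,x)=(\rho_\tau(t-\tau,\cdot)*\omega)(x)$, and let $\rho\in L^1([0,T]\times\mathbb R;\mathbb R)$ be an entropy weak solution on $[0,T]$ of the non-delayed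 problem $$\partial_t\rho(t,x)+\partial_x\big(\rho(t,x) f(\rho(t,x))\,v((\rho*\omega)(t,x))\big)=0,\qquad \rho(0,x)=\rho^0(x),$$ that is, with $A(t,x)=(\rho(t,\cdot)*\omega)(x)$. Then $\rho$ and each $\rho_\tau$ have a representative in $C([0,T];L^1(\mathbb R))$ (necessarily unique), which gives a meaning to $\rho(t,\cdot)$ and $\rho_\tau(t,\cdot)$ for every single $t$, and for these representatives $$\|\rho_\tau(t,\cdot)-\rho(t,\cdot)\|_{L^1(\mathbb R)}\longrightarrow 0\quad\text{as }\tau\searrow 0,\qquad\text{for all } t\in[0,T].$$ -/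

import Mathlib

open MeasureTheory Set Filter Topology

noncomputable section

/-- Standing assumptions on the speed law `v`, the saturation function `f` and the kernel `ω`.
Here `v` is a function on `[0, R]` and `ω` a function on `[0, L]` (their values elsewhere are
never used), while `f` is a function on `[0, R]` extended by `1` to the left and by `0` to the
right. Derivatives on the closed intervals are one-sided at the end points. -/
structure TrafficData (R V L : ℝ) (v f ω : ℝ → ℝ) : Prop where
  R_pos : 0 < R
  V_pos : 0 < V
  L_pos : 0 < L
  v_contDiff : ContDiffOn ℝ 2 v (Icc 0 R)
  v_mapsTo : MapsTo v (Icc 0 R) (Icc 0 V)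
  v_deriv_nonpos : ∀ r ∈ Icc 0 R, derivWithin v (Icc 0 R) r ≤ 0
  v_zero : v 0 = V
  v_R : v R = 0
  f_contDiff : ContDiffOn ℝ 1 f (Icc 0 R)
  f_mapsTo : MapsTo f (Icc 0 R) (Icc 0 1)
  f_deriv_nonpos : ∀ r ∈ Icc 0 R, derivWithin f (Icc 0 R) r ≤ 0
  f_zero : f 0 = 1
  f_R : f R = 0
  f_of_neg : ∀ r, r < 0 → f r = 1
  f_of_gt : ∀ r, R < r → f r = 0
  ω_contDiff : ContDiffOn ℝ 1 ω (Icc 0 L)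
  ω_nonneg : ∀ s ∈ Icc 0 L, 0 ≤ ω s
  ω_deriv_nonpos : ∀ s ∈ Icc 0 L, derivWithin ω (Icc 0 L) s ≤ 0
  ω_integral : ∫ s in (0 : ℝ)..L, ω s = 1

/-- `u ∈ BV(ℝ; [0, R])`, where `BV ⊆ L¹`: the function `u` is integrable, takes values in
`[0, R]` almost everywhere, and has finite (essential) total variation, that is, it agrees almost
everywhere with a function of bounded pointwise variation on `ℝ`. -/
def IsBVDatum (R : ℝ) (u : ℝ → ℝ) : Prop :=
  Integrable u ∧ (∀ᵐ x, u x ∈ Icc 0 R) ∧ ∃ g : ℝ → ℝ, u =ᵐ[volume] g ∧ BoundedVariationOn g univ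

/-- The downstream average `(u * ω)(x) = ∫_x^{x+L} u(y) ω(y - x) dy = ∫_0^L u(x + s) ω(s) ds`. -/
def downstream (L : ℝ) (ω u : ℝ → ℝ) (x : ℝ) : ℝ :=
  ∫ s in (0 : ℝ)..L, u (x + s) * ω s

/-- Extension of a density to past times by the initial datum. -/
def withPast (ρ₀ : ℝ → ℝ) (ρ : ℝ → ℝ → ℝ) (t x : ℝ) : ℝ :=
  if t ≤ 0 then ρ₀ x else ρ t x

/-- Test functions in `C¹_c([0, T) × ℝ; [0, ∞))`, as restrictions of `C¹` functions with compact
support on the plane. -/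
structure IsTestFunction (T : ℝ) (φ : ℝ × ℝ → ℝ) : Prop where
  contDiff : ContDiff ℝ 1 φ
  hasCompactSupport : HasCompactSupport φ
  tsupport_subset : tsupport φ ⊆ Iio T ×ˢ univ
  nonneg : ∀ t ∈ Ico 0 T, ∀ x, 0 ≤ φ (t, x)

/-- `ρ ∈ L¹([0, T] × ℝ)` is an entropy weak solution of `∂ₜ ρ + ∂ₓ (ρ f(ρ) v(A)) = 0` with initial
datum `ρ₀`, where `A = A(t, x)` is the averaged density seen by the drivers. As `v` is
a function on `[0, R]`, the expression `v(A)` requires `A` to take its values there. -/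
structure IsEntropySolutionWith (T R : ℝ) (v f ρ₀ : ℝ → ℝ) (A ρ : ℝ → ℝ → ℝ) : Prop where
  integrable : Integrable (fun p : ℝ × ℝ => ρ p.1 p.2) ((volume.restrict (Icc 0 T)).prod volume)
  mem_domain : ∀ᵐ t ∂(volume.restrict (Icc 0 T)), ∀ x, A t x ∈ Icc 0 R
  entropy : ∀ φ : ℝ × ℝ → ℝ, IsTestFunction T φ → ∀ κ : ℝ,
    0 ≤ (∫ t in (0 : ℝ)..T, ∫ x,
          (|ρ t x - κ| * deriv (fun s => φ (s, x)) t
            + Real.sign (ρ t x - κ) * (ρ t x * f (ρ t x) - κ * f κ) * v (A t x)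
                * deriv (fun y => φ (t, y)) x
            - Real.sign (ρ t x - κ) * (κ * f κ) * deriv (fun y => v (A t y)) x * φ (t, x)))
        + ∫ x, |ρ₀ x - κ| * φ (0, x)

/-- Entropy weak solution on `[0, T]` of the delayed problem
`∂ₜ ρ + ∂ₓ (ρ f(ρ) v((ρ * ω)(t - τ, x))) = 0`, `ρ(t, x) = ρ₀(x)` for `t ∈ [-τ, 0]`. -/
def IsDelayedEntropySolution (T R L : ℝ) (v f ω : ℝ → ℝ) (τ : ℝ) (ρ₀ : ℝ → ℝ)
    (ρ : ℝ → ℝ → ℝ) : Prop :=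
  IsEntropySolutionWith T R v f ρ₀ (fun t x => downstream L ω (withPast ρ₀ ρ (t - τ)) x) ρ

/-- Entropy weak solution on `[0, T]` of the non-delayed problem
`∂ₜ ρ + ∂ₓ (ρ f(ρ) v((ρ * ω)(t, x))) = 0`, `ρ(0, x) = ρ₀(x)`. -/
def IsNondelayedEntropySolution (T R L : ℝ) (v f ω : ℝ → ℝ) (ρ₀ : ℝ → ℝ)
    (ρ : ℝ → ℝ → ℝ) : Prop :=
  IsEntropySolutionWith T R v f ρ₀ (fun t x => downstream L ω (ρ t) x) ρ

/-- `U ∈ C([0, T]; L¹(ℝ))` represents `ρ ∈ L¹([0, T] × ℝ)`. For `T > 0` there is at most one such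
`U` on `[0, T]`; its value `U t` is what `ρ(t, ·)` means for every single time `t`. -/
def IsTimeContinuousVersion (T : ℝ) (ρ : ℝ → ℝ → ℝ) (U : ℝ → Lp ℝ 1 (volume : Measure ℝ)) :
    Prop :=
  ContinuousOn U (Icc 0 T) ∧ ∀ᵐ t ∂(volume.restrict (Icc 0 T)), U t =ᵐ[volume] ρ t

end

/-! The proof is Kruzhkov's doubling of variables in Kuznetsov's quantitative form. Two profiles are
compared through `kuznetsov η p q`, where `η` is a mollifier of scale `ε`. The spatial doubling
stays at scale `ε`, while the two time variables are merged completely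
(`ae_diag_le_of_forall_isTimeTest`). Merging them needs only the continuity of translations in `L¹`,
so no regularity in time is presupposed.

Let `Φ` be the functional of two solutions `u`, `w` with the same datum, `J` the functional of `u`
with itself, and `N` the `L¹` distance of the profiles that determine the two speeds. By
`IsFlux.rate_add_rate_le` the two entropy inequalities together produce at most `K (Φ + Φ(delayed) +
ε + (1 + J/ε) N)`. The dangerous term is the difference of the two speeds multiplied by the
derivative of `η`. It has size `N/ε`, but the zero mean of that derivative allows one to subtract an
integral equal to zero, after which a factor `J` appears. Integrated in time, this is
`IsKruzhkovSolution.ae_kuznetsov_le`, and the remaining estimates are two applications of it with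
Gronwall's inequality.

Comparing a solution with itself gives `N = 0`. Hence `J = O(ε)` persists if it holds for the datum
(`ae_kuznetsov_self_le`), and for a BV datum it does. This replaces a bound on the total variation
of the solution. The weak form of the equation, tested with `η`, then yields a time modulus `O(ε) +
O((t - t')/ε)` for every `ε` (`exists_modulus`); this provides the continuous versions, and with `ε
= √τ` it shows that `u(t)` and `u(t - τ)` differ by `O(√τ)`.

Comparing the non-delayed `u` with the delayed `w` (`ae_integral_abs_sub_le`), one has `N ≤ δ + J +
Φ(delayed)`, where `δ` bounds the distance between `u(t)` and `u(t - τ)`. As `J/ε` is bounded,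
Gronwall's inequality closes and the `L¹` distance is `O(ε + δ) = O(√τ)`. Only `J` and the modulus
of the non-delayed solution enter. The bound holds for almost every time, and continuity extends it
to every time.

To enter this framework, the entropy solutions need representatives all of whose time slices are
admissible profiles. The mass bound and the maximum principle come from the entropy inequalities for
`κ = 0` and `κ = R`, the zeros of `r f(r)` for which the source term drops out. The nonlocal speed
is handled by writing the downstream average in terms of a primitive of the profile
(`IsProfile.downstream_eq`). -/

/-! ### Abstract setting: profiles, nonlocal fluxes, mollifiers -/

/-- Admissible density profiles at a fixed time. -/
structure IsProfile (R M : ℝ) (p : ℝ → ℝ) : Prop where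
  measurable : Measurable p
  mem_Icc : ∀ x, p x ∈ Icc 0 R
  integrable : Integrable p
  integral_le : ∫ x, p x ≤ M

/-- The Kuznetsov functional `∬ |p(x) - q(y)| η(x - y) dx dy`. -/
noncomputable def kuznetsov (η p q : ℝ → ℝ) : ℝ :=
  ∫ z : ℝ × ℝ, |p z.1 - q z.2| * η (z.1 - z.2)

/-- The Kruzhkov entropy flux. -/
noncomputable def kruzhkovFlux (g : ℝ → ℝ) (a c : ℝ) : ℝ :=
  Real.sign (a - c) * (g a - g c)

/-- Nonlocal flux `g(p) α[p]`: the speed `α[p]` has spatial derivative `β[p]`, and both depend on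
the profile `p` in a Lipschitz way. -/
structure IsFlux (R M C : ℝ) (g : ℝ → ℝ) (α β : (ℝ → ℝ) → ℝ → ℝ) : Prop where
  R_nonneg : 0 ≤ R
  M_nonneg : 0 ≤ M
  C_nonneg : 0 ≤ C
  g_continuous : Continuous g
  g_nonneg : ∀ r ∈ Icc 0 R, 0 ≤ g r
  g_le : ∀ r ∈ Icc 0 R, g r ≤ r
  g_R : g R = 0
  g_lip : ∀ r ∈ Icc 0 R, ∀ s ∈ Icc 0 R, |g r - g s| ≤ C * |r - s|
  α_measurable : ∀ u : ℝ → ℝ → ℝ, Measurable (Function.uncurry u) →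
    (∀ t, IsProfile R M (u t)) → Measurable fun z : ℝ × ℝ => α (u z.1) z.2
  β_measurable : ∀ u : ℝ → ℝ → ℝ, Measurable (Function.uncurry u) →
    (∀ t, IsProfile R M (u t)) → Measurable fun z : ℝ × ℝ => β (u z.1) z.2
  α_bound : ∀ p, IsProfile R M p → ∀ x, |α p x| ≤ C
  β_bound : ∀ p, IsProfile R M p → ∀ x, |β p x| ≤ C
  α_lip : ∀ p, IsProfile R M p → ∀ x y, |α p x - α p y| ≤ C * |x - y|
  α_sub : ∀ p q, IsProfile R M p → IsProfile R M q → ∀ x,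
    |α p x - α q x| ≤ C * ∫ z, |p z - q z|
  β_sub : ∀ p q, IsProfile R M p → IsProfile R M q → ∀ η : ℝ → ℝ, Measurable η → (∀ z, 0 ≤ η z) →
    Integrable η → Integrable (fun z => |z| * η z) →
    Integrable (fun z : ℝ × ℝ => |β p z.1 - β q z.2| * η (z.1 - z.2)) ∧
    ∫ z : ℝ × ℝ, |β p z.1 - β q z.2| * η (z.1 - z.2) ≤
      C * (kuznetsov η p q + (∫ z, |p z - q z|) * (∫ z, η z) + ∫ z, |z| * η z)

/-- Mollifiers at scale `ε` whose derivative they dominate. -/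
structure IsMollifier (m ε : ℝ) (η : ℝ → ℝ) : Prop where
  ε_pos : 0 < ε
  contDiff : ContDiff ℝ 1 η
  nonneg : ∀ z, 0 ≤ η z
  even : ∀ z, η (-z) = η z
  integrable : Integrable η
  integral_eq : ∫ z, η z = 1
  integrable_abs_mul : Integrable fun z => |z| * η z
  integral_abs_mul : ∫ z, |z| * η z ≤ m * ε
  abs_deriv_le : ∀ z, |deriv η z| ≤ 2 / ε * η z
  abs_mul_abs_deriv_le : ∀ z, |z| * |deriv η z| ≤ 4 * η z

/-! ### Double integrals against a kernel in `x - y` -/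

section Convolution

variable {p q k : ℝ → ℝ}

theorem integrable_fst_mul_sub (hp : Integrable p) (hk : Integrable k) :
    Integrable fun z : ℝ × ℝ => p z.1 * k (z.1 - z.2) := by
  have h := (Integrable.convolution_integrand (ContinuousLinearMap.mul ℝ ℝ) hp
    hk.comp_neg).swap
  rw [Measure.volume_eq_prod]
  simpa [Function.comp_def] using h

theorem integrable_snd_mul_sub (hp : Integrable p) (hk : Integrable k) :
    Integrable fun z : ℝ × ℝ => p z.2 * k (z.1 - z.2) := by
  have h := Integrable.convolution_integrand (ContinuousLinearMap.mul ℝ ℝ) hp hk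
  rw [Measure.volume_eq_prod]
  simpa using h

theorem integral_fst_mul_sub (hp : Integrable p) (hk : Integrable k) :
    ∫ z : ℝ × ℝ, p z.1 * k (z.1 - z.2) = (∫ x, p x) * ∫ x, k x := by
  rw [Measure.volume_eq_prod, integral_prod _ (integrable_fst_mul_sub hp hk)]
  simp_rw [integral_const_mul, integral_sub_left_eq_self, integral_mul_const]

theorem integral_snd_mul_sub (hp : Integrable p) (hk : Integrable k) :
    ∫ z : ℝ × ℝ, p z.2 * k (z.1 - z.2) = (∫ x, p x) * ∫ x, k x := by
  rw [Measure.volume_eq_prod, integral_prod_symm _ (integrable_snd_mul_sub hp hk)]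
  simp_rw [integral_const_mul, integral_sub_right_eq_self, integral_mul_const]

/-- Every integrand of the spatial doubling has such a majorant, because nonnegative profiles
satisfy `|p(x) - q(y)| ≤ p(x) + q(y)`. The kernel `k` is built from `η` and its derivative. -/
theorem integrable_of_abs_le_add_mul_sub (hp : Integrable p) (hq : Integrable q)
    (hk : Integrable k) {F : ℝ × ℝ → ℝ} (hF : AEStronglyMeasurable F)
    (h : ∀ z, |F z| ≤ (p z.1 + q z.2) * k (z.1 - z.2)) : Integrable F := by
  refine ((integrable_fst_mul_sub hp hk).add (integrable_snd_mul_sub hq hk)).mono' hF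
    (Eventually.of_forall fun z => ?_)
  simpa [add_mul] using h z

theorem abs_integral_le_add_mul_sub (hp : Integrable p) (hq : Integrable q)
    (hk : Integrable k) {F : ℝ × ℝ → ℝ}
    (h : ∀ z, |F z| ≤ (p z.1 + q z.2) * k (z.1 - z.2)) :
    |∫ z, F z| ≤ ((∫ x, p x) + ∫ x, q x) * ∫ x, k x := by
  have h1 := (integrable_fst_mul_sub hp hk).add (integrable_snd_mul_sub hq hk)
  have h2 := norm_integral_le_of_norm_le (f := F) h1
    (Eventually.of_forall fun z => by simpa [add_mul] using h z)
  rw [integral_add' (integrable_fst_mul_sub hp hk) (integrable_snd_mul_sub hq hk),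
    integral_fst_mul_sub hp hk, integral_snd_mul_sub hq hk, ← add_mul] at h2
  simpa using h2

end Convolution

namespace IsProfile

variable {R M : ℝ} {p q r : ℝ → ℝ}

theorem nonneg (hp : IsProfile R M p) (x : ℝ) : 0 ≤ p x := (hp.mem_Icc x).1
theorem le (hp : IsProfile R M p) (x : ℝ) : p x ≤ R := (hp.mem_Icc x).2

theorem integral_nonneg (hp : IsProfile R M p) : 0 ≤ ∫ x, p x :=
  MeasureTheory.integral_nonneg hp.nonneg

theorem abs_sub_le (hp : IsProfile R M p) (hq : IsProfile R M q) (x y : ℝ) :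
    |p x - q y| ≤ p x + q y := by
  rw [abs_le]; constructor <;> linarith [hp.nonneg x, hq.nonneg y]

theorem integrable_abs_sub (hp : IsProfile R M p) (hq : IsProfile R M q) :
    Integrable fun x => |p x - q x| := (hp.integrable.sub hq.integrable).abs

theorem integral_abs_sub_le (hp : IsProfile R M p) (hq : IsProfile R M q) :
    ∫ x, |p x - q x| ≤ 2 * M := by
  have h := integral_mono (hp.integrable_abs_sub hq) (hp.integrable.add hq.integrable)
    fun x => hp.abs_sub_le hq x x
  rw [integral_add' hp.integrable hq.integrable] at h
  linarith [hp.integral_le, hq.integral_le]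

theorem integral_abs_sub_triangle (hp : IsProfile R M p) (hq : IsProfile R M q)
    (hr : IsProfile R M r) :
    ∫ x, |p x - r x| ≤ (∫ x, |p x - q x|) + ∫ x, |q x - r x| := by
  rw [← integral_add (hp.integrable_abs_sub hq) (hq.integrable_abs_sub hr)]
  exact integral_mono (hp.integrable_abs_sub hr)
    ((hp.integrable_abs_sub hq).add (hq.integrable_abs_sub hr)) fun x => _root_.abs_sub_le _ _ _

theorem measurable_fst (hp : IsProfile R M p) : Measurable fun z : ℝ × ℝ => p z.1 :=
  hp.measurable.comp _root_.measurable_fst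

theorem measurable_snd (hp : IsProfile R M p) : Measurable fun z : ℝ × ℝ => p z.2 :=
  hp.measurable.comp _root_.measurable_snd

variable {k : ℝ → ℝ}

theorem integrable_abs_sub_mul (hp : IsProfile R M p) (hq : IsProfile R M q)
    (hk : Integrable k) (hkm : Measurable k) :
    Integrable fun z : ℝ × ℝ => |p z.1 - q z.2| * k (z.1 - z.2) := by
  refine integrable_of_abs_le_add_mul_sub hp.integrable hq.integrable hk.abs
    (((hp.measurable_fst.sub hq.measurable_snd).abs.mul
      (hkm.comp (_root_.measurable_fst.sub _root_.measurable_snd))).aestronglyMeasurable) fun z => ?_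
  rw [abs_mul, abs_abs]
  exact mul_le_mul_of_nonneg_right (hp.abs_sub_le hq _ _) (abs_nonneg _)

end IsProfile

/-! ### The Kuznetsov functional -/

section Kuznetsov

variable {R M m ε : ℝ} {p q r η : ℝ → ℝ}

theorem IsMollifier.measurable (hη : IsMollifier m ε η) : Measurable η :=
  hη.contDiff.continuous.measurable

theorem IsMollifier.continuous_deriv (hη : IsMollifier m ε η) : Continuous (deriv η) :=
  hη.contDiff.continuous_deriv le_rfl

theorem IsMollifier.integrable_deriv (hη : IsMollifier m ε η) : Integrable (deriv η) :=
  (hη.integrable.const_mul (2 / ε)).mono' hη.continuous_deriv.aestronglyMeasurable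
    (Eventually.of_forall hη.abs_deriv_le)

theorem IsMollifier.deriv_neg (hη : IsMollifier m ε η) (z : ℝ) :
    deriv η (-z) = -deriv η z := by
  have h : (fun x => η (-x)) = η := funext hη.even
  have := deriv_comp_neg η z
  rw [h] at this
  linarith

/-- The derivative is odd, which avoids any discussion of boundary values at infinity. -/
theorem IsMollifier.integral_deriv (hη : IsMollifier m ε η) : ∫ z, deriv η z = 0 := by
  have h := integral_neg_eq_self (deriv η) volume
  simp_rw [hη.deriv_neg, integral_neg] at h
  linarith

theorem kuznetsov_nonneg (hη : IsMollifier m ε η) : 0 ≤ kuznetsov η p q :=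
  integral_nonneg fun _ => mul_nonneg (abs_nonneg _) (hη.nonneg _)

theorem kuznetsov_comm (hη : IsMollifier m ε η) : kuznetsov η p q = kuznetsov η q p := by
  unfold kuznetsov
  rw [Measure.volume_eq_prod, ← integral_prod_swap]
  congr 1; ext z
  simp only [Prod.fst_swap, Prod.snd_swap]
  rw [abs_sub_comm, ← hη.even, neg_sub]

theorem kuznetsov_le (hη : IsMollifier m ε η) (hp : IsProfile R M p) (hq : IsProfile R M q) :
    kuznetsov η p q ≤ 2 * M := by
  have h := abs_integral_le_add_mul_sub hp.integrable hq.integrable hη.integrable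
    (F := fun z => |p z.1 - q z.2| * η (z.1 - z.2)) fun z => by
      rw [abs_mul, abs_abs, abs_of_nonneg (hη.nonneg _)]
      exact mul_le_mul_of_nonneg_right (hp.abs_sub_le hq _ _) (hη.nonneg _)
  rw [hη.integral_eq] at h
  unfold kuznetsov
  linarith [le_abs_self (∫ z : ℝ × ℝ, |p z.1 - q z.2| * η (z.1 - z.2)),
    hp.integral_le, hq.integral_le]

/-- The triangle inequality at the point `y`: there `|q - r|` depends on `y` only, so `η` integrates
out to `1`. -/
theorem kuznetsov_le_add (hη : IsMollifier m ε η) (hp : IsProfile R M p) (hq : IsProfile R M q)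
    (hr : IsProfile R M r) :
    kuznetsov η p r ≤ kuznetsov η p q + ∫ x, |q x - r x| := by
  have h2 := integral_snd_mul_sub (hq.integrable_abs_sub hr) hη.integrable
  have h3 := integrable_snd_mul_sub (hq.integrable_abs_sub hr) hη.integrable
  rw [hη.integral_eq, mul_one] at h2
  unfold kuznetsov
  rw [← h2, ← integral_add (hp.integrable_abs_sub_mul hq hη.integrable hη.measurable) h3]
  refine integral_mono (hp.integrable_abs_sub_mul hr hη.integrable hη.measurable)
    ((hp.integrable_abs_sub_mul hq hη.integrable hη.measurable).add h3) fun z => ?_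
  beta_reduce
  rw [← add_mul]
  exact mul_le_mul_of_nonneg_right (abs_sub_le _ _ _) (hη.nonneg _)

/-- Insert `p(x)` between `p(y)` and `q(y)` and average in `x`. The smoothing error involves only
one of the two profiles, so spatial regularity of the other is never needed. -/
theorem integral_abs_sub_le_kuznetsov (hη : IsMollifier m ε η) (hp : IsProfile R M p)
    (hq : IsProfile R M q) :
    ∫ x, |p x - q x| ≤ kuznetsov η p p + kuznetsov η p q := by
  have h2 := integral_snd_mul_sub (hp.integrable_abs_sub hq) hη.integrable
  have h3 := integrable_snd_mul_sub (hp.integrable_abs_sub hq) hη.integrable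
  rw [hη.integral_eq, mul_one] at h2
  unfold kuznetsov
  rw [← h2, ← integral_add (hp.integrable_abs_sub_mul hp hη.integrable hη.measurable)
    (hp.integrable_abs_sub_mul hq hη.integrable hη.measurable)]
  refine integral_mono h3 ((hp.integrable_abs_sub_mul hp hη.integrable hη.measurable).add
    (hp.integrable_abs_sub_mul hq hη.integrable hη.measurable)) fun z => ?_
  beta_reduce
  rw [← add_mul]
  refine mul_le_mul_of_nonneg_right ?_ (hη.nonneg _)
  rw [abs_sub_comm (p z.1) (p z.2)]
  exact abs_sub_le _ _ _

end Kuznetsov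

/-! ### Existence of mollifiers -/

theorem abs_mul_inv_sq_le (z : ℝ) : |z| * ((1 + z ^ 2)⁻¹) ^ 2 ≤ (1 + z ^ 2)⁻¹ := by
  have h : 0 < 1 + z ^ 2 := by positivity
  have h1 : |z| ≤ 1 + z ^ 2 := by nlinarith [sq_abs z, sq_nonneg (|z| - 1), abs_nonneg z]
  calc |z| * ((1 + z ^ 2)⁻¹) ^ 2 ≤ (1 + z ^ 2) * ((1 + z ^ 2)⁻¹) ^ 2 := by gcongr
    _ = (1 + z ^ 2)⁻¹ := by field_simp

/-- Mollifiers exist at every scale, with a uniform constant in the first moment. -/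
theorem exists_isMollifier : ∃ m : ℝ, 0 ≤ m ∧ ∀ ε : ℝ, 0 < ε → ∃ η, IsMollifier m ε η := by
  -- A kernel with compact support cannot dominate its own derivative pointwise. Here `k'/k = -4z/(1
  -- + z²)` is bounded by `2`, and `|z| |k'|/k` by `4`. The square makes the first moment finite.
  set k : ℝ → ℝ := fun z => ((1 + z ^ 2)⁻¹) ^ 2 with hk
  have hpos : ∀ z : ℝ, 0 < 1 + z ^ 2 := fun z => by positivity
  have hkpos : ∀ z, 0 < k z := fun z => by have := hpos z; simp only [hk]; positivity
  have hinv1 : ∀ z : ℝ, (1 + z ^ 2)⁻¹ ≤ 1 := fun z =>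
    inv_le_one_of_one_le₀ (by nlinarith [sq_nonneg z])
  have hcd : ContDiff ℝ 1 k := by
    simp only [hk]
    exact ((contDiff_const.add (contDiff_id.pow 2)).inv fun z => (hpos z).ne').pow 2
  have hki : Integrable k := by
    refine integrable_inv_one_add_sq.mono' hcd.continuous.aestronglyMeasurable
      (Eventually.of_forall fun z => ?_)
    rw [Real.norm_of_nonneg (hkpos z).le]
    have := hpos z
    simp only [hk]
    nlinarith [hinv1 z, inv_pos.2 (hpos z)]
  have hzki : Integrable fun z => |z| * k z := by
    refine integrable_inv_one_add_sq.mono' ((continuous_abs.mul hcd.continuous).aestronglyMeasurable)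
      (Eventually.of_forall fun z => ?_)
    rw [Real.norm_of_nonneg (mul_nonneg (abs_nonneg z) (hkpos z).le)]
    exact abs_mul_inv_sq_le z
  have hIpos : 0 < ∫ z, k z := by
    rw [integral_pos_iff_support_of_nonneg (fun z => (hkpos z).le) hki]
    have : Function.support k = univ := by
      ext z; simp [(hkpos z).ne']
    simp [this]
  set I := ∫ z, k z with hI
  have hderiv : ∀ z, HasDerivAt k (-(4 * z) * (1 + z ^ 2)⁻¹ * k z) z := by
    intro z
    have h1 : HasDerivAt (fun z : ℝ => 1 + z ^ 2) (2 * z) z := by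
      simpa using (hasDerivAt_pow 2 z).const_add 1
    have h2 := (h1.inv (hpos z).ne').pow 2
    refine h2.congr_deriv ?_
    have := (hpos z).ne'
    simp only [hk, Pi.inv_apply, Nat.cast_ofNat, Nat.reduceSub, pow_one]
    field_simp
    ring
  refine ⟨(∫ z, |z| * k z) / I, div_nonneg (integral_nonneg fun z =>
    mul_nonneg (abs_nonneg z) (hkpos z).le) hIpos.le, fun ε hε => ?_⟩
  refine ⟨fun z => (I * ε)⁻¹ * k (z / ε), ?_⟩
  have hIε : 0 < (I * ε)⁻¹ := by positivity
  have hd : ∀ z, deriv (fun z => (I * ε)⁻¹ * k (z / ε)) z =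
      (I * ε)⁻¹ * ((-(4 * (z / ε)) * (1 + (z / ε) ^ 2)⁻¹ * k (z / ε)) * (1 / ε)) := by
    intro z
    have h3 : HasDerivAt (fun z : ℝ => z / ε) (1 / ε) z := (hasDerivAt_id z).div_const ε
    exact (((hderiv (z / ε)).comp z h3).const_mul _).deriv
  have hzero : ∀ w : ℝ, |w| * (1 + w ^ 2)⁻¹ ≤ 1 / 2 := fun w => by
    rw [← div_eq_mul_inv, div_le_div_iff₀ (hpos w) two_pos]
    nlinarith [sq_abs w, sq_nonneg (|w| - 1)]
  have hsq : ∀ w : ℝ, w ^ 2 * (1 + w ^ 2)⁻¹ ≤ 1 := fun w => by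
    rw [← div_eq_mul_inv, div_le_one (hpos w)]; linarith
  have hbd : ∀ z, |deriv (fun z => (I * ε)⁻¹ * k (z / ε)) z| =
      4 / ε * (|z / ε| * (1 + (z / ε) ^ 2)⁻¹) * ((I * ε)⁻¹ * k (z / ε)) := by
    intro z
    rw [hd, abs_mul, abs_mul, abs_mul, abs_mul, abs_neg, abs_mul, abs_of_pos hIε,
      abs_of_pos (hkpos _), abs_of_pos (inv_pos.2 (hpos (z / ε))), abs_of_pos (one_div_pos.2 hε),
      abs_of_pos (by norm_num : (0 : ℝ) < 4)]
    ring
  refine ⟨hε, contDiff_const.mul (hcd.comp (contDiff_id.div_const ε)),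
    fun z => mul_nonneg hIε.le (hkpos _).le, fun z => by simp [hk, neg_div],
    (hki.comp_div hε.ne').const_mul _, ?_, ?_, ?_, fun z => ?_, fun z => ?_⟩
  · rw [integral_const_mul, Measure.integral_comp_div, abs_of_pos hε, smul_eq_mul, ← hI]
    field_simp
  · have := ((hzki.comp_div hε.ne').const_mul (ε * (I * ε)⁻¹))
    refine this.congr (Eventually.of_forall fun z => ?_)
    simp only [abs_div, abs_of_pos hε]
    field_simp
  · have : (fun z => |z| * ((I * ε)⁻¹ * k (z / ε))) =
        fun z => (ε * (I * ε)⁻¹) * (|z / ε| * k (z / ε)) := by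
      ext z
      simp only [abs_div, abs_of_pos hε]
      field_simp
    rw [this, integral_const_mul, Measure.integral_comp_div (fun w => |w| * k w), abs_of_pos hε,
      smul_eq_mul]
    apply le_of_eq
    field_simp
  · rw [hbd]
    refine mul_le_mul_of_nonneg_right ?_ (mul_nonneg hIε.le (hkpos _).le)
    calc 4 / ε * (|z / ε| * (1 + (z / ε) ^ 2)⁻¹) ≤ 4 / ε * (1 / 2) := by
          gcongr; exact hzero _
      _ = 2 / ε := by ring
  · rw [hbd, ← mul_assoc]
    refine mul_le_mul_of_nonneg_right ?_ (mul_nonneg hIε.le (hkpos _).le)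
    calc |z| * (4 / ε * (|z / ε| * (1 + (z / ε) ^ 2)⁻¹))
        = 4 * (|z / ε| ^ 2 * (1 + (z / ε) ^ 2)⁻¹) := by
          rw [abs_div, abs_of_pos hε]; field_simp
      _ ≤ 4 * 1 := by rw [sq_abs]; gcongr; exact hsq _
      _ = 4 := by ring


/-! ### Kruzhkov flux and the doubled rate -/

theorem Real.measurable_sign : Measurable Real.sign := by
  unfold Real.sign
  exact Measurable.ite measurableSet_Iio measurable_const
    (Measurable.ite measurableSet_Ioi measurable_const measurable_const)

theorem Real.abs_sign_le (a : ℝ) : |Real.sign a| ≤ 1 := by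
  rcases Real.sign_apply_eq a with h | h | h <;> rw [h] <;> norm_num

theorem kruzhkovFlux_comm (g : ℝ → ℝ) (a c : ℝ) : kruzhkovFlux g a c = kruzhkovFlux g c a := by
  unfold kruzhkovFlux
  rw [← neg_sub c a, Real.sign_neg]; ring

/-- Contribution of one of the two variables to the doubled entropy inequality. -/
noncomputable def kruzhkovRate (g : ℝ → ℝ) (α β : (ℝ → ℝ) → ℝ → ℝ) (η p p' q : ℝ → ℝ) : ℝ :=
  ∫ z : ℝ × ℝ, (kruzhkovFlux g (p z.1) (q z.2) * α p' z.1 * deriv η (z.1 - z.2)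
    - Real.sign (p z.1 - q z.2) * g (q z.2) * β p' z.1 * η (z.1 - z.2))

section

variable {R M C m ε : ℝ} {g η p q p' q' : ℝ → ℝ} {α β : (ℝ → ℝ) → ℝ → ℝ}

theorem IsFlux.α_measurable' (h : IsFlux R M C g α β) (hp : IsProfile R M p) :
    Measurable (α p) :=
  (h.α_measurable (fun _ => p) (hp.measurable.comp measurable_snd) fun _ => hp).comp
    (measurable_const.prodMk measurable_id : Measurable fun x : ℝ => ((0 : ℝ), x))

theorem IsFlux.β_measurable' (h : IsFlux R M C g α β) (hp : IsProfile R M p) :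
    Measurable (β p) :=
  (h.β_measurable (fun _ => p) (hp.measurable.comp measurable_snd) fun _ => hp).comp
    (measurable_const.prodMk measurable_id : Measurable fun x : ℝ => ((0 : ℝ), x))

theorem IsFlux.abs_flux_le (h : IsFlux R M C g α β) {a c : ℝ} (ha : a ∈ Icc 0 R)
    (hc : c ∈ Icc 0 R) : |kruzhkovFlux g a c| ≤ C * |a - c| := by
  unfold kruzhkovFlux
  rw [abs_mul]
  calc _ ≤ 1 * |g a - g c| := mul_le_mul_of_nonneg_right (Real.abs_sign_le _) (abs_nonneg _)
    _ ≤ _ := by rw [one_mul]; exact h.g_lip a ha c hc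

/-- The jump of the sign does no harm, because the flux vanishes where the sign changes. If `c` is
not strictly between `a` and `b`, the difference is `±(g a - g b)`; otherwise the bounds by `C|a -
c|` and `C|b - c|` add up to exactly `C|a - b|`. -/
theorem IsFlux.abs_flux_sub_flux_le (h : IsFlux R M C g α β) {a b c : ℝ} (ha : a ∈ Icc 0 R)
    (hb : b ∈ Icc 0 R) (hc : c ∈ Icc 0 R) :
    |kruzhkovFlux g a c - kruzhkovFlux g b c| ≤ C * |a - b| := by
  wlog hab : a ≤ b generalizing a b
  · rw [abs_sub_comm, abs_sub_comm a b]; exact this hb ha (le_of_not_ge hab)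
  have h1 := h.g_lip a ha b hb
  by_cases hs : c ≤ a ∨ b ≤ c
  · have : kruzhkovFlux g a c - kruzhkovFlux g b c = g a - g b ∨
        kruzhkovFlux g a c - kruzhkovFlux g b c = -(g a - g b) := by
      unfold kruzhkovFlux
      rcases hs with hs | hs
      · left
        rcases hs.eq_or_lt with rfl | hs
        · rcases hab.eq_or_lt with rfl | hab
          · simp
          · rw [Real.sign_of_pos (sub_pos.2 hab)]; simp
        · rw [Real.sign_of_pos (sub_pos.2 hs), Real.sign_of_pos (by linarith)]; ring
      · right
        rcases hs.eq_or_lt with rfl | hs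
        · rcases hab.eq_or_lt with rfl | hab
          · simp
          · rw [Real.sign_of_neg (sub_neg.2 hab)]; simp
        · rw [Real.sign_of_neg (sub_neg.2 hs), Real.sign_of_neg (by linarith)]; ring
    rcases this with h2 | h2 <;> rw [h2]
    · exact h1
    · rw [abs_neg]; exact h1
  · push Not at hs
    calc |kruzhkovFlux g a c - kruzhkovFlux g b c|
        ≤ |kruzhkovFlux g a c| + |kruzhkovFlux g b c| := abs_sub _ _
      _ ≤ C * |a - c| + C * |b - c| := add_le_add (h.abs_flux_le ha hc) (h.abs_flux_le hb hc)
      _ = C * |a - b| := by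
        rw [abs_of_neg (sub_neg.2 hs.1), abs_of_pos (sub_pos.2 hs.2),
          abs_of_neg (by linarith : a - b < 0)]; ring

theorem measurable_kruzhkovFlux (hg : Measurable g) :
    Measurable fun z : ℝ × ℝ => kruzhkovFlux g z.1 z.2 :=
  (Real.measurable_sign.comp (measurable_fst.sub measurable_snd)).mul
    ((hg.comp measurable_fst).sub (hg.comp measurable_snd))

theorem IsFlux.abs_rate_integrand_le (h : IsFlux R M C g α β) (hη : IsMollifier m ε η)
    (hp : IsProfile R M p) (hp' : IsProfile R M p') (hq : IsProfile R M q) (z : ℝ × ℝ) :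
    |kruzhkovFlux g (p z.1) (q z.2) * α p' z.1 * deriv η (z.1 - z.2)
      - Real.sign (p z.1 - q z.2) * g (q z.2) * β p' z.1 * η (z.1 - z.2)| ≤
      (p z.1 + q z.2) * (C * C * |deriv η (z.1 - z.2)| + C * η (z.1 - z.2)) := by
  have h1 : |kruzhkovFlux g (p z.1) (q z.2)| ≤ C * (p z.1 + q z.2) :=
    (h.abs_flux_le (hp.mem_Icc _) (hq.mem_Icc _)).trans
      (mul_le_mul_of_nonneg_left (hp.abs_sub_le hq _ _) h.C_nonneg)
  have h2 := h.α_bound p' hp' z.1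
  have h3 := h.β_bound p' hp' z.1
  have h4 : |Real.sign (p z.1 - q z.2) * g (q z.2)| ≤ p z.1 + q z.2 := by
    rw [abs_mul, abs_of_nonneg (h.g_nonneg _ (hq.mem_Icc _))]
    calc _ ≤ 1 * q z.2 := mul_le_mul (Real.abs_sign_le _) (h.g_le _ (hq.mem_Icc _))
          (h.g_nonneg _ (hq.mem_Icc _)) zero_le_one
      _ ≤ _ := by linarith [hp.nonneg z.1]
  have h0 : 0 ≤ p z.1 + q z.2 := add_nonneg (hp.nonneg _) (hq.nonneg _)
  refine (abs_sub _ _).trans ?_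
  rw [abs_mul, abs_mul, abs_mul _ (η _), abs_mul _ (β _ _), abs_of_nonneg (hη.nonneg (z.1 - z.2)),
    mul_add]
  refine add_le_add ?_ ?_
  · calc _ ≤ (C * (p z.1 + q z.2)) * C * |deriv η (z.1 - z.2)| := by
          gcongr; exact mul_nonneg h.C_nonneg h0
      _ = _ := by ring
  · calc _ ≤ (p z.1 + q z.2) * C * η (z.1 - z.2) := by
          gcongr; exact hη.nonneg _
      _ = _ := by ring

theorem IsMollifier.integrable_rateKernel (hη : IsMollifier m ε η) (C : ℝ) :
    Integrable fun z => C * C * |deriv η z| + C * η z :=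
  (hη.integrable_deriv.abs.const_mul _).add (hη.integrable.const_mul _)

theorem IsMollifier.integral_abs_deriv_le (hη : IsMollifier m ε η) :
    ∫ z, |deriv η z| ≤ 2 / ε := by
  have h := integral_mono hη.integrable_deriv.abs (hη.integrable.const_mul (2 / ε))
    hη.abs_deriv_le
  rwa [integral_const_mul, hη.integral_eq, mul_one] at h

theorem IsFlux.integrable_rate (h : IsFlux R M C g α β) (hη : IsMollifier m ε η)
    (hp : IsProfile R M p) (hp' : IsProfile R M p') (hq : IsProfile R M q) :
    Integrable fun z : ℝ × ℝ => kruzhkovFlux g (p z.1) (q z.2) * α p' z.1 * deriv η (z.1 - z.2)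
      - Real.sign (p z.1 - q z.2) * g (q z.2) * β p' z.1 * η (z.1 - z.2) := by
  refine integrable_of_abs_le_add_mul_sub hp.integrable hq.integrable (hη.integrable_rateKernel C)
    (Measurable.aestronglyMeasurable ?_) (h.abs_rate_integrand_le hη hp hp' hq)
  have h1 := (measurable_kruzhkovFlux h.g_continuous.measurable).comp
    (hp.measurable_fst.prodMk hq.measurable_snd)
  have h2 := (h.α_measurable' hp').comp (measurable_fst : Measurable fun z : ℝ × ℝ => z.1)
  have h3 := (h.β_measurable' hp').comp (measurable_fst : Measurable fun z : ℝ × ℝ => z.1)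
  have hs : Measurable fun z : ℝ × ℝ => z.1 - z.2 := measurable_fst.sub measurable_snd
  exact ((h1.mul h2).mul (hη.continuous_deriv.measurable.comp hs)).sub
    ((((Real.measurable_sign.comp (hp.measurable_fst.sub hq.measurable_snd)).mul
      (h.g_continuous.measurable.comp hq.measurable_snd)).mul h3).mul (hη.measurable.comp hs))

theorem IsFlux.abs_rate_le (h : IsFlux R M C g α β) (hη : IsMollifier m ε η)
    (hp : IsProfile R M p) (hp' : IsProfile R M p') (hq : IsProfile R M q) :
    |kruzhkovRate g α β η p p' q| ≤ 2 * M * (C * C * (2 / ε) + C) := by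
  have h1 := abs_integral_le_add_mul_sub hp.integrable hq.integrable (hη.integrable_rateKernel C)
    (h.abs_rate_integrand_le hη hp hp' hq)
  rw [integral_add (hη.integrable_deriv.abs.const_mul _) (hη.integrable.const_mul _),
    integral_const_mul, integral_const_mul, hη.integral_eq, mul_one] at h1
  have hC := h.C_nonneg
  have hε := hη.ε_pos
  refine h1.trans (mul_le_mul (by linarith [hp.integral_le, hq.integral_le]) ?_ ?_ ?_)
  · gcongr; exact hη.integral_abs_deriv_le
  · exact add_nonneg (mul_nonneg (mul_nonneg hC hC) (integral_nonneg fun z => abs_nonneg _)) hC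
  · linarith [h.M_nonneg]

/-- The combined contributions of both variables are controlled by quantities without derivatives
of the profiles. -/
theorem IsFlux.rate_add_rate_le (h : IsFlux R M C g α β) (hη : IsMollifier m ε η) (hm : 0 ≤ m)
    (hp : IsProfile R M p) (hp' : IsProfile R M p') (hq : IsProfile R M q)
    (hq' : IsProfile R M q') :
    kruzhkovRate g α β η p p' q + kruzhkovRate g α β η q q' p ≤
      (5 * C ^ 2 + R * C) * (1 + m) * (kuznetsov η p q + kuznetsov η p' q' + ε
        + (1 + kuznetsov η p p / ε) * ∫ z, |p' z - q' z|) := by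
  have hC := h.C_nonneg
  have hR := h.R_nonneg
  have hε := hη.ε_pos
  set N := ∫ z, |p' z - q' z| with hN
  have hN0 : 0 ≤ N := integral_nonneg fun z => abs_nonneg _
  have hs : Measurable fun z : ℝ × ℝ => z.1 - z.2 := measurable_fst.sub measurable_snd
  -- Exchanging the variables brings both rates to the same pair of points. Since `η` is even and
  -- its derivative odd, the two flux terms acquire opposite signs, and only the difference of the
  -- speeds remains.
  have hswap : kruzhkovRate g α β η q q' p =
      ∫ z : ℝ × ℝ, (-(kruzhkovFlux g (p z.1) (q z.2) * α q' z.2 * deriv η (z.1 - z.2))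
        + Real.sign (p z.1 - q z.2) * g (p z.1) * β q' z.2 * η (z.1 - z.2)) := by
    unfold kruzhkovRate
    rw [Measure.volume_eq_prod, ← integral_prod_swap]
    congr 1; ext z
    simp only [Prod.fst_swap, Prod.snd_swap]
    rw [kruzhkovFlux_comm, ← neg_sub z.1 z.2, hη.deriv_neg, hη.even, ← neg_sub (p z.1) (q z.2),
      Real.sign_neg]
    ring
  have hI2 : Integrable fun z : ℝ × ℝ =>
      (-(kruzhkovFlux g (p z.1) (q z.2) * α q' z.2 * deriv η (z.1 - z.2))
        + Real.sign (p z.1 - q z.2) * g (p z.1) * β q' z.2 * η (z.1 - z.2)) := by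
    have := (h.integrable_rate hη hq hq' hp).swap
    rw [Measure.volume_eq_prod]
    refine this.congr (Eventually.of_forall fun z => ?_)
    simp only [Function.comp, Prod.fst_swap, Prod.snd_swap]
    rw [kruzhkovFlux_comm, ← neg_sub z.1 z.2, hη.deriv_neg, hη.even, ← neg_sub (p z.1) (q z.2),
      Real.sign_neg]
    ring
  have hI1 := h.integrable_rate hη hp hp' hq
  have hK := hp.integrable_abs_sub_mul hq hη.integrable hη.measurable
  obtain ⟨hβi, hβ⟩ := h.β_sub p' q' hp' hq' η hη.measurable hη.nonneg hη.integrable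
    hη.integrable_abs_mul
  rw [hη.integral_eq, mul_one] at hβ
  -- the part of the speed difference in one point, on which one integrates by parts
  set e : ℝ → ℝ := fun y => α p' y - α q' y with he
  have hem : Measurable e := (h.α_measurable' hp').sub (h.α_measurable' hq')
  have heb : ∀ y, |e y| ≤ C * N := fun y => h.α_sub p' q' hp' hq' y
  set F : ℝ × ℝ → ℝ := fun z => (kruzhkovFlux g (p z.1) (q z.2)) * e z.2 * deriv η (z.1 - z.2)
  -- `F0` is `F` with `p` frozen at the second point. Its first variable occurs only in the
  -- derivative of `η`, which has mean zero, so `F0` may be subtracted from `F` without changing the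
  -- integral.
  set F0 : ℝ × ℝ → ℝ := fun z => (kruzhkovFlux g (p z.2) (q z.2)) * e z.2 * deriv η (z.1 - z.2)
  have hflux1 := (measurable_kruzhkovFlux h.g_continuous.measurable).comp
    (hp.measurable_fst.prodMk hq.measurable_snd)
  have hflux2 := (measurable_kruzhkovFlux h.g_continuous.measurable).comp
    (hp.measurable.prodMk hq.measurable)
  have hFi : Integrable F := by
    refine integrable_of_abs_le_add_mul_sub hp.integrable hq.integrable
      (hη.integrable_deriv.abs.const_mul (C * (C * N)))
      ((hflux1.mul (hem.comp measurable_snd)).mul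
        (hη.continuous_deriv.measurable.comp hs)).aestronglyMeasurable fun z => ?_
    rw [abs_mul, abs_mul]
    calc _ ≤ (C * (p z.1 + q z.2)) * (C * N) * |deriv η (z.1 - z.2)| := by
          gcongr
          · exact mul_nonneg hC (add_nonneg (hp.nonneg _) (hq.nonneg _))
          · exact (h.abs_flux_le (hp.mem_Icc _) (hq.mem_Icc _)).trans
              (mul_le_mul_of_nonneg_left (hp.abs_sub_le hq _ _) hC)
          · exact heb _
      _ = _ := by ring
  have hF0s : Integrable fun y => kruzhkovFlux g (p y) (q y) * e y := by
    refine ((hp.integrable.add hq.integrable).const_mul (C * (C * N))).mono'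
      (hflux2.mul hem).aestronglyMeasurable (Eventually.of_forall fun y => ?_)
    rw [Real.norm_eq_abs, abs_mul]
    calc _ ≤ (C * (p y + q y)) * (C * N) := by
          gcongr
          · exact mul_nonneg hC (add_nonneg (hp.nonneg _) (hq.nonneg _))
          · exact (h.abs_flux_le (hp.mem_Icc _) (hq.mem_Icc _)).trans
              (mul_le_mul_of_nonneg_left (hp.abs_sub_le hq _ _) hC)
          · exact heb _
      _ = _ := by simp only [Pi.add_apply]; ring
  have hF0i : Integrable F0 := integrable_snd_mul_sub hF0s hη.integrable_deriv
  have hF0 : ∫ z, F0 z = 0 := by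
    have := integral_snd_mul_sub hF0s hη.integrable_deriv
    rw [hη.integral_deriv, mul_zero] at this
    exact this
  have hpp := hp.integrable_abs_sub_mul hp hη.integrable hη.measurable
  -- In `F - F0` the flux difference is at most `C |p(x) - p(y)|`. With the factor `2/ε` from
  -- `abs_deriv_le`, it integrates to the self functional of `p` over `ε`.
  have hFF0 : ∫ z, F z ≤ 2 * C ^ 2 * (kuznetsov η p p / ε * N) := by
    have h1 : ∫ z, (F z - F0 z) = ∫ z, F z := by rw [integral_sub hFi hF0i, hF0, sub_zero]
    rw [← h1]
    have h2 := integral_mono (hFi.sub hF0i) (hpp.const_mul (C * (C * N) * (2 / ε))) fun z => by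
      simp only [Pi.sub_apply, F, F0]
      refine (le_abs_self _).trans ?_
      rw [← sub_mul, ← sub_mul, abs_mul, abs_mul]
      calc _ ≤ (C * |p z.1 - p z.2|) * (C * N) * (2 / ε * η (z.1 - z.2)) := by
            gcongr
            · exact h.abs_flux_sub_flux_le (hp.mem_Icc _) (hp.mem_Icc _) (hq.mem_Icc _)
            · exact heb _
            · exact hη.abs_deriv_le _
        _ = C * (C * N) * (2 / ε) * (|p z.1 - p z.2| * η (z.1 - z.2)) := by ring
    rw [integral_const_mul] at h2
    refine h2.trans (le_of_eq ?_)
    unfold kuznetsov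
    field_simp
  have hmain : kruzhkovRate g α β η p p' q + kruzhkovRate g α β η q q' p ≤
      ∫ z : ℝ × ℝ, (F z + (5 * C ^ 2 * (|p z.1 - q z.2| * η (z.1 - z.2)) +
        R * (|β p' z.1 - β q' z.2| * η (z.1 - z.2)))) := by
    rw [hswap, kruzhkovRate, ← integral_add hI1 hI2]
    refine integral_mono (hI1.add hI2)
      (hFi.add ((hK.const_mul (5 * C ^ 2)).add (hβi.const_mul R))) fun z => ?_
    have hη0 := hη.nonneg (z.1 - z.2)
    -- The change of one speed between the two points gives a factor `|x - y|`, which the derivative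
    -- of `η` tolerates without loss in `ε`. Its constant `4 C²` and the `C²` of `e2` make up `5
    -- C²`.
    have e1 : kruzhkovFlux g (p z.1) (q z.2) * (α p' z.1 - α p' z.2) * deriv η (z.1 - z.2) ≤
        4 * C ^ 2 * (|p z.1 - q z.2| * η (z.1 - z.2)) := by
      refine (le_abs_self _).trans ?_
      rw [abs_mul, abs_mul]
      calc _ ≤ (C * |p z.1 - q z.2|) * (C * |z.1 - z.2|) * |deriv η (z.1 - z.2)| := by
            gcongr
            · exact h.abs_flux_le (hp.mem_Icc _) (hq.mem_Icc _)
            · exact h.α_lip p' hp' _ _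
        _ = C ^ 2 * |p z.1 - q z.2| * (|z.1 - z.2| * |deriv η (z.1 - z.2)|) := by ring
        _ ≤ C ^ 2 * |p z.1 - q z.2| * (4 * η (z.1 - z.2)) := by
            exact mul_le_mul_of_nonneg_left (hη.abs_mul_abs_deriv_le _)
              (mul_nonneg (sq_nonneg C) (abs_nonneg _))
        _ = _ := by ring
    have e2 : Real.sign (p z.1 - q z.2) * (g (p z.1) * β q' z.2 - g (q z.2) * β p' z.1) *
        η (z.1 - z.2) ≤ (C ^ 2 * |p z.1 - q z.2| + R * |β p' z.1 - β q' z.2|) * η (z.1 - z.2) := by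
      refine mul_le_mul_of_nonneg_right ?_ hη0
      refine (le_abs_self _).trans ?_
      rw [abs_mul]
      calc _ ≤ 1 * |g (p z.1) * β q' z.2 - g (q z.2) * β p' z.1| :=
            mul_le_mul_of_nonneg_right (Real.abs_sign_le _) (abs_nonneg _)
        _ = |(g (p z.1) - g (q z.2)) * β q' z.2 - g (q z.2) * (β p' z.1 - β q' z.2)| := by
            rw [one_mul]; ring_nf
        _ ≤ |g (p z.1) - g (q z.2)| * |β q' z.2| + |g (q z.2)| * |β p' z.1 - β q' z.2| := by
            refine (abs_sub _ _).trans (le_of_eq ?_)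
            rw [abs_mul, abs_mul]
        _ ≤ (C * |p z.1 - q z.2|) * C + R * |β p' z.1 - β q' z.2| := by
            gcongr
            · exact h.g_lip _ (hp.mem_Icc _) _ (hq.mem_Icc _)
            · exact h.β_bound _ hq' _
            · rw [abs_of_nonneg (h.g_nonneg _ (hq.mem_Icc _))]
              exact (h.g_le _ (hq.mem_Icc _)).trans (hq.le _)
        _ = _ := by ring
    simp only [F, he]
    linarith
  refine hmain.trans ?_
  have hsum : Integrable fun z : ℝ × ℝ => 5 * C ^ 2 * (|p z.1 - q z.2| * η (z.1 - z.2)) +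
      R * (|β p' z.1 - β q' z.2| * η (z.1 - z.2)) :=
    (hK.const_mul (5 * C ^ 2)).add (hβi.const_mul R)
  rw [integral_add hFi hsum,
    integral_add (hK.const_mul (5 * C ^ 2)) (hβi.const_mul R), integral_const_mul,
    integral_const_mul]
  change (∫ z, F z) + (5 * C ^ 2 * kuznetsov η p q + _) ≤ _
  have hΦ := kuznetsov_nonneg (p := p) (q := q) hη
  have hΦ' := kuznetsov_nonneg (p := p') (q := q') hη
  have hJ : 0 ≤ kuznetsov η p p / ε := div_nonneg (kuznetsov_nonneg hη) hε.le
  set X := kuznetsov η p p / ε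
  set Φ := kuznetsov η p q
  set Φ' := kuznetsov η p' q'
  have hJN : 0 ≤ X * N := mul_nonneg hJ hN0
  have hS : 0 ≤ Φ + Φ' + ε + (1 + X) * N := by nlinarith
  have hβ2 : R * ∫ z : ℝ × ℝ, |β p' z.1 - β q' z.2| * η (z.1 - z.2) ≤
      R * C * (Φ' + N + m * ε) := by
    rw [mul_assoc]
    exact mul_le_mul_of_nonneg_left (hβ.trans
      (mul_le_mul_of_nonneg_left (by linarith [hη.integral_abs_mul]) hC)) hR
  have hRC : 0 ≤ R * C := mul_nonneg hR hC
  have hCC : 0 ≤ C ^ 2 := sq_nonneg C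
  calc _ ≤ 2 * C ^ 2 * (X * N) + (5 * C ^ 2 * Φ + R * C * (Φ' + N + m * ε)) := by linarith
    _ ≤ 5 * C ^ 2 * (Φ + Φ' + ε + (1 + X) * N)
        + R * C * ((1 + m) * (Φ + Φ' + ε + (1 + X) * N)) := by
      have a1 : R * C * (Φ' + N + m * ε) ≤ R * C * ((1 + m) * (Φ + Φ' + ε + (1 + X) * N)) := by
        refine mul_le_mul_of_nonneg_left ?_ hRC
        nlinarith [mul_nonneg hm hΦ, mul_nonneg hm hΦ', mul_nonneg hm hJN, mul_nonneg hm hN0]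
      have a2 : 0 ≤ C ^ 2 * (Φ' + ε + N) := mul_nonneg hCC (by linarith)
      have a3 : 0 ≤ C ^ 2 * (X * N) := mul_nonneg hCC hJN
      nlinarith
    _ ≤ _ := by
      have : 0 ≤ 5 * C ^ 2 * (m * (Φ + Φ' + ε + (1 + X) * N)) := by positivity
      nlinarith

end


/-! ### Differential inequalities in time -/

/-- Nonnegative `C¹` test functions of time vanishing near `T`. -/
structure IsTimeTest (T : ℝ) (χ : ℝ → ℝ) : Prop where
  contDiff : ContDiff ℝ 1 χ
  nonneg : ∀ t, 0 ≤ χ t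
  eq_zero : ∃ T' < T, ∀ t, T' ≤ t → χ t = 0

theorem IsTimeTest.continuous_deriv {T : ℝ} {χ : ℝ → ℝ} (h : IsTimeTest T χ) :
    Continuous (deriv χ) := h.contDiff.continuous_deriv le_rfl

/-- These smoothed steps have derivative `-ζ`. When `ζ` concentrates at a time, they extract the
value there from a distributional inequality. -/
theorem isTimeTest_integral {T T' : ℝ} {ζ : ℝ → ℝ} (hζ : Continuous ζ) (h0 : ∀ s, 0 ≤ ζ s)
    (hT' : T' < T) (hz : ∀ s, T' ≤ s → ζ s = 0) :
    IsTimeTest T (fun t => ∫ s in t..T, ζ s) ∧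
      ∀ t, HasDerivAt (fun t => ∫ s in t..T, ζ s) (-ζ t) t := by
  have hd : ∀ t, HasDerivAt (fun t => ∫ s in t..T, ζ s) (-ζ t) t := fun t =>
    intervalIntegral.integral_hasDerivAt_left (hζ.intervalIntegrable _ _)
      hζ.aestronglyMeasurable.stronglyMeasurableAtFilter hζ.continuousAt
  have hzero : ∀ t, T' ≤ t → ∫ s in t..T, ζ s = 0 := fun t ht => by
    refine intervalIntegral.integral_zero_ae (Eventually.of_forall fun s hs => hz s ?_)
    have := (uIoc_subset_uIcc hs).1
    exact le_trans (le_inf ht hT'.le) this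
  refine ⟨⟨contDiff_one_iff_deriv.2 ⟨fun t => (hd t).differentiableAt, ?_⟩, fun t => ?_,
    T', hT', hzero⟩, hd⟩
  · rw [show deriv (fun t => ∫ s in t..T, ζ s) = fun t => -ζ t from funext fun t => (hd t).deriv]
    exact hζ.neg
  · rcases le_or_gt t T with h | h
    · exact intervalIntegral.integral_nonneg h fun s _ => h0 s
    · exact (hzero t (hT'.le.trans h.le)).ge

/-- A differential inequality `m' ≤ e`, `m(0) = m₀`, in the sense of distributions holds in
integrated form. -/
theorem ae_le_of_forall_isTimeTest {T m₀ : ℝ} (hT : 0 < T) {m e : ℝ → ℝ}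
    (hm : IntervalIntegrable m volume 0 T) (he : IntervalIntegrable e volume 0 T)
    (h : ∀ χ, IsTimeTest T χ →
      0 ≤ (∫ t in (0 : ℝ)..T, (deriv χ t * m t + χ t * e t)) + χ 0 * m₀) :
    ∀ᵐ t ∂(volume.restrict (Icc 0 T)), m t ≤ m₀ + ∫ s in (0 : ℝ)..t, e s := by
  set E : ℝ → ℝ := fun t => ∫ s in (0 : ℝ)..t, e s with hE
  have hEac : AbsolutelyContinuousOnInterval E 0 T :=
    he.absolutelyContinuousOnInterval_intervalIntegral (by simp)
  have hEi : IntervalIntegrable E volume 0 T := hEac.continuousOn.intervalIntegrable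
  set D : ℝ → ℝ := indicator (Icc 0 T) fun t => m₀ + E t - m t with hD
  have hDint : IntervalIntegrable (fun t => m₀ + E t - m t) volume 0 T :=
    ((intervalIntegrable_const).add hEi).sub hm
  have hDi : Integrable D := by
    rw [hD, integrable_indicator_iff measurableSet_Icc]
    exact (intervalIntegrable_iff_integrableOn_Icc_of_le hT.le).1 hDint
  -- The inner radius is half the outer one: Lebesgue differentiation through `ContDiffBump`
  -- requires a bounded ratio of radii, here `2`.
  set φ : ℕ → ContDiffBump (0 : ℝ) := fun n =>
    ⟨1 / (n + 1) / 2, 1 / (n + 1), by positivity, by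
      have : (0 : ℝ) < 1 / (n + 1) := by positivity
      linarith⟩ with hφ
  have hlim : Tendsto (fun n => (φ n).rOut) atTop (𝓝 0) := tendsto_one_div_add_atTop_nhds_zero_nat
  have hconv := ContDiffBump.ae_convolution_tendsto_right_of_locallyIntegrable (μ := volume)
    (g := D) (K := 2) hlim (Eventually.of_forall fun n => by simp only [hφ]; linarith)
    hDi.locallyIntegrable
  have hne : ∀ᵐ t : ℝ, t ≠ T := by simp [ae_iff, measure_singleton]
  rw [ae_restrict_iff' measurableSet_Icc]
  filter_upwards [hconv, hne] with x hx hxT hxI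
  have hxlt : x < T := lt_of_le_of_ne hxI.2 hxT
  suffices hDx : 0 ≤ D x by
    rw [hD, indicator_of_mem hxI] at hDx
    linarith
  refine ge_of_tendsto hx ?_
  -- The bump around `x` must end before `T`, so that its integral from `t` to `T` is an admissible
  -- test function. It may reach below `0`, where `D` is zero.
  have hev : ∀ᶠ n in atTop, (φ n).rOut < T - x := hlim.eventually (gt_mem_nhds (by linarith))
  filter_upwards [hev] with n hn
  set ζ : ℝ → ℝ := fun s => (φ n).normed volume (x - s) with hζdef
  have hζ : Continuous ζ := (φ n).continuous_normed.comp (continuous_const.sub continuous_id)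
  have hζ0 : ∀ s, 0 ≤ ζ s := fun s => (φ n).nonneg_normed _
  have hζz : ∀ s, x + (φ n).rOut ≤ s → ζ s = 0 := fun s hs => by
    have : x - s ∉ Function.support ((φ n).normed volume) := by
      rw [(φ n).support_normed_eq, Metric.mem_ball, dist_zero_right, Real.norm_eq_abs, not_lt,
        abs_of_nonpos (by linarith [(φ n).rOut_pos])]
      linarith
    simpa using this
  obtain ⟨hχ, hχd⟩ := isTimeTest_integral hζ hζ0 (by linarith : x + (φ n).rOut < T) hζz
  have key := h _ hχ
  set χ : ℝ → ℝ := fun t => ∫ s in t..T, ζ s with hχdef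
  have hder : deriv χ = fun t => -ζ t := funext fun t => (hχd t).deriv
  have hχac : AbsolutelyContinuousOnInterval χ 0 T :=
    hχ.contDiff.contDiffOn.absolutelyContinuousOnInterval
  -- Since `e` is merely integrable, `E` is only absolutely continuous. The boundary terms vanish
  -- because `χ T = 0` and `E 0 = 0`, so `χ e` turns into `ζ E` and the tested inequality becomes
  -- one on the average of `D`.
  have hparts := AbsolutelyContinuousOnInterval.integral_deriv_mul_eq_sub hχac hEac
  have hχT : χ T = 0 := by simp [hχdef]
  have hE0 : E 0 = 0 := by simp [hE]
  rw [hχT, hE0, zero_mul, mul_zero, sub_zero] at hparts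
  have hEd : ∫ t in (0 : ℝ)..T, (deriv χ t * E t + χ t * deriv E t) =
      ∫ t in (0 : ℝ)..T, (deriv χ t * E t + χ t * e t) := by
    refine intervalIntegral.integral_congr_ae ?_
    filter_upwards [he.ae_hasDerivAt_integral] with t ht hti
    rw [(ht (uIoc_subset_uIcc hti) 0 (by simp)).deriv]
  rw [hEd] at hparts
  have i1 : IntervalIntegrable (fun t => deriv χ t * m t) volume 0 T :=
    hm.continuousOn_mul hχ.continuous_deriv.continuousOn
  have i2 : IntervalIntegrable (fun t => χ t * e t) volume 0 T :=
    he.continuousOn_mul hχ.contDiff.continuous.continuousOn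
  have i3 : IntervalIntegrable (fun t => deriv χ t * E t) volume 0 T :=
    hEi.continuousOn_mul hχ.continuous_deriv.continuousOn
  rw [intervalIntegral.integral_add i1 i2] at key
  rw [intervalIntegral.integral_add i3 i2] at hparts
  have hval : convolution ((φ n).normed volume) D (ContinuousLinearMap.lsmul ℝ ℝ) volume x =
      ∫ s in (0 : ℝ)..T, ζ s * (m₀ + E s - m s) := by
    rw [convolution_eq_swap, intervalIntegral.integral_of_le hT.le, ← integral_Icc_eq_integral_Ioc,
      ← integral_indicator measurableSet_Icc]
    congr 1; ext s
    simp only [ContinuousLinearMap.lsmul_apply, smul_eq_mul, hD]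
    by_cases hs : s ∈ Icc 0 T
    · rw [indicator_of_mem hs, indicator_of_mem hs]
    · rw [indicator_of_notMem hs, indicator_of_notMem hs, mul_zero]
  rw [hval]
  have hsplit : ∫ s in (0 : ℝ)..T, ζ s * (m₀ + E s - m s) =
      (∫ s in (0 : ℝ)..T, ζ s) * m₀ - (∫ s in (0 : ℝ)..T, deriv χ s * E s) +
        ∫ s in (0 : ℝ)..T, deriv χ s * m s := by
    rw [← intervalIntegral.integral_mul_const, ← intervalIntegral.integral_sub
      ((hζ.intervalIntegrable _ _).mul_const _) i3, ← intervalIntegral.integral_add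
      (((hζ.intervalIntegrable _ _).mul_const _).sub i3) i1]
    congr 1; ext s
    rw [hder]; ring
  rw [hsplit]
  linarith

/-- Gronwall's inequality for bounded measurable functions. -/
theorem ae_le_of_ae_le_add_integral {T a c : ℝ} (ha : 0 ≤ a) (hc : 0 ≤ c) {F : ℝ → ℝ}
    (hF : IntervalIntegrable F volume 0 T) (hT : 0 < T)
    (h : ∀ᵐ t ∂(volume.restrict (Icc 0 T)), F t ≤ a + c * ∫ s in (0 : ℝ)..t, F s) :
    ∀ᵐ t ∂(volume.restrict (Icc 0 T)), F t ≤ a * Real.exp (c * T) := by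
  set H : ℝ → ℝ := fun t => ∫ s in (0 : ℝ)..t, F s with hH
  have hHc : ContinuousOn H (Icc 0 T) := by
    have := (hF.absolutelyContinuousOnInterval_intervalIntegral (c := 0) (by simp)).continuousOn
    rwa [uIcc_of_le hT.le] at this
  have hHi : IntervalIntegrable H volume 0 T := by
    rw [← uIcc_of_le hT.le] at hHc; exact hHc.intervalIntegrable
  -- `F` has no continuity, so the inequality is integrated once more: `H ≤ Y`, and `Y` is
  -- differentiable in the interior with `Y' = a + c H ≤ a + c Y`.
  set Y : ℝ → ℝ := fun t => ∫ s in (0 : ℝ)..t, (a + c * H s) with hY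
  have hi : IntervalIntegrable (fun s => a + c * H s) volume 0 T :=
    intervalIntegrable_const.add (hHi.const_mul c)
  have hsub : ∀ t ∈ Icc 0 T, uIcc 0 t ⊆ uIcc 0 T := fun t ht => by
    rw [uIcc_of_le ht.1, uIcc_of_le hT.le]; exact Icc_subset_Icc_right ht.2
  have hHY : ∀ t ∈ Icc 0 T, H t ≤ Y t := fun t ht => by
    refine intervalIntegral.integral_mono_ae_restrict ht.1 (hF.mono_set (hsub t ht))
      (hi.mono_set (hsub t ht)) ?_
    exact ae_restrict_of_ae_restrict_of_subset (Icc_subset_Icc_right ht.2) h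
  have hYc : ContinuousOn Y (Icc 0 T) := by
    have := (hi.absolutelyContinuousOnInterval_intervalIntegral (c := 0) (by simp)).continuousOn
    rwa [uIcc_of_le hT.le] at this
  have hYd : ∀ t ∈ Ioo 0 T, HasDerivAt Y (a + c * H t) t := fun t ht => by
    refine intervalIntegral.integral_hasDerivAt_right
      (hi.mono_set (hsub t (Ioo_subset_Icc_self ht))) ?_ ?_
    · have hc' : ContinuousOn (fun s => a + c * H s) (Ioo 0 T) :=
        (continuousOn_const.add (continuousOn_const.mul hHc)).mono Ioo_subset_Icc_self
      exact hc'.stronglyMeasurableAtFilter isOpen_Ioo t ht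
    · exact continuousAt_const.add (continuousAt_const.mul
        (hHc.continuousAt (Icc_mem_nhds ht.1 ht.2)))
  have hanti : AntitoneOn (fun t => Real.exp (-c * t) * (a + c * Y t)) (Icc 0 T) := by
    have hd : ∀ t ∈ Ioo 0 T, HasDerivAt (fun t => Real.exp (-c * t) * (a + c * Y t))
        (Real.exp (-c * t) * (-c * 1) * (a + c * Y t)
          + Real.exp (-c * t) * (c * (a + c * H t))) t := fun t ht =>
      (((hasDerivAt_id t).const_mul (-c)).exp).mul (((hYd t ht).const_mul c).const_add a)
    refine antitoneOn_of_deriv_nonpos (convex_Icc 0 T) ?_ ?_ ?_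
    · exact ContinuousOn.mul (by fun_prop) (continuousOn_const.add (continuousOn_const.mul hYc))
    · rw [interior_Icc]
      exact fun t ht => (hd t ht).differentiableAt.differentiableWithinAt
    · rw [interior_Icc]
      intro t ht
      rw [(hd t ht).deriv]
      have h1 := mul_le_mul_of_nonneg_left (hHY t (Ioo_subset_Icc_self ht)) (mul_nonneg hc hc)
      have h2 : Real.exp (-c * t) * (-c * 1) * (a + c * Y t)
          + Real.exp (-c * t) * (c * (a + c * H t)) =
          Real.exp (-c * t) * (c * c * H t - c * c * Y t) := by ring
      rw [h2]
      exact mul_nonpos_of_nonneg_of_nonpos (Real.exp_pos _).le (by linarith)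
  filter_upwards [h, ae_restrict_mem measurableSet_Icc] with t ht htI
  have h1 := hanti (left_mem_Icc.2 hT.le) htI htI.1
  simp only [hY, intervalIntegral.integral_same, mul_zero, Real.exp_zero, one_mul, add_zero] at h1
  have h2 : a + c * Y t ≤ a * Real.exp (c * t) := by
    have := mul_le_mul_of_nonneg_left h1 (Real.exp_pos (c * t)).le
    rw [← mul_assoc, ← Real.exp_add] at this
    simp only [neg_mul, add_neg_cancel, Real.exp_zero, one_mul] at this
    linarith
  have h3 := mul_le_mul_of_nonneg_left (hHY t htI) hc
  have h4 : a * Real.exp (c * t) ≤ a * Real.exp (c * T) := by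
    gcongr; exact htI.2
  linarith

/-- A delayed time integral is controlled by the one without delay. -/
theorem integral_delay_le {T τ t F₀ B : ℝ} (hτ : 0 ≤ τ) (ht : t ∈ Icc 0 T) {F : ℝ → ℝ}
    (hFm : Measurable F) (hF : ∀ s, 0 ≤ F s) (hFB : ∀ s, F s ≤ B) (hF0 : ∀ s ≤ 0, F s = F₀) :
    ∫ s in (0 : ℝ)..t, F (s - τ) ≤ T * F₀ + ∫ s in (0 : ℝ)..t, F s := by
  have hint : ∀ a b, IntervalIntegrable F volume a b := fun a b =>
    (intervalIntegrable_const (c := B)).mono_fun' hFm.aestronglyMeasurable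
      (Eventually.of_forall fun s => by
        simp only [Real.norm_eq_abs, abs_of_nonneg (hF s), hFB s])
  have hF00 : 0 ≤ F₀ := by rw [← hF0 0 le_rfl]; exact hF 0
  have hpos : ∀ s, 0 ≤ s → 0 ≤ ∫ r in (0 : ℝ)..s, F r := fun s hs =>
    intervalIntegral.integral_nonneg hs fun r _ => hF r
  rw [intervalIntegral.integral_comp_sub_right, zero_sub]
  have hconst : ∀ a b, a ≤ 0 → b ≤ 0 → ∫ s in a..b, F s = (b - a) * F₀ := fun a b ha hb => by
    rw [← smul_eq_mul, ← intervalIntegral.integral_const]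
    exact intervalIntegral.integral_congr fun s hs => hF0 s (hs.2.trans (sup_le ha hb))
  rcases le_total t τ with h | h
  · rw [hconst _ _ (by linarith) (by linarith)]
    have := mul_le_mul_of_nonneg_right ht.2 hF00
    have := hpos t ht.1
    linarith
  · rw [← intervalIntegral.integral_add_adjacent_intervals (hint (-τ) 0) (hint 0 (t - τ)),
      hconst _ _ (by linarith) le_rfl]
    have h1 := mul_le_mul_of_nonneg_right (h.trans ht.2) hF00
    have h2 : ∫ s in (0 : ℝ)..(t - τ), F s ≤ ∫ s in (0 : ℝ)..t, F s := by
      rw [← intervalIntegral.integral_add_adjacent_intervals (hint 0 (t - τ)) (hint (t - τ) t)]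
      have : 0 ≤ ∫ s in (t - τ)..t, F s :=
        intervalIntegral.integral_nonneg (by linarith) fun r _ => hF r
      linarith
    linarith


/-! ### Doubling of the time variable -/

/-- Translations in the first variable are continuous in `L¹(ℝ²)`. -/
theorem tendsto_integral_abs_translate_sub {f : ℝ × ℝ → ℝ} (hf : Integrable f) :
    Tendsto (fun h : ℝ => ∫ z : ℝ × ℝ, |f (z.1 + h, z.2) - f z|) (𝓝 0) (𝓝 0) := by
  set S : ℝ → C(ℝ × ℝ, ℝ × ℝ) := fun h => ⟨fun z => (z.1 + h, z.2), by fun_prop⟩ with hS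
  have hScont : Continuous S :=
    ContinuousMap.continuous_of_continuous_uncurry _ (by
      simp only [hS, Function.uncurry_def, ContinuousMap.coe_mk]; fun_prop)
  have hmp : ∀ h, MeasurePreserving (S h) (volume : Measure (ℝ × ℝ)) volume := fun h => by
    rw [Measure.volume_eq_prod]
    exact (measurePreserving_add_right volume h).prod (MeasurePreserving.id volume)
  have h1 : Tendsto (fun h : ℝ => Lp.compMeasurePreserving (S h) (hmp h) (hf.toL1 f)) (𝓝 0)
      (𝓝 (Lp.compMeasurePreserving (S 0) (hmp 0) (hf.toL1 f))) :=
    Filter.Tendsto.compMeasurePreservingLp (tendsto_const_nhds (x := hf.toL1 f))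
      hScont.continuousAt.tendsto hmp (hmp 0)
      ENNReal.one_ne_top
  have h2 := (h1.sub_const (Lp.compMeasurePreserving (S 0) (hmp 0) (hf.toL1 f))).norm
  rw [sub_self, norm_zero] at h2
  refine h2.congr fun h => ?_
  rw [L1.norm_eq_integral_norm]
  refine integral_congr_ae ?_
  have e1 := Lp.coeFn_compMeasurePreserving (hf.toL1 f) (hmp h)
  have e2 := Lp.coeFn_compMeasurePreserving (hf.toL1 f) (hmp 0)
  have e3 := (hmp h).quasiMeasurePreserving.ae_eq_comp hf.coeFn_toL1
  have e4 := (hmp 0).quasiMeasurePreserving.ae_eq_comp hf.coeFn_toL1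
  filter_upwards [Lp.coeFn_sub (Lp.compMeasurePreserving (S h) (hmp h) (hf.toL1 f))
    (Lp.compMeasurePreserving (S 0) (hmp 0) (hf.toL1 f)), e1, e2, e3, e4] with z a0 a1 a2 a3 a4
  rw [a0, Pi.sub_apply, a1, a2, a3, a4, Real.norm_eq_abs]
  simp [hS]

theorem integrable_indicator_of_forall_isProfile {R M : ℝ} {u : ℝ → ℝ → ℝ}
    (hu : Measurable (Function.uncurry u)) (hp : ∀ t, IsProfile R M (u t)) (a b : ℝ) :
    Integrable (indicator (Icc a b ×ˢ univ) (Function.uncurry u)) (volume : Measure (ℝ × ℝ)) := by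
  rw [integrable_indicator_iff (measurableSet_Icc.prod MeasurableSet.univ), IntegrableOn,
    Measure.volume_eq_prod, ← Measure.prod_restrict, Measure.restrict_univ,
    integrable_prod_iff hu.aestronglyMeasurable]
  refine ⟨Eventually.of_forall fun t => (hp t).integrable, ?_⟩
  refine (integrable_const M).mono' hu.norm.stronglyMeasurable.integral_prod_right'.aestronglyMeasurable
    (Eventually.of_forall fun t => ?_)
  rw [Real.norm_of_nonneg (integral_nonneg fun _ => norm_nonneg _)]
  refine le_trans (le_of_eq ?_) (hp t).integral_le
  exact integral_congr_ae (Eventually.of_forall fun x => Real.norm_of_nonneg ((hp t).nonneg x))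

theorem measurable_integral_abs_sub {u w : ℝ → ℝ → ℝ}
    (hu : Measurable (Function.uncurry u)) (hw : Measurable (Function.uncurry w)) :
    Measurable fun z : ℝ × ℝ => ∫ x, |u z.1 x - w z.2 x| := by
  have : Measurable fun q : (ℝ × ℝ) × ℝ => |u q.1.1 q.2 - w q.1.2 q.2| :=
    ((hu.comp ((measurable_fst.comp measurable_fst).prodMk measurable_snd)).sub
      (hw.comp ((measurable_snd.comp measurable_fst).prodMk measurable_snd))).abs
  exact this.stronglyMeasurable.integral_prod_right'.measurable

/-- A measurable family of profiles becomes integrable on the plane after truncation to the times in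
`[-1, T + 1]`, and shifts by at most `1` of times in `(0, T]` do not see the truncation. This
averaged continuity is all that merging the two time variables requires. -/
theorem tendsto_integral_time_translate {R M T : ℝ} (hT : 0 < T) {u : ℝ → ℝ → ℝ}
    (hu : Measurable (Function.uncurry u)) (hp : ∀ t, IsProfile R M (u t)) :
    Tendsto (fun h : ℝ => ∫ t in (0 : ℝ)..T, ∫ x, |u (t + h) x - u t x|) (𝓝[>] 0) (𝓝 0) := by
  set f := indicator (Icc (-1) (T + 1) ×ˢ univ) (Function.uncurry u) with hf
  have hfi : Integrable f := integrable_indicator_of_forall_isProfile hu hp _ _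
  have hlim := (tendsto_integral_abs_translate_sub hfi).mono_left
    (nhdsWithin_le_nhds (s := Ioi (0 : ℝ)))
  have hsm : ∀ᶠ h : ℝ in 𝓝[>] 0, h ≤ 1 :=
    (eventually_le_nhds (by norm_num : (0 : ℝ) < 1)).filter_mono nhdsWithin_le_nhds
  refine squeeze_zero' (Eventually.of_forall fun h =>
    intervalIntegral.integral_nonneg hT.le fun t _ => integral_nonneg fun x => abs_nonneg _) ?_ hlim
  filter_upwards [hsm, self_mem_nhdsWithin] with h h1 h0
  have h0' : 0 < h := h0
  have hi : Integrable (fun z : ℝ × ℝ => |f (z.1 + h, z.2) - f z|) (volume.prod volume) := by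
    have hmp : MeasurePreserving (fun z : ℝ × ℝ => (z.1 + h, z.2))
        ((volume : Measure ℝ).prod volume) (volume.prod volume) :=
      (measurePreserving_add_right volume h).prod (MeasurePreserving.id volume)
    exact ((hmp.integrable_comp hfi.aestronglyMeasurable).2 hfi |>.sub hfi).abs
  rw [Measure.volume_eq_prod, integral_prod _ hi, intervalIntegral.integral_of_le hT.le]
  refine le_trans (le_of_eq ?_) (setIntegral_le_integral (s := Ioc 0 T) hi.integral_prod_left
    (Eventually.of_forall fun t => integral_nonneg fun x => abs_nonneg _))
  refine setIntegral_congr_fun measurableSet_Ioc fun t ht => ?_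
  have a1 : ∀ x : ℝ, (t, x) ∈ Icc (-1) (T + 1) ×ˢ (univ : Set ℝ) := fun x =>
    ⟨⟨by linarith [ht.1], by linarith [ht.2]⟩, mem_univ _⟩
  have a2 : ∀ x : ℝ, (t + h, x) ∈ Icc (-1) (T + 1) ×ˢ (univ : Set ℝ) := fun x =>
    ⟨⟨by simp only; linarith [ht.1], by simp only; linarith [ht.2]⟩, mem_univ _⟩
  simp only [hf, indicator_of_mem (a1 _), indicator_of_mem (a2 _), Function.uncurry]

/-- Doubling of the time variable: from one-sided differential inequalities in each of the two
time variables to an integral inequality on the diagonal. -/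
theorem ae_diag_le_of_forall_isTimeTest {T B : ℝ} (hT : 0 < T) {Φ P Q D : ℝ → ℝ → ℝ} {k : ℝ → ℝ}
    (hΦm : Measurable (Function.uncurry Φ)) (hPm : Measurable (Function.uncurry P))
    (hQm : Measurable (Function.uncurry Q)) (hDm : Measurable (Function.uncurry D))
    (hkm : Measurable k) (hΦB : ∀ t s, |Φ t s| ≤ B) (hPB : ∀ t s, |P t s| ≤ B)
    (hQB : ∀ t s, |Q t s| ≤ B) (hkB : ∀ t, |k t| ≤ B) (hDB : ∀ t s, |D t s| ≤ B)
    (hD0 : ∀ t s, 0 ≤ D t s)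
    (h1 : ∀ s χ, IsTimeTest T χ →
      0 ≤ (∫ t in (0 : ℝ)..T, (deriv χ t * Φ t s + χ t * P t s)) + χ 0 * Φ 0 s)
    (h2 : ∀ t χ, IsTimeTest T χ →
      0 ≤ (∫ s in (0 : ℝ)..T, (deriv χ s * Φ t s + χ s * Q t s)) + χ 0 * Φ t 0)
    (hk : ∀ t s, P t s + Q t s ≤ k t + D t s) (hΦD : ∀ t s, |Φ t s - Φ t t| ≤ D t s)
    (hD : Tendsto (fun h => ∫ t in (0 : ℝ)..T, D t (t + h)) (𝓝[>] 0) (𝓝 0)) :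
    ∀ᵐ t ∂(volume.restrict (Icc 0 T)), Φ t t ≤ Φ 0 0 + ∫ s in (0 : ℝ)..t, k s := by
  have hB : 0 ≤ B := (abs_nonneg _).trans (hkB 0)
  have hint : ∀ {F : ℝ → ℝ}, Measurable F → (∀ t, |F t| ≤ B) → ∀ a b,
      IntervalIntegrable F volume a b := fun hF hb a b =>
    (intervalIntegrable_const (c := B)).mono_fun' hF.aestronglyMeasurable
      (Eventually.of_forall hb)
  have hdiag : Measurable fun t => Φ t t := hΦm.comp (measurable_id.prodMk measurable_id)
  refine ae_le_of_forall_isTimeTest hT (hint hdiag (fun t => hΦB t t) _ _) (hint hkm hkB _ _)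
    fun θ hθ => ?_
  -- the initial trace
  have hinit : ∀ᵐ s ∂(volume.restrict (Icc 0 T)), Φ 0 s ≤ Φ 0 0 + B * s := by
    have := ae_le_of_forall_isTimeTest hT (hint (hΦm.of_uncurry_left) (hΦB 0) _ _)
      (hint (hQm.of_uncurry_left) (hQB 0) _ _) (h2 0)
    filter_upwards [this, ae_restrict_mem measurableSet_Icc] with s hs hsI
    refine hs.trans (add_le_add_right ?_ _)
    have h3 := intervalIntegral.norm_integral_le_of_norm_le_const (a := 0) (b := s)
      (f := fun s => Q 0 s) (C := B) fun t _ => hQB 0 t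
    rw [sub_zero, abs_of_nonneg hsI.1] at h3
    exact (le_abs_self _).trans h3
  obtain ⟨T', hT', hz⟩ := hθ.eq_zero
  have hz' : ∀ t, T' < t → deriv θ t = 0 := fun t ht => by
    have : θ =ᶠ[𝓝 t] fun _ => 0 := by
      filter_upwards [lt_mem_nhds ht] with y hy using hz y hy.le
    rw [this.deriv_eq, deriv_const]
  obtain ⟨c, hc⟩ : ∃ c, ∀ t ∈ Icc 0 T, |deriv θ t| + θ t ≤ c := by
    obtain ⟨c, hc⟩ := (isCompact_Icc (a := (0 : ℝ)) (b := T)).bddAbove_image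
      (f := fun t => |deriv θ t| + θ t)
      ((hθ.continuous_deriv.abs.add hθ.contDiff.continuous).continuousOn)
    exact ⟨c, fun t ht => hc (mem_image_of_mem _ ht)⟩
  have hc0 : 0 ≤ c := (add_nonneg (abs_nonneg _) (hθ.nonneg 0)).trans (hc 0 (left_mem_Icc.2 hT.le))
  refine le_of_forall_pos_le_add fun ζ hζ => ?_
  -- choice of the scale
  have hcc : 0 < c + θ 0 * B + 1 := by nlinarith [hθ.nonneg 0]
  -- Two errors will occur: `c ξ` from leaving the diagonal, and at most `θ 0 * B * ξ` from the
  -- initial trace. The denominator makes their sum at most `ζ`.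
  set ξ := ζ / (c + θ 0 * B + 1) with hξ
  have hξ0 : 0 < ξ := div_pos hζ hcc
  obtain ⟨r₀, hr₀, hr⟩ : ∃ r₀ > 0, ∀ h, 0 < h → h < r₀ → ∫ t in (0 : ℝ)..T, D t (t + h) ≤ ξ := by
    have := hD.eventually (ge_mem_nhds hξ0)
    obtain ⟨r₀, hr₀, hsub⟩ := mem_nhdsGT_iff_exists_Ioo_subset.1 this
    exact ⟨r₀, hr₀, fun h h0 h1 => hsub ⟨h0, h1⟩⟩
  set r := min (min r₀ (T - T')) (min ξ T) with hrdef
  have hr0 : 0 < r := lt_min (lt_min hr₀ (by linarith)) (lt_min hξ0 hT)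
  have hrr₀ : r ≤ r₀ := (min_le_left _ _).trans (min_le_left _ _)
  have hrT' : r ≤ T - T' := (min_le_left _ _).trans (min_le_right _ _)
  have hrξ : r ≤ ξ := (min_le_right _ _).trans (min_le_left _ _)
  have hrT : r ≤ T := (min_le_right _ _).trans (min_le_right _ _)
  -- The centre `r / 2` makes the bump one-sided, with support in `0 < s - t < r`. Hence the
  -- inequality in `s` has no initial term, and only the trace of `Φ 0 s` for small `s` must be
  -- controlled.
  set φ : ContDiffBump (r / 2 : ℝ) := ⟨r / 4, r / 2, by linarith, by linarith⟩
  set δ : ℝ → ℝ := φ.normed volume with hδ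
  have hδc : ContDiff ℝ 1 δ := φ.contDiff_normed
  have hδ0 : ∀ h, 0 ≤ δ h := φ.nonneg_normed
  have hδ1 : ∫ h, δ h = 1 := φ.integral_normed
  have hδi : Integrable δ := φ.integrable_normed
  have hδz : ∀ h, h ∉ Ioo 0 r → δ h = 0 := fun h hh => by
    have : h ∉ Function.support (φ.normed volume) := by
      rw [φ.support_normed_eq, Real.ball_eq_Ioo]
      simpa [φ] using hh
    simpa using this
  have hδd : ∀ h, HasDerivAt δ (deriv δ h) h := fun h =>
    (hδc.differentiable one_ne_zero h).hasDerivAt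
  have hδ'c : Continuous (deriv δ) := hδc.continuous_deriv le_rfl
  set μ := volume.restrict (Ioc 0 T) with hμ
  -- integrability on the square
  have hsq : ∀ {F : ℝ → ℝ → ℝ} {w : ℝ × ℝ → ℝ}, Measurable (Function.uncurry F) →
      (∀ t s, |F t s| ≤ B) → Continuous w →
      Integrable (fun z : ℝ × ℝ => w z * F z.1 z.2) (μ.prod μ) := fun {F w} hF hb hw => by
    refine Integrable.mul_bdd (c := B) ?_ (hF.aestronglyMeasurable) (Eventually.of_forall fun z => hb _ _)
    rw [hμ, Measure.prod_restrict]
    exact (hw.continuousOn.integrableOn_compact (isCompact_Icc.prod isCompact_Icc)).mono_set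
      (prod_mono Ioc_subset_Icc_self Ioc_subset_Icc_self)
  have hθc := hθ.contDiff.continuous
  have hθ'c := hθ.continuous_deriv
  have hδcc := hδc.continuous
  have J1 : Integrable (fun z : ℝ × ℝ =>
      (deriv θ z.1 * δ (z.2 - z.1) - θ z.1 * deriv δ (z.2 - z.1)) * Φ z.1 z.2
        + θ z.1 * δ (z.2 - z.1) * P z.1 z.2) (μ.prod μ) :=
    (hsq hΦm hΦB (w := fun z => deriv θ z.1 * δ (z.2 - z.1) - θ z.1 * deriv δ (z.2 - z.1))
      (by fun_prop)).add (hsq hPm hPB (w := fun z => θ z.1 * δ (z.2 - z.1)) (by fun_prop))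
  have J2 : Integrable (fun z : ℝ × ℝ => θ z.1 * deriv δ (z.2 - z.1) * Φ z.1 z.2
      + θ z.1 * δ (z.2 - z.1) * Q z.1 z.2) (μ.prod μ) :=
    (hsq hΦm hΦB (w := fun z => θ z.1 * deriv δ (z.2 - z.1))
      (by fun_prop)).add (hsq hQm hQB (w := fun z => θ z.1 * δ (z.2 - z.1)) (by fun_prop))
  have ineq1 : 0 ≤ (∫ z : ℝ × ℝ, ((deriv θ z.1 * δ (z.2 - z.1) - θ z.1 * deriv δ (z.2 - z.1)) * Φ z.1 z.2
      + θ z.1 * δ (z.2 - z.1) * P z.1 z.2) ∂(μ.prod μ)) + θ 0 * ∫ s, δ s * Φ 0 s ∂μ := by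
    rw [integral_prod_symm _ J1, ← integral_const_mul, ← integral_add J1.integral_prod_right]
    · refine integral_nonneg fun s => ?_
      have hχd : ∀ t, HasDerivAt (fun t => θ t * δ (s - t))
          (deriv θ t * δ (s - t) - θ t * deriv δ (s - t)) t := fun t => by
        have e1 := ((hδd (s - t)).comp t ((hasDerivAt_id t).const_sub s))
        refine (((hθ.contDiff.differentiable one_ne_zero t).hasDerivAt).mul e1).congr_deriv ?_
        simp only [Function.comp]; ring
      have := h1 s (fun t => θ t * δ (s - t)) ⟨hθ.contDiff.mul
        (hδc.comp (contDiff_const.sub contDiff_id)), fun t => mul_nonneg (hθ.nonneg t) (hδ0 _),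
        T', hT', fun t ht => by rw [hz t ht, zero_mul]⟩
      simp_rw [(hχd _).deriv] at this
      rw [intervalIntegral.integral_of_le hT.le] at this
      simpa [hμ, mul_assoc] using this
    · exact (Integrable.mul_bdd (c := B) (hδi.restrict) (hΦm.of_uncurry_left).aestronglyMeasurable
        (Eventually.of_forall fun s => hΦB 0 s)).const_mul _
  have ineq2 : 0 ≤ ∫ z : ℝ × ℝ, (θ z.1 * deriv δ (z.2 - z.1) * Φ z.1 z.2
      + θ z.1 * δ (z.2 - z.1) * Q z.1 z.2) ∂(μ.prod μ) := by
    rw [integral_prod _ J2]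
    refine setIntegral_nonneg measurableSet_Ioc fun t ht => ?_
    -- For `t ≥ T'` the weight `θ t` vanishes. For `t < T'` the test function in `s` vanishes from
    -- `t + r` on, which lies before `T` thanks to `r ≤ T - T'`.
    rcases le_or_gt T' t with htT | htT
    · simp [hz t htT]
    have hχd : ∀ s, HasDerivAt (fun s => θ t * δ (s - t)) (θ t * deriv δ (s - t)) s := fun s => by
      have e1 := ((hδd (s - t)).comp s ((hasDerivAt_id s).sub_const t))
      refine (e1.const_mul (θ t)).congr_deriv ?_
      simp only [mul_one]
    have := h2 t (fun s => θ t * δ (s - t)) ⟨contDiff_const.mul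
        (hδc.comp (contDiff_id.sub contDiff_const)), fun s => mul_nonneg (hθ.nonneg t) (hδ0 _),
        t + r, by linarith, fun s hs => by
          rw [hδz (s - t) (fun h => by linarith [h.2]), mul_zero]⟩
    simp_rw [(hχd _).deriv] at this
    rw [hδz (0 - t) (fun h => by linarith [h.1, ht.1]), mul_zero, zero_mul, add_zero,
      intervalIntegral.integral_of_le hT.le] at this
    exact this
  -- mass of the approximate identity
  have hmass : ∀ t ∈ Ioc 0 T, t < T' → ∫ s, δ (s - t) ∂μ = 1 := fun t ht htT => by
    rw [← hδ1, ← integral_sub_right_eq_self δ t, hμ]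
    refine setIntegral_eq_integral_of_forall_compl_eq_zero fun s hs => hδz _ fun h => hs ⟨?_, ?_⟩
    · linarith [h.1, ht.1]
    · linarith [h.2]
  have hΦdm : Measurable (Function.uncurry fun t (_ : ℝ) => Φ t t) := hdiag.comp measurable_fst
  have hkdm : Measurable (Function.uncurry fun t (_ : ℝ) => k t) := hkm.comp measurable_fst
  have I1 : Integrable (fun z : ℝ × ℝ => deriv θ z.1 * δ (z.2 - z.1) * Φ z.1 z.1) (μ.prod μ) :=
    hsq hΦdm (fun t _ => hΦB t t) (w := fun z => deriv θ z.1 * δ (z.2 - z.1)) (by fun_prop)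
  have I2 : Integrable (fun z : ℝ × ℝ => θ z.1 * δ (z.2 - z.1) * k z.1) (μ.prod μ) :=
    hsq hkdm (fun t _ => hkB t) (w := fun z => θ z.1 * δ (z.2 - z.1)) (by fun_prop)
  have I3 : Integrable (fun z : ℝ × ℝ => δ (z.2 - z.1) * D z.1 z.2) (μ.prod μ) :=
    hsq hDm hDB (w := fun z => δ (z.2 - z.1)) (by fun_prop)
  have I12 : Integrable (fun z : ℝ × ℝ => deriv θ z.1 * δ (z.2 - z.1) * Φ z.1 z.1
      + θ z.1 * δ (z.2 - z.1) * k z.1) (μ.prod μ) := I1.add I2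
  have hdiagint : ∫ z : ℝ × ℝ, (deriv θ z.1 * δ (z.2 - z.1) * Φ z.1 z.1
      + θ z.1 * δ (z.2 - z.1) * k z.1) ∂(μ.prod μ) =
      ∫ t in (0 : ℝ)..T, (deriv θ t * Φ t t + θ t * k t) := by
    rw [integral_prod _ I12, intervalIntegral.integral_of_le hT.le]
    have hne : ∀ᵐ t ∂μ, t ≠ T' := by
      refine ae_restrict_of_ae ?_
      simp [ae_iff, measure_singleton]
    refine integral_congr_ae ?_
    filter_upwards [hne, ae_restrict_mem measurableSet_Ioc] with t hne ht
    rcases lt_or_gt_of_ne hne with h | h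
    · have : ∀ s, deriv θ t * δ (s - t) * Φ t t + θ t * δ (s - t) * k t =
          δ (s - t) * (deriv θ t * Φ t t + θ t * k t) := fun s => by ring
      simp only [this]
      rw [integral_mul_const, hmass t ht h, one_mul]
    · simp [hz t h.le, hz' t h]
  -- In the variable `h = s - t` the weight no longer depends on `t`. The error is thus bounded by a
  -- `δ`-average, over `0 < h < r`, of the integrals of `D t (t + h)`, each of them at most `ξ`.
  have hDint : ∫ z : ℝ × ℝ, δ (z.2 - z.1) * D z.1 z.2 ∂(μ.prod μ) ≤ ξ := by
    have hJ : Integrable (fun z : ℝ × ℝ => δ z.2 * D z.1 (z.1 + z.2)) (μ.prod volume) := by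
      have e1 : Integrable (fun z : ℝ × ℝ => δ z.2) (μ.prod volume) := hδi.comp_snd μ
      refine e1.mul_bdd (c := B) (hDm.comp (measurable_fst.prodMk
        (measurable_fst.add measurable_snd))).aestronglyMeasurable
        (Eventually.of_forall fun z => hDB _ _)
    calc ∫ z : ℝ × ℝ, δ (z.2 - z.1) * D z.1 z.2 ∂(μ.prod μ)
        = ∫ t, (∫ s, δ (s - t) * D t s ∂μ) ∂μ := integral_prod _ I3
      _ ≤ ∫ t, (∫ h, δ h * D t (t + h)) ∂μ := by
          refine integral_mono I3.integral_prod_left hJ.integral_prod_left fun t => ?_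
          have e2 : Integrable fun s => δ (s - t) * D t s :=
            (hδi.comp_sub_right t).mul_bdd (c := B) (hDm.of_uncurry_left).aestronglyMeasurable
              (Eventually.of_forall fun s => hDB t s)
          have e3 := integral_sub_right_eq_self (fun h => δ h * D t (t + h)) t (μ := volume)
          simp only [add_sub_cancel] at e3
          beta_reduce
          rw [← e3]
          exact setIntegral_le_integral e2
            (Eventually.of_forall fun s => mul_nonneg (hδ0 _) (hD0 _ _))
      _ = ∫ h, δ h * ∫ t in (0 : ℝ)..T, D t (t + h) := by
          have e4 := integral_integral_swap (f := fun t h => δ h * D t (t + h)) hJ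
          rw [e4]
          congr 1; ext h
          rw [integral_const_mul, intervalIntegral.integral_of_le hT.le]
      _ ≤ ∫ h, δ h * ξ := by
          refine integral_mono ?_ (hδi.mul_const _) fun h => ?_
          · have e5 := hJ.integral_prod_right
            refine e5.congr (Eventually.of_forall fun h => ?_)
            simp only [integral_const_mul, intervalIntegral.integral_of_le hT.le, hμ]
          · by_cases hh : h ∈ Ioo 0 r
            · exact mul_le_mul_of_nonneg_left (hr h hh.1 (hh.2.trans_le hrr₀)) (hδ0 h)
            · simp [hδz h hh]
      _ = ξ := by rw [integral_mul_const, hδ1, one_mul]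
  have hini : ∫ s, δ s * Φ 0 s ∂μ ≤ Φ 0 0 + B * r := by
    have e1 : ∫ s, δ s ∂μ = 1 := by
      rw [← hδ1, hμ]
      exact setIntegral_eq_integral_of_forall_compl_eq_zero fun s hs => hδz _ fun h =>
        hs ⟨h.1, h.2.le.trans hrT⟩
    calc ∫ s, δ s * Φ 0 s ∂μ ≤ ∫ s, δ s * (Φ 0 0 + B * r) ∂μ := by
          refine integral_mono_ae ((hδi.restrict).mul_bdd (c := B)
            (hΦm.of_uncurry_left).aestronglyMeasurable (Eventually.of_forall fun s => hΦB 0 s))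
            (hδi.restrict.mul_const _) ?_
          filter_upwards [ae_restrict_of_ae_restrict_of_subset Ioc_subset_Icc_self hinit] with s hs
          by_cases hh : s ∈ Ioo 0 r
          · refine mul_le_mul_of_nonneg_left (hs.trans ?_) (hδ0 s)
            have := mul_le_mul_of_nonneg_left hh.2.le hB
            linarith
          · simp [hδz s hh]
      _ = _ := by rw [integral_mul_const, e1, one_mul]
  -- The terms with the derivative of `δ` cancel in the sum. What remains is compared with its value
  -- on the diagonal: moving `Φ` and bounding the rates together cost at most `c D`.
  have hsum : (∫ z : ℝ × ℝ, ((deriv θ z.1 * δ (z.2 - z.1) - θ z.1 * deriv δ (z.2 - z.1)) * Φ z.1 z.2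
        + θ z.1 * δ (z.2 - z.1) * P z.1 z.2) ∂(μ.prod μ)) +
      (∫ z : ℝ × ℝ, (θ z.1 * deriv δ (z.2 - z.1) * Φ z.1 z.2
        + θ z.1 * δ (z.2 - z.1) * Q z.1 z.2) ∂(μ.prod μ)) ≤
      (∫ t in (0 : ℝ)..T, (deriv θ t * Φ t t + θ t * k t)) + c * ξ := by
    rw [← integral_add J1 J2, ← hdiagint]
    refine le_trans ?_ (add_le_add_right (mul_le_mul_of_nonneg_left hDint hc0) _)
    rw [← integral_const_mul, ← integral_add I12 (I3.const_mul c)]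
    refine integral_mono_ae (J1.add J2) (I12.add (I3.const_mul c)) ?_
    have hmem : ∀ᵐ z ∂(μ.prod μ), z ∈ Ioc 0 T ×ˢ Ioc 0 T := by
      rw [hμ, Measure.prod_restrict]
      exact ae_restrict_mem (measurableSet_Ioc.prod measurableSet_Ioc)
    filter_upwards [hmem] with z hz
    have a1 := hc z.1 (Ioc_subset_Icc_self hz.1)
    have a2 : deriv θ z.1 * (Φ z.1 z.2 - Φ z.1 z.1) ≤ |deriv θ z.1| * D z.1 z.2 := by
      refine (le_abs_self _).trans ?_
      rw [abs_mul]
      exact mul_le_mul_of_nonneg_left (hΦD _ _) (abs_nonneg _)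
    have a3 := mul_le_mul_of_nonneg_left (hk z.1 z.2) (hθ.nonneg z.1)
    have a4 := mul_le_mul_of_nonneg_right a1 (hD0 z.1 z.2)
    have a5 : deriv θ z.1 * Φ z.1 z.2 + θ z.1 * (P z.1 z.2 + Q z.1 z.2) ≤
        deriv θ z.1 * Φ z.1 z.1 + θ z.1 * k z.1 + c * D z.1 z.2 := by linarith
    have a6 := mul_le_mul_of_nonneg_left a5 (hδ0 (z.2 - z.1))
    linarith
  have a7 := mul_le_mul_of_nonneg_left hini (hθ.nonneg 0)
  have a8 : θ 0 * (B * r) ≤ θ 0 * (B * ξ) :=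
    mul_le_mul_of_nonneg_left (mul_le_mul_of_nonneg_left hrξ hB) (hθ.nonneg 0)
  have a9 : (c + θ 0 * B + 1) * ξ = ζ := by rw [hξ]; field_simp
  linarith


/-! ### Kruzhkov solutions and the Kuznetsov inequality -/

/-- A representative of an entropy solution, extended by the datum `r₀` to the past, all of whose
time slices are admissible profiles; the speed at time `t` is evaluated at time `t - τ`. -/
structure IsKruzhkovSolution (T R M τ : ℝ) (g : ℝ → ℝ) (α β : (ℝ → ℝ) → ℝ → ℝ) (r₀ : ℝ → ℝ)
    (u : ℝ → ℝ → ℝ) : Prop where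
  τ_nonneg : 0 ≤ τ
  measurable : Measurable (Function.uncurry u)
  isProfile : ∀ t, IsProfile R M (u t)
  past : ∀ t ≤ 0, u t = r₀
  entropy : ∀ χ, IsTimeTest T χ → ∀ ψ : ℝ → ℝ, ContDiff ℝ 1 ψ → (∀ x, 0 ≤ ψ x) → Integrable ψ →
    Integrable (deriv ψ) → ∀ κ ∈ Icc 0 R,
    0 ≤ (∫ t in (0 : ℝ)..T, (deriv χ t * (∫ x, |u t x - κ| * ψ x) +
        χ t * ∫ x, (kruzhkovFlux g (u t x) κ * α (u (t - τ)) x * deriv ψ x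
          - Real.sign (u t x - κ) * g κ * β (u (t - τ)) x * ψ x)))
      + χ 0 * ∫ x, |r₀ x - κ| * ψ x

section Measurability

variable {R M C m ε : ℝ} {g η : ℝ → ℝ} {α β : (ℝ → ℝ) → ℝ → ℝ} {u u' w : ℝ → ℝ → ℝ}

theorem measurable_kuznetsov (hη : Measurable η) (hu : Measurable (Function.uncurry u))
    (hw : Measurable (Function.uncurry w)) :
    Measurable (Function.uncurry fun t s => kuznetsov η (u t) (w s)) := by
  have : Measurable fun q : (ℝ × ℝ) × (ℝ × ℝ) =>
      |u q.1.1 q.2.1 - w q.1.2 q.2.2| * η (q.2.1 - q.2.2) := by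
    refine Measurable.mul ((Measurable.sub ?_ ?_).abs) (hη.comp (by fun_prop))
    · exact hu.comp (by fun_prop : Measurable fun q : (ℝ × ℝ) × (ℝ × ℝ) => (q.1.1, q.2.1))
    · exact hw.comp (by fun_prop : Measurable fun q : (ℝ × ℝ) × (ℝ × ℝ) => (q.1.2, q.2.2))
  exact this.stronglyMeasurable.integral_prod_right'.measurable

theorem IsFlux.measurable_rate_integrand (h : IsFlux R M C g α β) {ψ ψ' : ℝ → ℝ}
    (hψ : Measurable ψ) (hψ' : Measurable ψ')
    (hu : Measurable (Function.uncurry u)) (hu' : Measurable (Function.uncurry u'))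
    (hup : ∀ t, IsProfile R M (u' t)) (hw : Measurable (Function.uncurry w)) :
    Measurable fun q : (ℝ × ℝ) × (ℝ × ℝ) =>
      kruzhkovFlux g (u q.1.1 q.2.1) (w q.1.2 q.2.2) * α (u' q.1.1) q.2.1 * ψ' (q.2.1 - q.2.2)
      - Real.sign (u q.1.1 q.2.1 - w q.1.2 q.2.2) * g (w q.1.2 q.2.2) * β (u' q.1.1) q.2.1
        * ψ (q.2.1 - q.2.2) := by
  have m1 : Measurable fun q : (ℝ × ℝ) × (ℝ × ℝ) => (q.1.1, q.2.1) := by fun_prop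
  have m2 : Measurable fun q : (ℝ × ℝ) × (ℝ × ℝ) => (q.1.2, q.2.2) := by fun_prop
  have m3 : Measurable fun q : (ℝ × ℝ) × (ℝ × ℝ) => q.2.1 - q.2.2 := by fun_prop
  have a1 : Measurable fun q : (ℝ × ℝ) × (ℝ × ℝ) => u q.1.1 q.2.1 := hu.comp m1
  have a2 : Measurable fun q : (ℝ × ℝ) × (ℝ × ℝ) => w q.1.2 q.2.2 := hw.comp m2
  have a3 : Measurable fun q : (ℝ × ℝ) × (ℝ × ℝ) => α (u' q.1.1) q.2.1 :=
    (h.α_measurable u' hu' hup).comp m1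
  have a4 : Measurable fun q : (ℝ × ℝ) × (ℝ × ℝ) => β (u' q.1.1) q.2.1 :=
    (h.β_measurable u' hu' hup).comp m1
  have a5 : Measurable fun q : (ℝ × ℝ) × (ℝ × ℝ) =>
      kruzhkovFlux g (u q.1.1 q.2.1) (w q.1.2 q.2.2) :=
    (measurable_kruzhkovFlux h.g_continuous.measurable).comp (a1.prodMk a2)
  exact ((a5.mul a3).mul (hψ'.comp m3)).sub ((((Real.measurable_sign.comp (a1.sub a2)).mul
    (h.g_continuous.measurable.comp a2)).mul a4).mul (hψ.comp m3))

theorem IsFlux.measurable_rate (h : IsFlux R M C g α β) (hη : IsMollifier m ε η)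
    (hu : Measurable (Function.uncurry u)) (hu' : Measurable (Function.uncurry u'))
    (hup : ∀ t, IsProfile R M (u' t)) (hw : Measurable (Function.uncurry w)) :
    Measurable (Function.uncurry fun t s => kruzhkovRate g α β η (u t) (u' t) (w s)) :=
  (h.measurable_rate_integrand hη.measurable hη.continuous_deriv.measurable hu hu' hup
    hw).stronglyMeasurable.integral_prod_right'.measurable

end Measurability

/-- Partial integrals of kernels dominated by `(u(t,x) + q(y)) k(x - y)`. -/
theorem integrable_partial_integral {R M T : ℝ} {u : ℝ → ℝ → ℝ} {q k : ℝ → ℝ}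
    (hu : ∀ t, IsProfile R M (u t)) (hq : IsProfile R M q) (hk : Integrable k)
    {G : ℝ → ℝ → ℝ → ℝ} (hG : Measurable fun z : ℝ × (ℝ × ℝ) => G z.1 z.2.1 z.2.2)
    (hle : ∀ t x y, |G t x y| ≤ (u t x + q y) * k (x - y)) :
    (∀ t, ∫ y, ∫ x, G t x y = ∫ z : ℝ × ℝ, G t z.1 z.2) ∧
      Integrable (fun z : ℝ × ℝ => ∫ x, G z.1 x z.2) ((volume.restrict (Ioc 0 T)).prod volume) := by
  have hint : ∀ t, Integrable (fun z : ℝ × ℝ => G t z.1 z.2) (volume.prod volume) := fun t =>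
    integrable_of_abs_le_add_mul_sub (hu t).integrable hq.integrable hk
      (hG.comp (measurable_const.prodMk measurable_id)).aestronglyMeasurable
      fun z => hle t z.1 z.2
  have hm : Measurable fun z : ℝ × ℝ => ∫ x, G z.1 x z.2 := by
    have : Measurable fun z : (ℝ × ℝ) × ℝ => G z.1.1 z.2 z.1.2 :=
      hG.comp (by fun_prop : Measurable fun z : (ℝ × ℝ) × ℝ => (z.1.1, (z.2, z.1.2)))
    exact this.stronglyMeasurable.integral_prod_right'.measurable
  refine ⟨fun t => (integral_prod_symm _ (hint t)).symm, ?_⟩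
  rw [integrable_prod_iff hm.aestronglyMeasurable]
  refine ⟨Eventually.of_forall fun t => (hint t).integral_prod_right, ?_⟩
  refine (integrable_const ((M + M) * ∫ x, |k x|)).mono'
    hm.norm.stronglyMeasurable.integral_prod_right'.aestronglyMeasurable
    (Eventually.of_forall fun t => ?_)
  rw [Real.norm_of_nonneg (integral_nonneg fun _ => norm_nonneg _)]
  have h1 : ∫ y, ‖∫ x, G t x y‖ ≤ ∫ y, ∫ x, ‖G t x y‖ :=
    integral_mono (hint t).integral_prod_right.norm (hint t).norm.integral_prod_right
      fun y => norm_integral_le_integral_norm _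
  have h2 : ∫ y, ∫ x, ‖G t x y‖ = ∫ z : ℝ × ℝ, ‖G t z.1 z.2‖ :=
    (integral_prod_symm _ (hint t).norm).symm
  have h3 := abs_integral_le_add_mul_sub (hu t).integrable hq.integrable hk.abs
    (F := fun z => ‖G t z.1 z.2‖) fun z => by
      rw [Real.norm_eq_abs, abs_abs]
      exact (hle t z.1 z.2).trans (mul_le_mul_of_nonneg_left (le_abs_self _)
        (add_nonneg ((hu t).nonneg _) (hq.nonneg _)))
  refine h1.trans (h2.le.trans ((le_abs_self _).trans (h3.trans ?_)))
  exact mul_le_mul_of_nonneg_right (add_le_add (hu t).integral_le hq.integral_le)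
    (integral_nonneg fun _ => abs_nonneg _)

namespace IsKruzhkovSolution

variable {T R M C m ε τ τ' : ℝ} {g η r₀ q : ℝ → ℝ} {α β : (ℝ → ℝ) → ℝ → ℝ} {u w : ℝ → ℝ → ℝ}

theorem measurable_shift (hu : IsKruzhkovSolution T R M τ g α β r₀ u) :
    Measurable (Function.uncurry fun t => u (t - τ)) :=
  hu.measurable.comp (by fun_prop : Measurable fun z : ℝ × ℝ => (z.1 - τ, z.2))

/-- The entropy inequality with a varying constant `κ = q(y)`, integrated in `y`. -/
theorem integrated (hu : IsKruzhkovSolution T R M τ g α β r₀ u) (h : IsFlux R M C g α β)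
    (hη : IsMollifier m ε η) (hT : 0 < T) (hq : IsProfile R M q) {χ : ℝ → ℝ}
    (hχ : IsTimeTest T χ) :
    0 ≤ (∫ t in (0 : ℝ)..T, (deriv χ t * kuznetsov η (u t) q
      + χ t * kruzhkovRate g α β η (u t) (u (t - τ)) q)) + χ 0 * kuznetsov η (u 0) q := by
  have m0 : Measurable fun z : ℝ × (ℝ × ℝ) => ((z.1, (0 : ℝ)), z.2) := by fun_prop
  have hqm : Measurable (Function.uncurry fun (_ : ℝ) => q) := hq.measurable.comp measurable_snd
  have A1 := integrable_partial_integral (T := T) hu.isProfile hq hη.integrable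
    (G := fun t x y => |u t x - q y| * η (x - y)) (by
      refine Measurable.mul ((Measurable.sub ?_ ?_).abs) (hη.measurable.comp (by fun_prop))
      · exact hu.measurable.comp (by fun_prop : Measurable fun z : ℝ × (ℝ × ℝ) => (z.1, z.2.1))
      · exact hq.measurable.comp (by fun_prop)) fun t x y => by
      rw [abs_mul, abs_abs, abs_of_nonneg (hη.nonneg _)]
      exact mul_le_mul_of_nonneg_right ((hu.isProfile t).abs_sub_le hq _ _) (hη.nonneg _)
  have A2 := integrable_partial_integral (T := T) hu.isProfile hq (hη.integrable_rateKernel C)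
    (G := fun t x y => kruzhkovFlux g (u t x) (q y) * α (u (t - τ)) x * deriv η (x - y)
      - Real.sign (u t x - q y) * g (q y) * β (u (t - τ)) x * η (x - y))
    ((h.measurable_rate_integrand hη.measurable hη.continuous_deriv.measurable hu.measurable
      hu.measurable_shift (fun t => hu.isProfile _) hqm).comp m0)
    fun t x y => h.abs_rate_integrand_le hη (hu.isProfile t) (hu.isProfile _) hq (x, y)
  have hpt : ∀ y, 0 ≤ (∫ t in (0 : ℝ)..T, (deriv χ t * (∫ x, |u t x - q y| * η (x - y)) +
        χ t * ∫ x, (kruzhkovFlux g (u t x) (q y) * α (u (t - τ)) x * deriv η (x - y)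
          - Real.sign (u t x - q y) * g (q y) * β (u (t - τ)) x * η (x - y))))
      + χ 0 * ∫ x, |u 0 x - q y| * η (x - y) := fun y => by
    have hd : deriv (fun x => η (x - y)) = fun x => deriv η (x - y) :=
      funext fun x => deriv_comp_sub_const η y x
    have := hu.entropy χ hχ (fun x => η (x - y)) (hη.contDiff.comp (contDiff_id.sub contDiff_const))
      (fun x => hη.nonneg _) (hη.integrable.comp_sub_right y)
      (by rw [hd]; exact hη.integrable_deriv.comp_sub_right y) (q y) (hq.mem_Icc y)
    rw [hd] at this
    rwa [hu.past 0 le_rfl]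
  have bdd : ∀ {F : ℝ → ℝ} {A : ℝ × ℝ → ℝ}, Continuous F →
      Integrable A ((volume.restrict (Ioc 0 T)).prod volume) →
      Integrable (fun z : ℝ × ℝ => F z.1 * A z) ((volume.restrict (Ioc 0 T)).prod volume) :=
    fun {F A} hF hA => by
      obtain ⟨c, hc⟩ := (isCompact_Icc (a := (0 : ℝ)) (b := T)).exists_bound_of_continuousOn
        hF.continuousOn
      refine hA.bdd_mul (c := c) (hF.comp continuous_fst).aestronglyMeasurable ?_
      have : ∀ᵐ z ∂((volume.restrict (Ioc 0 T)).prod (volume : Measure ℝ)), z.1 ∈ Ioc 0 T :=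
        Measure.quasiMeasurePreserving_fst.ae (ae_restrict_mem measurableSet_Ioc)
      filter_upwards [this] with z hz using hc _ (Ioc_subset_Icc_self hz)
  have B1 := bdd hχ.continuous_deriv A1.2
  have B2 := bdd hχ.contDiff.continuous A2.2
  have B12 : Integrable (Function.uncurry fun (t y : ℝ) =>
      deriv χ t * (∫ x, |u t x - q y| * η (x - y)) +
        χ t * ∫ x, (kruzhkovFlux g (u t x) (q y) * α (u (t - τ)) x * deriv η (x - y)
          - Real.sign (u t x - q y) * g (q y) * β (u (t - τ)) x * η (x - y)))
      ((volume.restrict (Ioc 0 T)).prod volume) := B1.add B2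
  have h0 : Integrable fun y => ∫ x, |u 0 x - q y| * η (x - y) :=
    Integrable.integral_prod_right (μ := volume) (f := fun z : ℝ × ℝ => |u 0 z.1 - q z.2| * η (z.1 - z.2))
      ((hu.isProfile 0).integrable_abs_sub_mul hq hη.integrable hη.measurable)
  have key : 0 ≤ ∫ y, ((∫ t in (0 : ℝ)..T, (deriv χ t * (∫ x, |u t x - q y| * η (x - y)) +
        χ t * ∫ x, (kruzhkovFlux g (u t x) (q y) * α (u (t - τ)) x * deriv η (x - y)
          - Real.sign (u t x - q y) * g (q y) * β (u (t - τ)) x * η (x - y))))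
      + χ 0 * ∫ x, |u 0 x - q y| * η (x - y)) := integral_nonneg hpt
  rw [integral_add (B12.integral_prod_right.congr (Eventually.of_forall fun y => by
    simp only [intervalIntegral.integral_of_le hT.le, Function.uncurry])) (h0.const_mul _),
    integral_const_mul, A1.1 0] at key
  refine key.trans (le_of_eq ?_)
  unfold kuznetsov kruzhkovRate
  congr 1
  simp only [intervalIntegral.integral_of_le hT.le]
  -- The entropy inequalities hold for each fixed `y` and are integrated in time; Fubini moves the
  -- integral over `y` inside, where it completes the double integrals defining the functional and
  -- the rate.
  rw [← integral_integral_swap B12]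
  refine integral_congr_ae ?_
  filter_upwards [B1.prod_right_ae, B2.prod_right_ae] with t ht1 ht2
  rw [integral_add ht1 ht2, integral_const_mul, integral_const_mul, A1.1 t, A2.1 t]

/-- The Kuznetsov inequality for two solutions with the same datum. -/
theorem ae_kuznetsov_le (hu : IsKruzhkovSolution T R M τ g α β r₀ u)
    (hw : IsKruzhkovSolution T R M τ' g α β r₀ w) (h : IsFlux R M C g α β)
    (hη : IsMollifier m ε η) (hm : 0 ≤ m) (hT : 0 < T) :
    ∀ᵐ t ∂(volume.restrict (Icc 0 T)), kuznetsov η (u t) (w t) ≤ kuznetsov η r₀ r₀ +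
      ∫ s in (0 : ℝ)..t, (5 * C ^ 2 + R * C) * (1 + m) * (kuznetsov η (u s) (w s)
        + kuznetsov η (u (s - τ)) (w (s - τ')) + ε
        + (1 + kuznetsov η (u s) (u s) / ε) * ∫ x, |u (s - τ) x - w (s - τ') x|) := by
  set K := (5 * C ^ 2 + R * C) * (1 + m) with hK
  have hC := h.C_nonneg
  have hM := h.M_nonneg
  have hε := hη.ε_pos
  have hK0 : 0 ≤ K := by have := h.R_nonneg; positivity
  -- The error `D` has to dominate both the increment of `Φ` (the summand `1`) and the change of the
  -- rate bound when `w` is moved from time `s` to time `t` (the rest). It may depend on `ε`, which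
  -- stays fixed while the time variables merge.
  set K1 := 1 + K * (2 + 2 * M / ε) with hK1
  have hK10 : 0 ≤ K1 := by positivity
  have hup := hu.isProfile
  have hwp := hw.isProfile
  have mΦ := measurable_kuznetsov hη.measurable hu.measurable hw.measurable
  have mΦ' := measurable_kuznetsov hη.measurable hu.measurable_shift hw.measurable_shift
  have mJ := measurable_kuznetsov hη.measurable hu.measurable hu.measurable
  have mN := measurable_integral_abs_sub hu.measurable_shift hw.measurable_shift
  have mdiag : Measurable fun t : ℝ => (t, t) := by fun_prop
  have mD1 := measurable_integral_abs_sub hw.measurable hw.measurable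
  have mD2 := measurable_integral_abs_sub hw.measurable_shift hw.measurable_shift
  have mswap : Measurable fun z : ℝ × ℝ => (z.2, z.1) := by fun_prop
  have hN0 : ∀ p q : ℝ → ℝ, 0 ≤ ∫ x, |p x - q x| := fun p q => integral_nonneg fun _ => abs_nonneg _
  have habs : ∀ {x b : ℝ}, 0 ≤ x → x ≤ b → |x| ≤ b := fun h0 h1 => by rwa [abs_of_nonneg h0]
  set B1 := 2 * M
  set B2 := 2 * M * (C * C * (2 / ε) + C)
  set B3 := K * (2 * M + 2 * M + ε + (1 + 2 * M / ε) * (2 * M))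
  set B4 := K1 * (2 * M + 2 * M)
  have hB1 : 0 ≤ B1 := by positivity
  have hB2 : 0 ≤ B2 := by positivity
  have hB3 : 0 ≤ B3 := by positivity
  have hB4 : 0 ≤ B4 := by positivity
  have key := ae_diag_le_of_forall_isTimeTest (B := B1 + B2 + B3 + B4) hT
    (Φ := fun t s => kuznetsov η (u t) (w s))
    (P := fun t s => kruzhkovRate g α β η (u t) (u (t - τ)) (w s))
    (Q := fun t s => kruzhkovRate g α β η (w s) (w (s - τ')) (u t))
    (D := fun t s => K1 * ((∫ x, |w s x - w t x|) + ∫ x, |w (s - τ') x - w (t - τ') x|))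
    (k := fun s => K * (kuznetsov η (u s) (w s)
        + kuznetsov η (u (s - τ)) (w (s - τ')) + ε
        + (1 + kuznetsov η (u s) (u s) / ε) * ∫ x, |u (s - τ) x - w (s - τ') x|))
    mΦ
    (h.measurable_rate hη hu.measurable hu.measurable_shift (fun t => hup _) hw.measurable)
    ((h.measurable_rate hη hw.measurable hw.measurable_shift (fun t => hwp _)
      hu.measurable).comp mswap)
    (((mD1.comp mswap).add (mD2.comp mswap)).const_mul K1)
    (((((mΦ.comp mdiag).add (mΦ'.comp mdiag)).add_const ε).add
      ((((mJ.comp mdiag).div_const ε).const_add 1).mul (mN.comp mdiag))).const_mul K)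
    (fun t s => (habs (kuznetsov_nonneg hη) (kuznetsov_le hη (hup t) (hwp s))).trans (by linarith))
    (fun t s => (h.abs_rate_le hη (hup t) (hup _) (hwp s)).trans (by linarith))
    (fun t s => (h.abs_rate_le hη (hwp s) (hwp _) (hup t)).trans (by linarith))
    (fun t => by
      have j0 : 0 ≤ kuznetsov η (u t) (u t) := kuznetsov_nonneg hη
      have j1 : 0 ≤ kuznetsov η (u t) (w t) := kuznetsov_nonneg hη
      have j2 : 0 ≤ kuznetsov η (u (t - τ)) (w (t - τ')) := kuznetsov_nonneg hη
      have n0 := hN0 (u (t - τ)) (w (t - τ'))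
      refine (habs (by positivity) (?_ : _ ≤ B3)).trans (by linarith)
      refine mul_le_mul_of_nonneg_left ?_ hK0
      gcongr
      · exact kuznetsov_le hη (hup _) (hwp _)
      · exact kuznetsov_le hη (hup _) (hwp _)
      · exact kuznetsov_le hη (hup _) (hup _)
      · exact (hup _).integral_abs_sub_le (hwp _))
    (fun t s => by
      have n0 := hN0 (w s) (w t)
      have n1 := hN0 (w (s - τ')) (w (t - τ'))
      refine (habs (by positivity) (?_ : _ ≤ B4)).trans (by linarith)
      refine mul_le_mul_of_nonneg_left ?_ hK10
      gcongr
      · exact (hwp _).integral_abs_sub_le (hwp _)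
      · exact (hwp _).integral_abs_sub_le (hwp _))
    (fun t s => mul_nonneg hK10 (add_nonneg (hN0 _ _) (hN0 _ _)))
    (fun s χ hχ => hu.integrated h hη hT (hwp s) hχ)
    (fun t χ hχ => by
      have := hw.integrated h hη hT (hup t) hχ
      simp_rw [kuznetsov_comm hη (p := w _) (q := u t)] at this
      exact this)
    (fun t s => by
      refine (h.rate_add_rate_le hη hm (hup t) (hup _) (hwp s) (hwp _)).trans ?_
      rw [← hK]
      -- Only the second solution is moved in time. The coefficient containing the self functional
      -- of `u` stays at time `t`, and its crude bound `2 M / ε` is used only on the error.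
      have t1 := kuznetsov_le_add hη (hup t) (hwp t) (hwp s)
      have t2 := kuznetsov_le_add hη (hup (t - τ)) (hwp (t - τ')) (hwp (s - τ'))
      have t3 := (hup (t - τ)).integral_abs_sub_triangle (hwp (t - τ')) (hwp (s - τ'))
      simp_rw [abs_sub_comm (w t _) (w s _)] at t1
      simp_rw [abs_sub_comm (w (t - τ') _) (w (s - τ') _)] at t2 t3
      set x1 := ∫ x, |w s x - w t x|
      set x2 := ∫ x, |w (s - τ') x - w (t - τ') x|
      have hx1 : 0 ≤ x1 := hN0 _ _
      have hx2 : 0 ≤ x2 := hN0 _ _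
      have hj0 : 0 ≤ kuznetsov η (u t) (u t) / ε := div_nonneg (kuznetsov_nonneg hη) hε.le
      have hj : kuznetsov η (u t) (u t) / ε ≤ 2 * M / ε := by
        gcongr; exact kuznetsov_le hη (hup t) (hup t)
      set j := kuznetsov η (u t) (u t) / ε
      have t4 : (1 + j) * (∫ x, |u (t - τ) x - w (s - τ') x|) ≤
          (1 + j) * (∫ x, |u (t - τ) x - w (t - τ') x|) + (1 + 2 * M / ε) * x2 := by
        have := mul_le_mul_of_nonneg_left t3 (by linarith : 0 ≤ 1 + j)
        have := mul_le_mul_of_nonneg_right hj hx2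
        linarith
      have t5 : K * (kuznetsov η (u t) (w s) + kuznetsov η (u (t - τ)) (w (s - τ')) + ε
          + (1 + j) * ∫ x, |u (t - τ) x - w (s - τ') x|) ≤
          K * ((kuznetsov η (u t) (w t) + kuznetsov η (u (t - τ)) (w (t - τ')) + ε
          + (1 + j) * ∫ x, |u (t - τ) x - w (t - τ') x|) + (x1 + (2 + 2 * M / ε) * x2)) :=
        mul_le_mul_of_nonneg_left (by linarith) hK0
      have t6 : K * (x1 + (2 + 2 * M / ε) * x2) ≤ K1 * (x1 + x2) := by
        have : 0 ≤ 2 * M / ε := by positivity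
        have a1 : 0 ≤ K * (2 * M / ε) * x1 := by positivity
        have a2 : 0 ≤ K * x1 := by positivity
        rw [hK1]
        linarith
      linarith)
    (fun t s => by
      have t1 := kuznetsov_le_add hη (hup t) (hwp t) (hwp s)
      have t2 := kuznetsov_le_add hη (hup t) (hwp s) (hwp t)
      simp_rw [abs_sub_comm (w t _) (w s _)] at t1
      have n0 := hN0 (w s) (w t)
      have n1 := hN0 (w (s - τ')) (w (t - τ'))
      have : |kuznetsov η (u t) (w s) - kuznetsov η (u t) (w t)| ≤
          1 * ((∫ x, |w s x - w t x|) + ∫ x, |w (s - τ') x - w (t - τ') x|) := by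
        rw [abs_le]; constructor <;> linarith
      refine this.trans (mul_le_mul_of_nonneg_right ?_ (add_nonneg n0 n1))
      have : 0 ≤ K * (2 + 2 * M / ε) := by positivity
      linarith)
    (by
      have l1 := tendsto_integral_time_translate hT hw.measurable hwp
      have l2 := tendsto_integral_time_translate hT hw.measurable_shift (fun t => hwp _)
      have l3 := (l1.add l2).const_mul K1
      rw [add_zero, mul_zero] at l3
      refine l3.congr fun c => ?_
      rw [intervalIntegral.integral_const_mul, intervalIntegral.integral_add]
      · refine (intervalIntegrable_const (c := 2 * M)).mono_fun'
          (mD1.comp (by fun_prop : Measurable fun t : ℝ => (t + c, t))).aestronglyMeasurable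
          (Eventually.of_forall fun t => ?_)
        exact habs (hN0 _ _) ((hwp _).integral_abs_sub_le (hwp _))
      · refine (intervalIntegrable_const (c := 2 * M)).mono_fun'
          (mD2.comp (by fun_prop : Measurable fun t : ℝ => (t + c, t))).aestronglyMeasurable
          (Eventually.of_forall fun t => ?_)
        exact habs (hN0 _ _) ((hwp _).integral_abs_sub_le (hwp _)))
  simpa only [hu.past 0 le_rfl, hw.past 0 le_rfl] using key

end IsKruzhkovSolution


/-! ### Spatial regularity, time modulus and stability in the delay -/

theorem IsFlux.g_zero {R M C : ℝ} {g : ℝ → ℝ} {α β : (ℝ → ℝ) → ℝ → ℝ} (h : IsFlux R M C g α β) :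
    g 0 = 0 :=
  le_antisymm (h.g_le 0 ⟨le_rfl, h.R_nonneg⟩) (h.g_nonneg 0 ⟨le_rfl, h.R_nonneg⟩)

/-- For `κ = 0` and `κ = R` the Kruzhkov flux on `[0, R]` is `g` and `-g` respectively. The two
entropy inequalities are therefore the two halves of the weak equation. -/
theorem IsFlux.kruzhkovFlux_zero {R M C : ℝ} {g : ℝ → ℝ} {α β : (ℝ → ℝ) → ℝ → ℝ}
    (h : IsFlux R M C g α β) {a : ℝ} (ha : a ∈ Icc 0 R) : kruzhkovFlux g a 0 = g a := by
  unfold kruzhkovFlux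
  rw [sub_zero, h.g_zero, sub_zero]
  rcases ha.1.eq_or_lt with rfl | h0
  · simp [h.g_zero]
  · rw [Real.sign_of_pos h0, one_mul]

theorem IsFlux.kruzhkovFlux_R {R M C : ℝ} {g : ℝ → ℝ} {α β : (ℝ → ℝ) → ℝ → ℝ}
    (h : IsFlux R M C g α β) {a : ℝ} (ha : a ∈ Icc 0 R) : kruzhkovFlux g a R = -g a := by
  unfold kruzhkovFlux
  rw [h.g_R, sub_zero]
  rcases ha.2.eq_or_lt with rfl | h0
  · simp [h.g_R]
  · rw [Real.sign_of_neg (sub_neg.2 h0), neg_one_mul]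

/-- Bound of the Kuznetsov functional of a solution with itself, relative to `c₀` for the datum. -/
noncomputable def selfBound (K T c₀ : ℝ) : ℝ := (c₀ + K * T * c₀ + K * T) * Real.exp (2 * K * T)

/-- Bound for the distance of two solutions relative to `c` for the self distance. -/
noncomputable def distBound (K T c : ℝ) : ℝ :=
  c + (c + K * (2 + c) * T * c + K * T * (2 + c) * (1 + c)) * Real.exp (K * (3 + c) * T)

theorem le_selfBound {K T c₀ : ℝ} (hK : 0 ≤ K) (hT : 0 ≤ T) (hc : 0 ≤ c₀) :
    c₀ ≤ selfBound K T c₀ := by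
  unfold selfBound
  have h1 : 1 ≤ Real.exp (2 * K * T) := Real.one_le_exp (by positivity)
  have h2 : 0 ≤ K * T * c₀ := by positivity
  have h3 : 0 ≤ K * T := by positivity
  nlinarith

namespace IsKruzhkovSolution

variable {T R M C m ε τ τ' c c₀ δ : ℝ} {g η r₀ q : ℝ → ℝ} {α β : (ℝ → ℝ) → ℝ → ℝ}
  {u w : ℝ → ℝ → ℝ}

theorem isProfile_datum (hu : IsKruzhkovSolution T R M τ g α β r₀ u) : IsProfile R M r₀ := by
  rw [← hu.past 0 le_rfl]; exact hu.isProfile 0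

/-- Bound on the spatial variation of a solution. -/
theorem ae_kuznetsov_self_le (hu : IsKruzhkovSolution T R M τ g α β r₀ u)
    (h : IsFlux R M C g α β) (hη : IsMollifier m ε η) (hm : 0 ≤ m) (hT : 0 < T)
    (h0 : kuznetsov η r₀ r₀ ≤ c₀ * ε) :
    ∀ᵐ t ∂(volume.restrict (Icc 0 T)), kuznetsov η (u t) (u t) ≤
      selfBound ((5 * C ^ 2 + R * C) * (1 + m)) T c₀ * ε := by
  have key := hu.ae_kuznetsov_le hu h hη hm hT
  set K := (5 * C ^ 2 + R * C) * (1 + m) with hK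
  have hC := h.C_nonneg
  have hK0 : 0 ≤ K := by have := h.R_nonneg; positivity
  have hε := hη.ε_pos
  set J : ℝ → ℝ := fun t => kuznetsov η (u t) (u t) with hJ
  have hJm : Measurable J := (measurable_kuznetsov hη.measurable hu.measurable hu.measurable).comp
    (by fun_prop : Measurable fun t : ℝ => (t, t))
  have hJ0 : ∀ t, 0 ≤ J t := fun t => kuznetsov_nonneg hη
  have hJB : ∀ t, J t ≤ 2 * M := fun t => kuznetsov_le hη (hu.isProfile t) (hu.isProfile t)
  have hJp : ∀ t ≤ 0, J t = kuznetsov η r₀ r₀ := fun t ht => by simp only [hJ, hu.past t ht]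
  have hint : ∀ a b, IntervalIntegrable J volume a b := fun a b =>
    (intervalIntegrable_const (c := 2 * M)).mono_fun' hJm.aestronglyMeasurable
      (Eventually.of_forall fun s => by
        simp only [Real.norm_eq_abs, abs_of_nonneg (hJ0 s), hJB s])
  have hint' : ∀ a b, IntervalIntegrable (fun s => J (s - τ)) volume a b := fun a b =>
    (intervalIntegrable_const (c := 2 * M)).mono_fun'
      (hJm.comp (measurable_id.sub_const τ)).aestronglyMeasurable
      (Eventually.of_forall fun s => by
        simp only [Real.norm_eq_abs, abs_of_nonneg (hJ0 _), hJB _])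
  have hr0 : 0 ≤ kuznetsov η r₀ r₀ := kuznetsov_nonneg hη
  have hc0 : 0 ≤ c₀ * ε := hr0.trans h0
  have h2 : ∀ᵐ t ∂(volume.restrict (Icc 0 T)), J t ≤
      (c₀ + K * T * c₀ + K * T) * ε + (2 * K) * ∫ s in (0 : ℝ)..t, J s := by
    filter_upwards [key, ae_restrict_mem measurableSet_Icc] with t ht htI
    refine ht.trans ?_
    -- Comparing `u` with itself makes the two speeds equal, so the product of `J/ε` with the `L¹`
    -- distance disappears and the inequality for `J` becomes linear.
    have e1 : ∫ s in (0 : ℝ)..t, K * (kuznetsov η (u s) (u s) + kuznetsov η (u (s - τ)) (u (s - τ))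
        + ε + (1 + kuznetsov η (u s) (u s) / ε) * ∫ x, |u (s - τ) x - u (s - τ) x|) =
        K * ((∫ s in (0 : ℝ)..t, J s) + (∫ s in (0 : ℝ)..t, J (s - τ)) + t * ε) := by
      rw [intervalIntegral.integral_const_mul]
      simp only [sub_self, abs_zero, integral_zero, mul_zero, add_zero]
      rw [intervalIntegral.integral_add ((hint _ _).add (hint' _ _)) intervalIntegrable_const,
        intervalIntegral.integral_add (hint _ _) (hint' _ _), intervalIntegral.integral_const,
        sub_zero, smul_eq_mul]
    rw [e1]
    have e2 := integral_delay_le hu.τ_nonneg htI hJm hJ0 hJB hJp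
    have e3 : t * ε ≤ T * ε := mul_le_mul_of_nonneg_right htI.2 hε.le
    have e4 := mul_le_mul_of_nonneg_left h0 (mul_nonneg hK0 hT.le)
    have e5 := mul_le_mul_of_nonneg_left (add_le_add e2 e3) hK0
    linarith
  have hc0' : 0 ≤ c₀ := by
    by_contra hneg
    push Not at hneg
    nlinarith
  have := ae_le_of_ae_le_add_integral (by positivity) (by positivity) (hint 0 T) hT h2
  filter_upwards [this] with t ht
  refine ht.trans (le_of_eq ?_)
  unfold selfBound
  ring

/-- The weak form of the equation, tested with a translated mollifier. -/
theorem ae_weak_form (hu : IsKruzhkovSolution T R M τ g α β r₀ u) (h : IsFlux R M C g α β)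
    (hη : IsMollifier m ε η) (hT : 0 < T) (y : ℝ) :
    ∀ᵐ t ∂(volume.restrict (Icc 0 T)), ∫ x, u t x * η (x - y) = (∫ x, r₀ x * η (x - y)) +
      ∫ s in (0 : ℝ)..t, ∫ x, g (u s x) * α (u (s - τ)) x * deriv η (x - y) := by
  have hd : deriv (fun x => η (x - y)) = fun x => deriv η (x - y) :=
    funext fun x => deriv_comp_sub_const η y x
  have hηi := hη.integrable.comp_sub_right y
  have hη'i := hη.integrable_deriv.comp_sub_right y
  have hψd : Integrable (deriv fun x => η (x - y)) := by rw [hd]; exact hη'i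
  have hψc : ContDiff ℝ 1 fun x => η (x - y) := hη.contDiff.comp (contDiff_id.sub contDiff_const)
  have hR := h.R_nonneg
  have hC := h.C_nonneg
  have hpi : ∀ p, IsProfile R M p → Integrable fun x => p x * η (x - y) := fun p hp =>
    hηi.bdd_mul (c := R) hp.measurable.aestronglyMeasurable (Eventually.of_forall fun x => by
      rw [Real.norm_of_nonneg (hp.nonneg x)]; exact hp.le x)
  set mf : ℝ → ℝ := fun t => ∫ x, u t x * η (x - y) with hmf
  set e : ℝ → ℝ := fun s => ∫ x, g (u s x) * α (u (s - τ)) x * deriv η (x - y) with he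
  have hmm : Measurable mf := by
    have : Measurable fun z : ℝ × ℝ => u z.1 z.2 * η (z.2 - y) :=
      hu.measurable.mul (hη.measurable.comp (by fun_prop))
    exact this.stronglyMeasurable.integral_prod_right'.measurable
  have hem : Measurable e := by
    have : Measurable fun z : ℝ × ℝ =>
        g (u z.1 z.2) * α (u (z.1 - τ)) z.2 * deriv η (z.2 - y) :=
      ((h.g_continuous.measurable.comp hu.measurable).mul (h.α_measurable _ hu.measurable_shift
        fun t => hu.isProfile _)).mul (hη.continuous_deriv.measurable.comp (by fun_prop))
    exact this.stronglyMeasurable.integral_prod_right'.measurable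
  have hmB : ∀ t, |mf t| ≤ R * ∫ x, η (x - y) := fun t => by
    rw [← integral_const_mul, ← Real.norm_eq_abs]
    refine norm_integral_le_of_norm_le (hηi.const_mul R) (Eventually.of_forall fun x => ?_)
    rw [norm_mul, Real.norm_of_nonneg ((hu.isProfile t).nonneg x), Real.norm_of_nonneg (hη.nonneg _)]
    exact mul_le_mul_of_nonneg_right ((hu.isProfile t).le x) (hη.nonneg _)
  have heB : ∀ t, |e t| ≤ R * C * ∫ x, |deriv η (x - y)| := fun t => by
    rw [← integral_const_mul, ← Real.norm_eq_abs (e t)]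
    refine norm_integral_le_of_norm_le (hη'i.abs.const_mul (R * C)) (Eventually.of_forall fun x => ?_)
    rw [norm_mul, norm_mul, Real.norm_of_nonneg (h.g_nonneg _ ((hu.isProfile t).mem_Icc x)),
      Real.norm_eq_abs, Real.norm_eq_abs]
    gcongr
    · exact (h.g_le _ ((hu.isProfile t).mem_Icc x)).trans ((hu.isProfile t).le x)
    · exact h.α_bound _ (hu.isProfile _) _
  have him : IntervalIntegrable mf volume 0 T :=
    intervalIntegrable_const.mono_fun' hmm.aestronglyMeasurable (Eventually.of_forall hmB)
  have hie : ∀ t, IntervalIntegrable e volume 0 t := fun t =>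
    intervalIntegrable_const.mono_fun' hem.aestronglyMeasurable (Eventually.of_forall heB)
  -- The upper bound comes from `κ = 0`, where `|u| = u`, and the lower bound `lo` from `κ = R`,
  -- where `|u - R| = R - u`. Both constants annihilate the source term.
  have up := ae_le_of_forall_isTimeTest (m₀ := ∫ x, r₀ x * η (x - y)) hT him (hie T) fun χ hχ => by
    have := hu.entropy χ hχ _ hψc (fun x => hη.nonneg _) hηi hψd 0 ⟨le_rfl, hR⟩
    rw [hd] at this
    simpa only [sub_zero, h.g_zero, h.kruzhkovFlux_zero ((hu.isProfile _).mem_Icc _),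
      abs_of_nonneg ((hu.isProfile _).nonneg _), abs_of_nonneg (hu.isProfile_datum.nonneg _),
      mul_zero, zero_mul] using this
  have hRp : ∀ p, IsProfile R M p → ∫ x, |p x - R| * η (x - y) =
      R * (∫ x, η (x - y)) - ∫ x, p x * η (x - y) := fun p hp => by
    rw [← integral_const_mul, ← integral_sub (hηi.const_mul R) (hpi p hp)]
    congr 1; ext x
    rw [abs_of_nonpos (by linarith [hp.le x])]; ring
  have lo := ae_le_of_forall_isTimeTest (m := fun t => R * (∫ x, η (x - y)) - mf t)
    (e := fun t => -e t) (m₀ := R * (∫ x, η (x - y)) - ∫ x, r₀ x * η (x - y)) hT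
    (intervalIntegrable_const.sub him) (hie T).neg fun χ hχ => by
    have := hu.entropy χ hχ _ hψc (fun x => hη.nonneg _) hηi hψd R ⟨hR, le_rfl⟩
    rw [hd] at this
    simpa only [h.g_R, h.kruzhkovFlux_R ((hu.isProfile _).mem_Icc _), hRp _ (hu.isProfile _),
      hRp _ hu.isProfile_datum, mul_zero, zero_mul, sub_zero, neg_mul, integral_neg, hmf, he]
      using this
  filter_upwards [up, lo] with t h1 h2
  rw [intervalIntegral.integral_neg] at h2
  exact le_antisymm h1 (by linarith)

/-- Time modulus of continuity of a solution, on a set of full measure. -/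
theorem exists_modulus (hu : IsKruzhkovSolution T R M τ g α β r₀ u) (h : IsFlux R M C g α β)
    (hη : IsMollifier m ε η) (hT : 0 < T) (h0 : kuznetsov η r₀ r₀ ≤ c * ε)
    (hc : ∀ᵐ t ∂(volume.restrict (Icc 0 T)), kuznetsov η (u t) (u t) ≤ c * ε) :
    ∃ S : Set ℝ, 0 ∈ S ∧ (∀ᵐ t ∂(volume.restrict (Icc 0 T)), t ∈ S) ∧
      ∀ t ∈ S, ∀ t' ∈ S, 0 ≤ t' → t' ≤ t → t ≤ T →
        ∫ x, |u t x - u t' x| ≤ 2 * c * ε + 2 * C * M / ε * (t - t') := by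
  have hC := h.C_nonneg
  have hM := h.M_nonneg
  have hε := hη.ε_pos
  set G : ℝ → ℝ → ℝ → ℝ := fun s x y => g (u s x) * α (u (s - τ)) x * deriv η (x - y) with hG
  have hGm : Measurable fun z : ℝ × (ℝ × ℝ) => G z.1 z.2.1 z.2.2 := by
    have m1 : Measurable fun z : ℝ × (ℝ × ℝ) => (z.1, z.2.1) := by fun_prop
    exact ((h.g_continuous.measurable.comp (hu.measurable.comp m1)).mul
      ((h.α_measurable _ hu.measurable_shift fun t => hu.isProfile _).comp m1)).mul
      (hη.continuous_deriv.measurable.comp (by fun_prop))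
  have hGle : ∀ t x y, |G t x y| ≤ (u t x + (fun _ => (0 : ℝ)) y) * (C * |deriv η (x - y)|) :=
    fun t x y => by
      simp only [hG, add_zero]
      rw [abs_mul, abs_mul, abs_of_nonneg (h.g_nonneg _ ((hu.isProfile t).mem_Icc x)), ← mul_assoc]
      gcongr
      · exact (hu.isProfile t).nonneg x
      · exact h.g_le _ ((hu.isProfile t).mem_Icc x)
      · exact h.α_bound _ (hu.isProfile _) _
  have hzero : IsProfile R M fun _ => (0 : ℝ) :=
    ⟨measurable_const, fun _ => ⟨le_rfl, h.R_nonneg⟩, integrable_zero _ _ _, by simpa using hM⟩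
  have hk : Integrable fun z => C * |deriv η z| := hη.integrable_deriv.abs.const_mul C
  obtain ⟨-, hGi⟩ := integrable_partial_integral (T := T) hu.isProfile hzero hk hGm hGle
  set e : ℝ → ℝ → ℝ := fun s y => ∫ x, G s x y with he
  have hem : Measurable (Function.uncurry e) := by
    have : Measurable fun z : (ℝ × ℝ) × ℝ => G z.1.1 z.2 z.1.2 :=
      hGm.comp (by fun_prop : Measurable fun z : (ℝ × ℝ) × ℝ => (z.1.1, (z.2, z.1.2)))
    exact this.stronglyMeasurable.integral_prod_right'.measurable
  -- the mass of `e s` is bounded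
  have hGint : ∀ s, Integrable (fun z : ℝ × ℝ => G s z.1 z.2) (volume.prod volume) := fun s =>
    integrable_of_abs_le_add_mul_sub (hu.isProfile s).integrable hzero.integrable hk
      (hGm.comp (measurable_const.prodMk measurable_id)).aestronglyMeasurable
      fun z => hGle s z.1 z.2
  have heint : ∀ s, Integrable (e s) := fun s => (hGint s).integral_prod_right
  have heB : ∀ s, ∫ y, |e s y| ≤ 2 * C * M / ε := fun s => by
    have h1 : ∫ y, |e s y| ≤ ∫ y, ∫ x, ‖G s x y‖ :=
      integral_mono (heint s).abs (hGint s).norm.integral_prod_right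
        fun y => norm_integral_le_integral_norm fun x => G s x y
    have h2 : ∫ y, ∫ x, ‖G s x y‖ = ∫ z : ℝ × ℝ, ‖G s z.1 z.2‖ :=
      (integral_prod_symm _ (hGint s).norm).symm
    have h3 := abs_integral_le_add_mul_sub (hu.isProfile s).integrable hzero.integrable hk
      (F := fun z => ‖G s z.1 z.2‖) fun z => by
        rw [Real.norm_eq_abs, abs_abs]; exact hGle s z.1 z.2
    rw [integral_zero, add_zero, integral_const_mul] at h3
    refine h1.trans (h2.le.trans ((le_abs_self _).trans (h3.trans ?_)))
    calc _ ≤ M * (C * (2 / ε)) := by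
          gcongr
          · exact (hu.isProfile s).integral_le
          · exact hη.integral_abs_deriv_le
      _ = _ := by ring
  -- `W` is the defect in the weak form. The time integral is written over the whole line with a
  -- condition on `s`, which makes `W` visibly measurable in `(t, y)` jointly.
  set W : ℝ → ℝ → ℝ := fun t y => (∫ x, u t x * η (x - y)) - (∫ x, r₀ x * η (x - y))
    - ∫ s, if 0 < s ∧ s ≤ t then e s y else 0 with hW
  have hWm : Measurable (Function.uncurry W) := by
    have a1 : Measurable fun z : (ℝ × ℝ) × ℝ => u z.1.1 z.2 * η (z.2 - z.1.2) :=
      (hu.measurable.comp (by fun_prop : Measurable fun z : (ℝ × ℝ) × ℝ => (z.1.1, z.2))).mul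
        (hη.measurable.comp (by fun_prop))
    have a2 : Measurable fun z : (ℝ × ℝ) × ℝ => r₀ z.2 * η (z.2 - z.1.2) :=
      (hu.isProfile_datum.measurable.comp measurable_snd).mul (hη.measurable.comp (by fun_prop))
    have a3 : Measurable fun z : (ℝ × ℝ) × ℝ =>
        if 0 < z.2 ∧ z.2 ≤ z.1.1 then e z.2 z.1.2 else 0 := by
      refine Measurable.ite ?_ (hem.comp (by fun_prop :
        Measurable fun z : (ℝ × ℝ) × ℝ => (z.2, z.1.2))) measurable_const
      exact (measurableSet_lt measurable_const measurable_snd).inter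
        (measurableSet_le measurable_snd (measurable_fst.comp measurable_fst))
    exact ((a1.stronglyMeasurable.integral_prod_right'.measurable).sub
      a2.stronglyMeasurable.integral_prod_right'.measurable).sub
      a3.stronglyMeasurable.integral_prod_right'.measurable
  have hite : ∀ t y, 0 ≤ t → (∫ s, if 0 < s ∧ s ≤ t then e s y else 0) =
      ∫ s in (0 : ℝ)..t, e s y := fun t y ht => by
    rw [intervalIntegral.integral_of_le ht, ← integral_indicator measurableSet_Ioc]
    congr 1; ext s
    simp [indicator, mem_Ioc]
  -- The weak form has an exceptional set of times depending on `y`. Joint measurability allows the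
  -- order of the quantifiers to be exchanged.
  have hW0 : ∀ᵐ t ∂(volume.restrict (Icc 0 T)), ∀ᵐ y, W t y = 0 := by
    have hcomm := Measure.ae_ae_comm (μ := (volume : Measure ℝ)) (ν := volume.restrict (Icc 0 T))
      (p := fun y t => W t y = 0)
      ((hWm.comp (by fun_prop : Measurable fun z : ℝ × ℝ => (z.2, z.1)))
        (measurableSet_singleton 0))
    refine hcomm.1 (Eventually.of_forall fun y => ?_)
    filter_upwards [hu.ae_weak_form h hη hT y, ae_restrict_mem measurableSet_Icc] with t ht htI
    simp only [hW]
    rw [hite t y htI.1, ht]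
    simp only [he, hG]
    ring
  refine ⟨{t | kuznetsov η (u t) (u t) ≤ c * ε ∧ ∀ᵐ y, W t y = 0}, ⟨?_, ?_⟩, ?_, ?_⟩
  · rw [hu.past 0 le_rfl]; exact h0
  · refine Eventually.of_forall fun y => ?_
    simp only [hW, hite 0 y le_rfl, hu.past 0 le_rfl, intervalIntegral.integral_same]
    ring
  · filter_upwards [hc, hW0] with t h1 h2 using ⟨h1, h2⟩
  · rintro t ⟨hJt, hWt⟩ t' ⟨hJt', hWt'⟩ ht'0 htt htT
    -- Each slice is replaced by its mollification at a cost of its self functional, which gives the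
    -- `2 c ε`. The mollified slices differ by the time integral of the flux, whose `L¹` norm in `y`
    -- is bounded by `heB`.
    have conv : ∀ p, IsProfile R M p → Integrable (fun y => ∫ x, p x * η (x - y)) ∧
        ∫ y, |p y - ∫ x, p x * η (x - y)| ≤ kuznetsov η p p := fun p hp => by
      have i1 := integrable_fst_mul_sub hp.integrable hη.integrable
      have i2 : Integrable (fun y => ∫ x, p x * η (x - y)) :=
        Integrable.integral_prod_right (μ := volume) (f := fun z : ℝ × ℝ => p z.1 * η (z.1 - z.2)) i1
      have i3 : Integrable (fun z : ℝ × ℝ => |p z.1 - p z.2| * η (z.1 - z.2)) (volume.prod volume) :=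
        hp.integrable_abs_sub_mul hp hη.integrable hη.measurable
      refine ⟨i2, ?_⟩
      unfold kuznetsov
      rw [Measure.volume_eq_prod, integral_prod_symm _ i3]
      refine integral_mono (hp.integrable.sub i2).abs i3.integral_prod_right fun y => ?_
      have j1 : Integrable fun x => η (x - y) := hη.integrable.comp_sub_right y
      have j2 : Integrable fun x => p x * η (x - y) :=
        j1.bdd_mul (c := R) hp.measurable.aestronglyMeasurable (Eventually.of_forall fun x => by
          rw [Real.norm_of_nonneg (hp.nonneg x)]; exact hp.le x)
      have j3 : p y - ∫ x, p x * η (x - y) = ∫ x, (p y - p x) * η (x - y) := by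
        simp_rw [sub_mul]
        rw [integral_sub (j1.const_mul _) j2, integral_const_mul, integral_sub_right_eq_self,
          hη.integral_eq, mul_one]
      beta_reduce
      rw [j3]
      refine (norm_integral_le_integral_norm fun x => (p y - p x) * η (x - y)).trans (le_of_eq ?_)
      congr 1; ext x
      rw [norm_mul, Real.norm_eq_abs, Real.norm_of_nonneg (hη.nonneg _), abs_sub_comm]
    obtain ⟨c1, c2⟩ := conv _ (hu.isProfile t)
    obtain ⟨c1', c2'⟩ := conv _ (hu.isProfile t')
    set U : ℝ → ℝ := fun y => ∫ x, u t x * η (x - y) with hU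
    set U' : ℝ → ℝ := fun y => ∫ x, u t' x * η (x - y) with hU'
    have hsub : Ioc t' t ⊆ Ioc 0 T := fun s hs => ⟨ht'0.trans_lt hs.1, hs.2.trans htT⟩
    have hGi' : Integrable (Function.uncurry e) ((volume.restrict (Ioc t' t)).prod volume) :=
      hGi.mono_measure (Measure.prod_mono (Measure.restrict_mono hsub le_rfl) le_rfl)
    have hdiff : ∀ᵐ y, |U y - U' y| ≤ ∫ s, |e s y| ∂(volume.restrict (Ioc t' t)) := by
      filter_upwards [hWt, hWt', hGi.prod_left_ae] with y h1 h2 h3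
      have h3' : IntegrableOn (fun s => e s y) (Ioc 0 T) := h3
      simp only [hW] at h1 h2
      rw [hite _ _ (ht'0.trans htt)] at h1
      rw [hite _ _ ht'0] at h2
      have h4 : U y - U' y = ∫ s in t'..t, e s y := by
        have k1 : IntervalIntegrable (fun s => e s y) volume 0 t' :=
          (intervalIntegrable_iff_integrableOn_Ioc_of_le ht'0).2
            (h3'.mono_set (Ioc_subset_Ioc_right (htt.trans htT)))
        have k2 : IntervalIntegrable (fun s => e s y) volume t' t :=
          (intervalIntegrable_iff_integrableOn_Ioc_of_le htt).2 (h3'.mono_set hsub)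
        rw [← intervalIntegral.integral_add_adjacent_intervals k1 k2] at h1
        simp only [hU, hU']
        linarith
      rw [h4, intervalIntegral.integral_of_le htt]
      exact norm_integral_le_integral_norm fun s => e s y
    have hUU : ∫ y, |U y - U' y| ≤ 2 * C * M / ε * (t - t') := by
      have k1 := integral_mono_ae (c1.sub c1').abs hGi'.abs.integral_prod_right hdiff
      have k2 := integral_integral_swap (f := fun s y => |e s y|) hGi'.abs
      refine k1.trans (k2.symm.le.trans ?_)
      have k3 := integral_mono (μ := volume.restrict (Ioc t' t)) hGi'.abs.integral_prod_left
        (integrable_const (2 * C * M / ε)) heB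
      refine k3.trans (le_of_eq ?_)
      rw [integral_const, smul_eq_mul, measureReal_restrict_apply MeasurableSet.univ, univ_inter,
        Real.volume_real_Ioc_of_le htt, mul_comm]
    have hfin : ∫ x, |u t x - u t' x| ≤
        ∫ x, (|u t x - U x| + |U x - U' x| + |u t' x - U' x|) := by
      refine integral_mono ((hu.isProfile t).integrable_abs_sub (hu.isProfile t'))
        (((((hu.isProfile t).integrable.sub c1).abs).add (c1.sub c1').abs).add
          ((hu.isProfile t').integrable.sub c1').abs) fun x => ?_
      have e1 := abs_sub_le (u t x) (U x) (u t' x)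
      have e2 := abs_sub_le (U x) (U' x) (u t' x)
      rw [abs_sub_comm (U' x)] at e2
      linarith
    have s1 : Integrable fun x => |u t x - U x| + |U x - U' x| :=
      (((hu.isProfile t).integrable.sub c1).abs).add (c1.sub c1').abs
    have s2 : Integrable fun x => |u t' x - U' x| := ((hu.isProfile t').integrable.sub c1').abs
    have s3 : Integrable fun x => |u t x - U x| := ((hu.isProfile t).integrable.sub c1).abs
    have s4 : Integrable fun x => |U x - U' x| := (c1.sub c1').abs
    rw [integral_add s1 s2, integral_add s3 s4] at hfin
    linarith

/-- Stability with respect to the delay. -/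
theorem ae_integral_abs_sub_le (hu : IsKruzhkovSolution T R M 0 g α β r₀ u)
    (hw : IsKruzhkovSolution T R M τ g α β r₀ w) (h : IsFlux R M C g α β)
    (hη : IsMollifier m ε η) (hm : 0 ≤ m) (hT : 0 < T) (h0 : kuznetsov η r₀ r₀ ≤ c * ε)
    (hc : ∀ᵐ t ∂(volume.restrict (Icc 0 T)), kuznetsov η (u t) (u t) ≤ c * ε)
    (hδ : ∀ᵐ t ∂(volume.restrict (Icc 0 T)), ∫ x, |u t x - u (t - τ) x| ≤ δ) (hδ0 : 0 ≤ δ) :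
    ∀ᵐ t ∂(volume.restrict (Icc 0 T)), ∫ x, |u t x - w t x| ≤
      distBound ((5 * C ^ 2 + R * C) * (1 + m)) T c * (ε + δ) := by
  have key := hu.ae_kuznetsov_le hw h hη hm hT
  set K := (5 * C ^ 2 + R * C) * (1 + m) with hK
  have hC := h.C_nonneg
  have hM := h.M_nonneg
  have hK0 : 0 ≤ K := by have := h.R_nonneg; positivity
  have hε := hη.ε_pos
  have hr0 : 0 ≤ kuznetsov η r₀ r₀ := kuznetsov_nonneg hη
  have hcε : 0 ≤ c * ε := hr0.trans h0
  have hc0 : 0 ≤ c := by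
    by_contra hneg
    push Not at hneg
    nlinarith
  have hup := hu.isProfile
  have hwp := hw.isProfile
  set F : ℝ → ℝ := fun t => kuznetsov η (u t) (w t) with hF
  have hFm : Measurable F := (measurable_kuznetsov hη.measurable hu.measurable hw.measurable).comp
    (by fun_prop : Measurable fun t : ℝ => (t, t))
  have hF0 : ∀ t, 0 ≤ F t := fun t => kuznetsov_nonneg hη
  have hFB : ∀ t, F t ≤ 2 * M := fun t => kuznetsov_le hη (hup t) (hwp t)
  have hFp : ∀ t ≤ 0, F t = kuznetsov η r₀ r₀ := fun t ht => by
    simp only [hF, hu.past t ht, hw.past t ht]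
  have hint : ∀ a b, IntervalIntegrable F volume a b := fun a b =>
    (intervalIntegrable_const (c := 2 * M)).mono_fun' hFm.aestronglyMeasurable
      (Eventually.of_forall fun s => by
        simp only [Real.norm_eq_abs, abs_of_nonneg (hF0 s), hFB s])
  have hint' : ∀ a b, IntervalIntegrable (fun s => F (s - τ)) volume a b := fun a b =>
    (intervalIntegrable_const (c := 2 * M)).mono_fun'
      (hFm.comp (measurable_id.sub_const τ)).aestronglyMeasurable
      (Eventually.of_forall fun s => by
        simp only [Real.norm_eq_abs, abs_of_nonneg (hF0 _), hFB _])
  -- the self distance at delayed times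
  have hcd : ∀ᵐ t ∂(volume.restrict (Icc 0 T)), kuznetsov η (u (t - τ)) (u (t - τ)) ≤ c * ε := by
    have h1 : ∀ᵐ t, t ∈ Icc 0 T → kuznetsov η (u t) (u t) ≤ c * ε :=
      (ae_restrict_iff' measurableSet_Icc).1 hc
    have h2 : ∀ᵐ t : ℝ, t - τ ∈ Icc 0 T → kuznetsov η (u (t - τ)) (u (t - τ)) ≤ c * ε :=
      (measurePreserving_sub_right volume τ).quasiMeasurePreserving.ae h1
    rw [ae_restrict_iff' measurableSet_Icc]
    filter_upwards [h2] with t ht htI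
    rcases le_total (t - τ) 0 with hn | hn
    · rw [hu.past _ hn]; exact h0
    · exact ht ⟨hn, by linarith [htI.2, hw.τ_nonneg]⟩
  have hpt : ∀ᵐ s ∂(volume.restrict (Icc 0 T)), K * (kuznetsov η (u s) (w s)
        + kuznetsov η (u (s - 0)) (w (s - τ)) + ε
        + (1 + kuznetsov η (u s) (u s) / ε) * ∫ x, |u (s - 0) x - w (s - τ) x|) ≤
      K * (F s + (2 + c) * F (s - τ) + (2 + c) * (1 + c) * (ε + δ)) := by
    filter_upwards [hc, hδ, hcd] with s h1 h2 h3
    rw [sub_zero]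
    refine mul_le_mul_of_nonneg_left ?_ hK0
    -- The pair `u(s)`, `w(s - τ)` at different times is brought to the common time `s - τ` by
    -- moving `u`, at cost `δ`. In `e2` the `L¹` distance is then bounded by `F (s - τ)` plus the
    -- self functional of `u`.
    have e1 : kuznetsov η (u s) (w (s - τ)) ≤ F (s - τ) + δ := by
      have := kuznetsov_le_add hη (hwp (s - τ)) (hup (s - τ)) (hup s)
      simp_rw [abs_sub_comm (u (s - τ) _) (u s _)] at this
      rw [kuznetsov_comm hη (p := w _), kuznetsov_comm hη (p := w _)] at this
      linarith
    have e2 : ∫ x, |u s x - w (s - τ) x| ≤ δ + (c * ε + F (s - τ)) := by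
      have t1 := (hup s).integral_abs_sub_triangle (hup (s - τ)) (hwp (s - τ))
      have t2 := integral_abs_sub_le_kuznetsov hη (hup (s - τ)) (hwp (s - τ))
      linarith
    have e3 : kuznetsov η (u s) (u s) / ε ≤ c := by rwa [div_le_iff₀ hε]
    have e4 : (1 + kuznetsov η (u s) (u s) / ε) * (∫ x, |u s x - w (s - τ) x|) ≤
        (1 + c) * (δ + (c * ε + F (s - τ))) :=
      mul_le_mul (by linarith) e2 (integral_nonneg fun _ => abs_nonneg _) (by linarith)
    have e5 : 0 ≤ c * ε := hcε
    have e6 : 0 ≤ c * δ := mul_nonneg hc0 hδ0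
    have e7 : 0 ≤ c * c * δ := mul_nonneg (mul_nonneg hc0 hc0) hδ0
    have e8 : kuznetsov η (u s) (w s) = F s := rfl
    nlinarith
  set b := (2 + c) * (1 + c) * (ε + δ) with hb
  have hb0 : 0 ≤ b := by positivity
  have h2 : ∀ᵐ t ∂(volume.restrict (Icc 0 T)), F t ≤
      (c * ε + K * (2 + c) * T * (c * ε) + K * T * b) + (K * (3 + c)) * ∫ s in (0 : ℝ)..t, F s := by
    filter_upwards [key, ae_restrict_mem measurableSet_Icc] with t ht htI
    refine ht.trans ?_
    have mN := measurable_integral_abs_sub hu.measurable_shift hw.measurable_shift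
    have mJ := measurable_kuznetsov hη.measurable hu.measurable hu.measurable
    have mΦ' := measurable_kuznetsov hη.measurable hu.measurable_shift hw.measurable_shift
    have mdiag : Measurable fun t : ℝ => (t, t) := by fun_prop
    have hi1 : IntervalIntegrable (fun s => K * (kuznetsov η (u s) (w s)
        + kuznetsov η (u (s - 0)) (w (s - τ)) + ε
        + (1 + kuznetsov η (u s) (u s) / ε) * ∫ x, |u (s - 0) x - w (s - τ) x|)) volume 0 t := by
      refine (intervalIntegrable_const
        (c := K * (2 * M + 2 * M + ε + (1 + 2 * M / ε) * (2 * M)))).mono_fun'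
        (((((hFm).add (mΦ'.comp mdiag)).add_const ε).add
        ((((mJ.comp mdiag).div_const ε).const_add 1).mul (mN.comp mdiag))).const_mul
          K).aestronglyMeasurable (Eventually.of_forall fun s => ?_)
      have j0 : 0 ≤ kuznetsov η (u s) (u s) := kuznetsov_nonneg hη
      have j1 : 0 ≤ kuznetsov η (u s) (w s) := kuznetsov_nonneg hη
      have j2 : 0 ≤ kuznetsov η (u (s - 0)) (w (s - τ)) := kuznetsov_nonneg hη
      have n0 : 0 ≤ ∫ x, |u (s - 0) x - w (s - τ) x| := integral_nonneg fun _ => abs_nonneg _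
      beta_reduce
      rw [Real.norm_of_nonneg (by positivity)]
      refine mul_le_mul_of_nonneg_left ?_ hK0
      gcongr
      · exact kuznetsov_le hη (hup _) (hwp _)
      · exact kuznetsov_le hη (hup _) (hwp _)
      · exact kuznetsov_le hη (hup _) (hup _)
      · exact (hup _).integral_abs_sub_le (hwp _)
    have hi2 : IntervalIntegrable (fun s => K * (F s + (2 + c) * F (s - τ) + b)) volume 0 t :=
      (((hint _ _).add ((hint' _ _).const_mul _)).add intervalIntegrable_const).const_mul K
    have e1 := intervalIntegral.integral_mono_ae_restrict htI.1 hi1 hi2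
      (ae_restrict_of_ae_restrict_of_subset (Icc_subset_Icc_right htI.2) hpt)
    have e0 : ∫ s in (0 : ℝ)..t, K * (F s + (2 + c) * F (s - τ) + b) =
        K * ((∫ s in (0 : ℝ)..t, F s) + (2 + c) * (∫ s in (0 : ℝ)..t, F (s - τ)) + t * b) := by
      rw [intervalIntegral.integral_const_mul,
        intervalIntegral.integral_add ((hint _ _).add ((hint' _ _).const_mul _))
          intervalIntegrable_const,
        intervalIntegral.integral_add (hint _ _) ((hint' _ _).const_mul _),
        intervalIntegral.integral_const, intervalIntegral.integral_const_mul,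
        sub_zero, smul_eq_mul]
    rw [e0] at e1
    have e2 := integral_delay_le hw.τ_nonneg htI hFm hF0 hFB hFp
    have e3 : t * b ≤ T * b := mul_le_mul_of_nonneg_right htI.2 hb0
    have e4 : T * kuznetsov η r₀ r₀ ≤ T * (c * ε) := mul_le_mul_of_nonneg_left h0 hT.le
    have e5 := mul_le_mul_of_nonneg_left (e2.trans (add_le_add_left e4 _))
      (by linarith : 0 ≤ 2 + c)
    have e6 := mul_le_mul_of_nonneg_left (add_le_add e5 e3) hK0
    linarith
  have h3 := ae_le_of_ae_le_add_integral (by positivity) (by positivity) (hint 0 T) hT h2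
  filter_upwards [h3, hc] with t ht hct
  have t2 := integral_abs_sub_le_kuznetsov hη (hup t) (hwp t)
  have hE := Real.exp_pos (K * (3 + c) * T)
  set E := Real.exp (K * (3 + c) * T)
  have a1 : (c * ε + K * (2 + c) * T * (c * ε) + K * T * b) ≤
      (c + K * (2 + c) * T * c + K * T * (2 + c) * (1 + c)) * (ε + δ) := by
    have : 0 ≤ (c + K * (2 + c) * T * c) * δ := by positivity
    rw [hb]
    linarith
  have a2 := mul_le_mul_of_nonneg_right a1 hE.le
  have a3 : 0 ≤ c * δ := mul_nonneg hc0 hδ0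
  unfold distBound
  have a4 : F t = kuznetsov η (u t) (w t) := rfl
  linarith

end IsKruzhkovSolution


/-! ### Regularity of the downstream average -/

/-- The spatial derivative of `downstream L ω p`. -/
noncomputable def downstreamDeriv (L : ℝ) (ω p : ℝ → ℝ) (x : ℝ) : ℝ :=
  ω L * p (x + L) - ω 0 * p x - ∫ s in (0 : ℝ)..L, p (x + s) * derivWithin ω (Icc 0 L) s

/-- `v`, `ω` and their one-sided derivatives are controlled only on their intervals. A globally
continuous substitute with the same values there gives measurability of compositions and products.
-/
theorem continuous_comp_Icc {R : ℝ} (hR : 0 ≤ R) {k : ℝ → ℝ} (hk : ContinuousOn k (Icc 0 R)) :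
    ∃ k' : ℝ → ℝ, Continuous k' ∧ ∀ r ∈ Icc 0 R, k' r = k r :=
  ⟨IccExtend hR ((Icc 0 R).domRestrict k), (continuousOn_iff_continuous_domRestrict.1 hk).Icc_extend',
    fun r hr => by rw [IccExtend_of_mem hR _ hr, domRestrict_apply]⟩

theorem measurable_downstream {L : ℝ} {k : ℝ → ℝ} {u : ℝ → ℝ → ℝ} (hL : 0 < L)
    (hk : ContinuousOn k (Icc 0 L)) (hu : Measurable (Function.uncurry u)) :
    Measurable fun z : ℝ × ℝ => downstream L k (u z.1) z.2 := by
  obtain ⟨k', hk'c, hk'⟩ := continuous_comp_Icc hL.le hk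
  have : (fun z : ℝ × ℝ => downstream L k (u z.1) z.2) = fun z : ℝ × ℝ =>
      ∫ s in Ioc 0 L, u z.1 (z.2 + s) * k' s := by
    ext z
    rw [downstream, intervalIntegral.integral_of_le hL.le]
    refine setIntegral_congr_fun measurableSet_Ioc fun s hs => ?_
    simp only [hk' s (Ioc_subset_Icc_self hs)]
  rw [this]
  have hm : Measurable fun z : (ℝ × ℝ) × ℝ => u z.1.1 (z.1.2 + z.2) * k' z.2 :=
    (hu.comp (by fun_prop : Measurable fun z : (ℝ × ℝ) × ℝ => (z.1.1, z.1.2 + z.2))).mul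
      (hk'c.measurable.comp measurable_snd)
  exact hm.stronglyMeasurable.integral_prod_right'.measurable

section Kernel

variable {R M L D : ℝ} {k ω p q : ℝ → ℝ}

theorem IsProfile.intervalIntegrable_mul (hp : IsProfile R M p) (hL : 0 < L)
    (hk : ContinuousOn k (Icc 0 L)) (x : ℝ) :
    IntervalIntegrable (fun s => p (x + s) * k s) volume 0 L := by
  have h1 : IntervalIntegrable (fun s => p (x + s)) volume 0 L :=
    (hp.integrable.comp_add_left x).intervalIntegrable
  exact h1.mul_continuousOn (by rwa [uIcc_of_le hL.le])

/-- Convolution with a bounded kernel on `[0, L]`: bound in `L¹`. -/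
theorem IsProfile.integral_abs_downstream_le (hp : IsProfile R M p) (hL : 0 < L)
    (hk : ContinuousOn k (Icc 0 L)) (hD : ∀ s ∈ Icc 0 L, |k s| ≤ D) :
    Integrable (downstream L k p) ∧ ∫ x, |downstream L k p x| ≤ L * D * ∫ x, p x := by
  obtain ⟨k', hk'c, hk'⟩ := continuous_comp_Icc hL.le hk
  have hD0 : 0 ≤ D := (abs_nonneg _).trans (hD 0 (left_mem_Icc.2 hL.le))
  have hds : ∀ x, downstream L k p x = ∫ s in Ioc 0 L, p (x + s) * k' s := fun x => by
    rw [downstream, intervalIntegral.integral_of_le hL.le]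
    refine setIntegral_congr_fun measurableSet_Ioc fun s hs => ?_
    simp only [hk' s (Ioc_subset_Icc_self hs)]
  have hm : Measurable fun z : ℝ × ℝ => p (z.2 + z.1) * k' z.1 :=
    (hp.measurable.comp (by fun_prop)).mul (hk'c.measurable.comp _root_.measurable_fst)
  have hs : ∀ s ∈ Ioc 0 L, ∀ x, ‖p (x + s) * k' s‖ ≤ D * p (x + s) := fun s hs x => by
    rw [norm_mul, Real.norm_of_nonneg (hp.nonneg _), Real.norm_eq_abs,
      hk' s (Ioc_subset_Icc_self hs), mul_comm]
    exact mul_le_mul_of_nonneg_right (hD s (Ioc_subset_Icc_self hs)) (hp.nonneg _)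
  have hbd : ∀ s ∈ Ioc 0 L, ∫ x, ‖p (x + s) * k' s‖ ≤ D * ∫ x, p x := fun s hsI => by
    have h1 : Integrable fun x => p (x + s) := hp.integrable.comp_add_right s
    have h2 := integral_mono_of_nonneg (Eventually.of_forall fun x => norm_nonneg _)
      (h1.const_mul D) (Eventually.of_forall (hs s hsI))
    rwa [integral_const_mul, integral_add_right_eq_self p s] at h2
  have hnm : AEStronglyMeasurable (fun s => ∫ x, ‖p (x + s) * k' s‖) (volume.restrict (Ioc 0 L)) :=
    (hm.norm.stronglyMeasurable.integral_prod_right' (f := fun z : ℝ × ℝ =>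
      ‖p (z.2 + z.1) * k' z.1‖)).aestronglyMeasurable
  have hni : Integrable (fun s => ∫ x, ‖p (x + s) * k' s‖) (volume.restrict (Ioc 0 L)) := by
    refine (integrable_const (D * ∫ x, p x)).mono' hnm ?_
    filter_upwards [ae_restrict_mem measurableSet_Ioc] with s hsI
    rw [Real.norm_of_nonneg (MeasureTheory.integral_nonneg fun x => norm_nonneg _)]
    exact hbd s hsI
  have hi : Integrable (fun z : ℝ × ℝ => p (z.2 + z.1) * k' z.1)
      ((volume.restrict (Ioc 0 L)).prod volume) := by
    rw [integrable_prod_iff hm.aestronglyMeasurable]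
    exact ⟨Eventually.of_forall fun s => (hp.integrable.comp_add_right s).mul_const (k' s), hni⟩
  have hds' : downstream L k p = fun x => ∫ s in Ioc 0 L, p (x + s) * k' s := funext hds
  rw [hds']
  refine ⟨hi.integral_prod_right, ?_⟩
  calc ∫ x, |∫ s in Ioc 0 L, p (x + s) * k' s|
      ≤ ∫ x, ∫ s in Ioc 0 L, ‖p (x + s) * k' s‖ :=
        integral_mono hi.integral_prod_right.abs hi.norm.integral_prod_right
          fun x => norm_integral_le_integral_norm fun s => p (x + s) * k' s
    _ = ∫ s in Ioc 0 L, ∫ x, ‖p (x + s) * k' s‖ :=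
        (integral_integral_swap (f := fun s x => ‖p (x + s) * k' s‖) hi.norm).symm
    _ ≤ ∫ _ in Ioc 0 L, D * ∫ x, p x := by
        refine setIntegral_mono_on hni (integrable_const _) measurableSet_Ioc hbd
    _ = L * D * ∫ x, p x := by
        rw [setIntegral_const, Real.volume_real_Ioc_of_le hL.le, smul_eq_mul]; ring

/-- The weight depends only on `x - y`, which a simultaneous shift preserves. -/
theorem kuznetsov_translate (η p q : ℝ → ℝ) (s : ℝ) :
    kuznetsov η (fun x => p (x + s)) (fun x => q (x + s)) = kuznetsov η p q := by
  unfold kuznetsov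
  rw [Measure.volume_eq_prod]
  have h := integral_add_right_eq_self (μ := (volume : Measure ℝ).prod volume)
    (fun z : ℝ × ℝ => |p z.1 - q z.2| * η (z.1 - z.2)) ((s, s) : ℝ × ℝ)
  simpa using h

theorem IsProfile.translate (hp : IsProfile R M p) (s : ℝ) : IsProfile R M fun x => p (x + s) :=
  ⟨hp.measurable.comp (measurable_id.add_const s), fun x => hp.mem_Icc _,
    hp.integrable.comp_add_right s, by rw [integral_add_right_eq_self p s]; exact hp.integral_le⟩

/-- The average superposes the simultaneous translates of `p` and `q` by `s ∈ [0, L]`. All of these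
have the same Kuznetsov functional, so averaging costs only the bound `L D` for the mass of the
kernel. -/
theorem IsProfile.integral_abs_downstream_sub_le (hp : IsProfile R M p) (hq : IsProfile R M q)
    (hL : 0 < L) (hk : ContinuousOn k (Icc 0 L)) (hD : ∀ s ∈ Icc 0 L, |k s| ≤ D) {η : ℝ → ℝ}
    (hη : Measurable η) (hη0 : ∀ z, 0 ≤ η z) (hηi : Integrable η) :
    Integrable (fun z : ℝ × ℝ => |downstream L k p z.1 - downstream L k q z.2| * η (z.1 - z.2)) ∧
    ∫ z : ℝ × ℝ, |downstream L k p z.1 - downstream L k q z.2| * η (z.1 - z.2) ≤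
      L * D * kuznetsov η p q := by
  obtain ⟨k', hk'c, hk'⟩ := continuous_comp_Icc hL.le hk
  have hD0 : 0 ≤ D := (abs_nonneg _).trans (hD 0 (left_mem_Icc.2 hL.le))
  set G : ℝ × (ℝ × ℝ) → ℝ := fun z => |p (z.2.1 + z.1) - q (z.2.2 + z.1)| * η (z.2.1 - z.2.2)
    with hG
  have hGm : Measurable G :=
    ((hp.measurable.comp (by fun_prop)).sub (hq.measurable.comp (by fun_prop))).abs.mul
      (hη.comp (by fun_prop))
  have hG0 : ∀ z, 0 ≤ G z := fun z => mul_nonneg (abs_nonneg _) (hη0 _)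
  have hGs : ∀ s, Integrable fun z => G (s, z) := fun s =>
    (hp.translate s).integrable_abs_sub_mul (hq.translate s) hηi hη
  have hGint : ∀ s, ∫ z, G (s, z) = kuznetsov η p q := fun s => kuznetsov_translate η p q s
  have hi : Integrable G ((volume.restrict (Ioc 0 L)).prod volume) := by
    rw [integrable_prod_iff hGm.aestronglyMeasurable]
    refine ⟨Eventually.of_forall hGs, ?_⟩
    simp_rw [Real.norm_of_nonneg (hG0 _), hGint]
    exact integrable_const _
  have hpt : ∀ z : ℝ × ℝ, |downstream L k p z.1 - downstream L k q z.2| * η (z.1 - z.2) ≤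
      ∫ s in Ioc 0 L, D * G (s, z) := fun z => by
    have e1 : downstream L k p z.1 - downstream L k q z.2 =
        ∫ s in Ioc 0 L, (p (z.1 + s) - q (z.2 + s)) * k s := by
      unfold downstream
      rw [← intervalIntegral.integral_sub (hp.intervalIntegrable_mul hL hk _)
        (hq.intervalIntegrable_mul hL hk _), intervalIntegral.integral_of_le hL.le]
      simp_rw [sub_mul]
    have e3 : Integrable (fun s => |p (z.1 + s) - q (z.2 + s)|) :=
      ((hp.integrable.comp_add_left z.1).sub (hq.integrable.comp_add_left z.2)).abs
    have e2 : |downstream L k p z.1 - downstream L k q z.2| ≤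
        ∫ s in Ioc 0 L, D * |p (z.1 + s) - q (z.2 + s)| := by
      rw [e1, ← Real.norm_eq_abs]
      refine norm_integral_le_of_norm_le (e3.restrict.const_mul D) ?_
      filter_upwards [ae_restrict_mem measurableSet_Ioc] with s hs
      rw [norm_mul, mul_comm, Real.norm_eq_abs, Real.norm_eq_abs]
      exact mul_le_mul_of_nonneg_right (hD s (Ioc_subset_Icc_self hs)) (abs_nonneg _)
    refine (mul_le_mul_of_nonneg_right e2 (hη0 _)).trans (le_of_eq ?_)
    rw [← integral_mul_const]
    simp only [hG, mul_assoc]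
  have hmeas : AEStronglyMeasurable
      (fun z : ℝ × ℝ => |downstream L k p z.1 - downstream L k q z.2| * η (z.1 - z.2)) := by
    have m1 : Measurable (downstream L k p) :=
      (measurable_downstream hL hk (u := fun _ => p) (hp.measurable.comp _root_.measurable_snd)).comp
        (measurable_const.prodMk measurable_id : Measurable fun x : ℝ => ((0 : ℝ), x))
    have m2 : Measurable (downstream L k q) :=
      (measurable_downstream hL hk (u := fun _ => q) (hq.measurable.comp _root_.measurable_snd)).comp
        (measurable_const.prodMk measurable_id : Measurable fun x : ℝ => ((0 : ℝ), x))
    exact (((m1.comp _root_.measurable_fst).sub (m2.comp _root_.measurable_snd)).abs.mul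
      (hη.comp (_root_.measurable_fst.sub _root_.measurable_snd))).aestronglyMeasurable
  have hbi : Integrable fun z : ℝ × ℝ => ∫ s in Ioc 0 L, D * G (s, z) :=
    (hi.const_mul D).integral_prod_right
  have hint : Integrable
      (fun z : ℝ × ℝ => |downstream L k p z.1 - downstream L k q z.2| * η (z.1 - z.2)) := by
    refine hbi.mono' hmeas (Eventually.of_forall fun z => ?_)
    rw [Real.norm_of_nonneg (mul_nonneg (abs_nonneg _) (hη0 _))]
    exact hpt z
  refine ⟨hint, (integral_mono hint hbi hpt).trans ?_⟩
  rw [← integral_integral_swap (f := fun s z => D * G (s, z)) (hi.const_mul D)]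
  simp_rw [integral_const_mul, hGint]
  rw [setIntegral_const, Real.volume_real_Ioc_of_le hL.le, smul_eq_mul]
  linarith

end Kernel


section DownstreamRegularity

variable {R M L Cω : ℝ} {ω p q : ℝ → ℝ}

theorem IsProfile.abs_primitive_sub_le (hp : IsProfile R M p) (x y : ℝ) :
    |(∫ t in (0 : ℝ)..x, p t) - ∫ t in (0 : ℝ)..y, p t| ≤ R * |x - y| := by
  rw [intervalIntegral.integral_interval_sub_left hp.integrable.intervalIntegrable
    hp.integrable.intervalIntegrable, ← Real.norm_eq_abs]
  refine intervalIntegral.norm_integral_le_of_norm_le_const fun t _ => ?_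
  rw [Real.norm_of_nonneg (hp.nonneg t)]
  exact hp.le t

theorem IsProfile.lipschitzWith_primitive (hp : IsProfile R M p) (x : ℝ) :
    LipschitzWith R.toNNReal fun s => ∫ t in (0 : ℝ)..x + s, p t := by
  refine LipschitzWith.of_dist_le_mul fun s s' => ?_
  rw [Real.dist_eq, Real.dist_eq, Real.coe_toNNReal _ ((hp.nonneg 0).trans (hp.le 0))]
  simpa using hp.abs_primitive_sub_le (x + s) (x + s')

theorem IsProfile.ae_hasDerivAt_primitive (hp : IsProfile R M p) :
    ∀ᵐ x, HasDerivAt (fun x => ∫ t in (0 : ℝ)..x, p t) (p x) x := by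
  filter_upwards [_root_.LocallyIntegrable.ae_hasDerivAt_integral hp.integrable.locallyIntegrable] with x hx using hx 0

theorem IsProfile.ae_hasDerivAt_primitive_add (hp : IsProfile R M p) (x : ℝ) :
    ∀ᵐ s, HasDerivAt (fun y => ∫ t in (0 : ℝ)..y, p t) (p (x + s)) (x + s) :=
  (measurePreserving_add_left volume x).quasiMeasurePreserving.ae hp.ae_hasDerivAt_primitive

theorem continuousOn_derivWithin_Icc (hL : 0 < L) (hω : ContDiffOn ℝ 1 ω (Icc 0 L)) :
    ContinuousOn (derivWithin ω (Icc 0 L)) (Icc 0 L) :=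
  hω.continuousOn_derivWithin (uniqueDiffOn_Icc hL) le_rfl

/-- Integration by parts. As `p` may be discontinuous, the definition does not show any regularity
in `x`; here `x` enters only through a primitive of `p`, which is `R`-Lipschitz. Both the Lipschitz
bound and the derivative are read off from this formula. -/
theorem IsProfile.downstream_eq (hp : IsProfile R M p) (hL : 0 < L)
    (hω : ContDiffOn ℝ 1 ω (Icc 0 L)) (x : ℝ) :
    downstream L ω p x = ω L * (∫ t in (0 : ℝ)..x + L, p t) - ω 0 * (∫ t in (0 : ℝ)..x, p t) -
      ∫ s in (0 : ℝ)..L, (∫ t in (0 : ℝ)..x + s, p t) * derivWithin ω (Icc 0 L) s := by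
  have hac := ((hp.lipschitzWith_primitive x).lipschitzOnWith (s := uIcc 0 L))
    |>.absolutelyContinuousOnInterval
  have hωac : AbsolutelyContinuousOnInterval ω 0 L :=
    ContDiffOn.absolutelyContinuousOnInterval (by rwa [uIcc_of_le hL.le])
  have h := hac.integral_deriv_mul_eq_sub hωac
  have hP : Continuous fun s => ∫ t in (0 : ℝ)..x + s, p t :=
    (hp.lipschitzWith_primitive x).continuous
  have h2 : ∫ s in (0 : ℝ)..L, (p (x + s) * ω s +
      (∫ t in (0 : ℝ)..x + s, p t) * derivWithin ω (Icc 0 L) s) =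
      ∫ s in (0 : ℝ)..L, (deriv (fun s => ∫ t in (0 : ℝ)..x + s, p t) s * ω s +
        (∫ t in (0 : ℝ)..x + s, p t) * deriv ω s) := by
    refine intervalIntegral.integral_congr_ae ?_
    -- At the end point `L` the one-sided derivative of `ω` need not be its derivative; this single
    -- point is discarded.
    filter_upwards [hp.ae_hasDerivAt_primitive_add x, Measure.ae_ne volume L] with s hs hsL hsI
    rw [uIoc_of_le hL.le] at hsI
    rw [(hs.comp_const_add x s).deriv, derivWithin_of_mem_nhds
      (Icc_mem_nhds hsI.1 (lt_of_le_of_ne hsI.2 hsL))]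
  have h3 : IntervalIntegrable (fun s => (∫ t in (0 : ℝ)..x + s, p t) *
      derivWithin ω (Icc 0 L) s) volume 0 L :=
    ContinuousOn.intervalIntegrable (by
      rw [uIcc_of_le hL.le]
      exact hP.continuousOn.mul (continuousOn_derivWithin_Icc hL hω))
  rw [← h2, intervalIntegral.integral_add (hp.intervalIntegrable_mul hL hω.continuousOn x) h3,
    add_zero] at h
  rw [downstream]
  linarith

theorem IsProfile.abs_integral_primitive_sub_le (hp : IsProfile R M p) (hL : 0 < L)
    (hω : ContDiffOn ℝ 1 ω (Icc 0 L))
    (hC : ∀ s ∈ Icc 0 L, |derivWithin ω (Icc 0 L) s| ≤ Cω) (x y : ℝ) :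
    |(∫ s in (0 : ℝ)..L, (∫ t in (0 : ℝ)..x + s, p t) * derivWithin ω (Icc 0 L) s) -
      ∫ s in (0 : ℝ)..L, (∫ t in (0 : ℝ)..y + s, p t) * derivWithin ω (Icc 0 L) s| ≤
      R * |x - y| * Cω * L := by
  have hi : ∀ x, IntervalIntegrable (fun s => (∫ t in (0 : ℝ)..x + s, p t) *
      derivWithin ω (Icc 0 L) s) volume 0 L := fun x =>
    ContinuousOn.intervalIntegrable (by
      rw [uIcc_of_le hL.le]
      exact (hp.lipschitzWith_primitive x).continuous.continuousOn.mul
        (continuousOn_derivWithin_Icc hL hω))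
  rw [← intervalIntegral.integral_sub (hi x) (hi y), ← Real.norm_eq_abs]
  have h := intervalIntegral.norm_integral_le_of_norm_le_const (a := 0) (b := L)
    (C := R * |x - y| * Cω) (f := fun s => (∫ t in (0 : ℝ)..x + s, p t) *
      derivWithin ω (Icc 0 L) s - (∫ t in (0 : ℝ)..y + s, p t) * derivWithin ω (Icc 0 L) s)
    fun s hs => by
      rw [uIoc_of_le hL.le] at hs
      rw [← sub_mul, norm_mul, Real.norm_eq_abs, Real.norm_eq_abs]
      have h1 := hp.abs_primitive_sub_le (x + s) (y + s)
      rw [add_sub_add_right_eq_sub] at h1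
      exact mul_le_mul h1 (hC s (Ioc_subset_Icc_self hs)) (abs_nonneg _)
        ((abs_nonneg _).trans h1)
  rwa [sub_zero, abs_of_pos hL] at h

theorem IsProfile.abs_downstream_sub_le (hp : IsProfile R M p) (hL : 0 < L)
    (hω : ContDiffOn ℝ 1 ω (Icc 0 L))
    (hC : ∀ s ∈ Icc 0 L, |derivWithin ω (Icc 0 L) s| ≤ Cω) (x y : ℝ) :
    |downstream L ω p x - downstream L ω p y| ≤
      R * (|ω L| + |ω 0| + L * Cω) * |x - y| := by
  rw [hp.downstream_eq hL hω, hp.downstream_eq hL hω]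
  have h1 := hp.abs_primitive_sub_le (x + L) (y + L)
  have h2 := hp.abs_primitive_sub_le x y
  have h3 := hp.abs_integral_primitive_sub_le hL hω hC x y
  rw [add_sub_add_right_eq_sub] at h1
  set P1 := ∫ t in (0 : ℝ)..x + L, p t
  set P2 := ∫ t in (0 : ℝ)..x, p t
  set P3 := ∫ s in (0 : ℝ)..L, (∫ t in (0 : ℝ)..x + s, p t) * derivWithin ω (Icc 0 L) s
  set Q1 := ∫ t in (0 : ℝ)..y + L, p t
  set Q2 := ∫ t in (0 : ℝ)..y, p t
  set Q3 := ∫ s in (0 : ℝ)..L, (∫ t in (0 : ℝ)..y + s, p t) * derivWithin ω (Icc 0 L) s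
  have e : ω L * P1 - ω 0 * P2 - P3 - (ω L * Q1 - ω 0 * Q2 - Q3) =
      ω L * (P1 - Q1) - ω 0 * (P2 - Q2) - (P3 - Q3) := by ring
  rw [e]
  have h4 : |ω L * (P1 - Q1)| ≤ |ω L| * (R * |x - y|) := by
    rw [abs_mul]; exact mul_le_mul_of_nonneg_left h1 (abs_nonneg _)
  have h5 : |ω 0 * (P2 - Q2)| ≤ |ω 0| * (R * |x - y|) := by
    rw [abs_mul]; exact mul_le_mul_of_nonneg_left h2 (abs_nonneg _)
  have h6 := abs_sub (ω L * (P1 - Q1) - ω 0 * (P2 - Q2)) (P3 - Q3)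
  have h7 := abs_sub (ω L * (P1 - Q1)) (ω 0 * (P2 - Q2))
  linarith

/-- It suffices that the primitive of `p` be differentiable at `x` and at `x + L`, which Lebesgue's
theorem grants almost everywhere. The remaining integral can be differentiated at every point, the
Lipschitz bound of the primitive serving as majorant. -/
theorem IsProfile.hasDerivAt_downstream (hp : IsProfile R M p) (hL : 0 < L)
    (hω : ContDiffOn ℝ 1 ω (Icc 0 L)) :
    ∀ᵐ x, HasDerivAt (downstream L ω p) (downstreamDeriv L ω p x) x := by
  have hs : ∀ᵐ x : ℝ, HasDerivAt (fun y => ∫ t in (0 : ℝ)..y, p t) (p (x + L)) (x + L) :=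
    (measurePreserving_add_right volume L).quasiMeasurePreserving.ae hp.ae_hasDerivAt_primitive
  obtain ⟨k, hkc, hk⟩ := continuous_comp_Icc hL.le (continuousOn_derivWithin_Icc hL hω)
  have hR : 0 ≤ R := (hp.nonneg 0).trans (hp.le 0)
  filter_upwards [hp.ae_hasDerivAt_primitive, hs] with x h1 h2
  have h3 : HasDerivAt (fun x => ∫ s in (0 : ℝ)..L, (∫ t in (0 : ℝ)..x + s, p t) *
      derivWithin ω (Icc 0 L) s) (∫ s in (0 : ℝ)..L, p (x + s) * derivWithin ω (Icc 0 L) s) x := by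
    have hcg : ∀ F : ℝ → ℝ, ∫ s in (0 : ℝ)..L, F s * derivWithin ω (Icc 0 L) s =
        ∫ s in (0 : ℝ)..L, F s * k s := fun F => by
      refine intervalIntegral.integral_congr fun s hs => ?_
      rw [uIcc_of_le hL.le] at hs
      simp only [hk s hs]
    simp_rw [hcg]
    refine (intervalIntegral.hasDerivAt_integral_of_dominated_loc_of_lip (s := univ)
      (bound := fun s => R * |k s|) univ_mem (Eventually.of_forall fun y => ?_) ?_ ?_ ?_ ?_ ?_).2
    · exact ((hp.lipschitzWith_primitive y).continuous.mul hkc).aestronglyMeasurable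
    · exact ((hp.lipschitzWith_primitive x).continuous.mul hkc).intervalIntegrable _ _
    · exact ((hp.measurable.comp (measurable_const_add x)).mul hkc.measurable).aestronglyMeasurable
    · refine Eventually.of_forall fun s _ => (LipschitzWith.of_dist_le_mul fun y y' => ?_).lipschitzOnWith
      rw [Real.dist_eq, Real.dist_eq, ← sub_mul, abs_mul, Real.coe_nnabs,
        abs_of_nonneg (mul_nonneg hR (abs_nonneg _))]
      have h := hp.abs_primitive_sub_le (y + s) (y' + s)
      rw [add_sub_add_right_eq_sub] at h
      linarith [mul_le_mul_of_nonneg_right h (abs_nonneg (k s))]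
    · exact (continuous_const.mul hkc.abs).intervalIntegrable _ _
    · filter_upwards [hp.ae_hasDerivAt_primitive_add x] with s h _
      exact (h.comp_add_const x s).mul_const _
  have h4 := (((h2.comp_add_const x L).const_mul (ω L)).sub (h1.const_mul (ω 0))).sub h3
  refine h4.congr_of_eventuallyEq (Eventually.of_forall fun y => ?_)
  simp [hp.downstream_eq hL hω y]

theorem IsProfile.abs_downstreamDeriv_le (hp : IsProfile R M p) (hL : 0 < L)
    (hC : ∀ s ∈ Icc 0 L, |derivWithin ω (Icc 0 L) s| ≤ Cω) (x : ℝ) :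
    |downstreamDeriv L ω p x| ≤ R * (|ω L| + |ω 0| + L * Cω) := by
  have hpa : ∀ y, |p y| ≤ R := fun y => by rw [abs_of_nonneg (hp.nonneg y)]; exact hp.le y
  have hR : 0 ≤ R := (hp.nonneg 0).trans (hp.le 0)
  have h := intervalIntegral.norm_integral_le_of_norm_le_const (a := 0) (b := L)
    (C := R * Cω) (f := fun s => p (x + s) * derivWithin ω (Icc 0 L) s) fun s hs => by
      rw [uIoc_of_le hL.le] at hs
      rw [norm_mul, Real.norm_eq_abs, Real.norm_eq_abs]
      exact mul_le_mul (hpa _) (hC s (Ioc_subset_Icc_self hs)) (abs_nonneg _) hR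
  rw [sub_zero, abs_of_pos hL, Real.norm_eq_abs] at h
  have h4 : |ω L * p (x + L)| ≤ |ω L| * R := by
    rw [abs_mul]; exact mul_le_mul_of_nonneg_left (hpa _) (abs_nonneg _)
  have h5 : |ω 0 * p x| ≤ |ω 0| * R := by
    rw [abs_mul]; exact mul_le_mul_of_nonneg_left (hpa _) (abs_nonneg _)
  have h6 := abs_sub (ω L * p (x + L) - ω 0 * p x)
    (∫ s in (0 : ℝ)..L, p (x + s) * derivWithin ω (Icc 0 L) s)
  have h7 := abs_sub (ω L * p (x + L)) (ω 0 * p x)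
  rw [downstreamDeriv]
  linarith

/-- The difference of two values of the derivative of `v` is bounded but need not be integrable in
`x`. In the speed derivative it is multiplied by this function, whose `L¹` bound makes the product
integrable. -/
theorem IsProfile.integral_abs_downstreamDeriv_le (hp : IsProfile R M p) (hL : 0 < L)
    (hω : ContDiffOn ℝ 1 ω (Icc 0 L))
    (hC : ∀ s ∈ Icc 0 L, |derivWithin ω (Icc 0 L) s| ≤ Cω) :
    Integrable (downstreamDeriv L ω p) ∧
      ∫ x, |downstreamDeriv L ω p x| ≤ (|ω L| + |ω 0| + L * Cω) * M := by
  obtain ⟨i3, h3⟩ := hp.integral_abs_downstream_le hL (continuousOn_derivWithin_Icc hL hω) hC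
  have hC0 : 0 ≤ Cω := (abs_nonneg _).trans (hC 0 (left_mem_Icc.2 hL.le))
  have i1 : Integrable fun x => p (x + L) := hp.integrable.comp_add_right L
  have i : Integrable (downstreamDeriv L ω p) :=
    ((i1.const_mul (ω L)).sub (hp.integrable.const_mul (ω 0))).sub i3
  refine ⟨i, ?_⟩
  have j : Integrable fun x => |ω L| * p (x + L) + |ω 0| * p x :=
    (i1.const_mul _).add (hp.integrable.const_mul _)
  have h : ∫ x, |downstreamDeriv L ω p x| ≤ ∫ x, ((|ω L| * p (x + L) + |ω 0| * p x) +
      |downstream L (derivWithin ω (Icc 0 L)) p x|) := by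
    refine integral_mono i.abs (j.add i3.abs) fun x => ?_
    have h6 := abs_sub (ω L * p (x + L) - ω 0 * p x)
      (∫ s in (0 : ℝ)..L, p (x + s) * derivWithin ω (Icc 0 L) s)
    have h7 := abs_sub (ω L * p (x + L)) (ω 0 * p x)
    rw [abs_mul, abs_mul, abs_of_nonneg (hp.nonneg _), abs_of_nonneg (hp.nonneg _)] at h7
    simp only [downstreamDeriv, downstream]
    linarith
  rw [integral_add j i3.abs, integral_add (i1.const_mul _) (hp.integrable.const_mul _),
    integral_const_mul, integral_const_mul, integral_add_right_eq_self p L] at h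
  have hS : 0 ≤ |ω L| + |ω 0| + L * Cω := by positivity
  have := mul_le_mul_of_nonneg_left hp.integral_le hS
  linarith

theorem IsProfile.integral_abs_downstreamDeriv_sub_le (hp : IsProfile R M p)
    (hq : IsProfile R M q) (hL : 0 < L) (hω : ContDiffOn ℝ 1 ω (Icc 0 L))
    (hC : ∀ s ∈ Icc 0 L, |derivWithin ω (Icc 0 L) s| ≤ Cω) {η : ℝ → ℝ} (hη : Measurable η)
    (hη0 : ∀ z, 0 ≤ η z) (hηi : Integrable η) :
    Integrable (fun z : ℝ × ℝ =>
      |downstreamDeriv L ω p z.1 - downstreamDeriv L ω q z.2| * η (z.1 - z.2)) ∧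
    ∫ z : ℝ × ℝ, |downstreamDeriv L ω p z.1 - downstreamDeriv L ω q z.2| * η (z.1 - z.2) ≤
      (|ω L| + |ω 0| + L * Cω) * kuznetsov η p q := by
  obtain ⟨i3, h3⟩ := hp.integral_abs_downstream_sub_le hq hL
    (continuousOn_derivWithin_Icc hL hω) hC hη hη0 hηi
  have i1 : Integrable fun z : ℝ × ℝ => |p (z.1 + L) - q (z.2 + L)| * η (z.1 - z.2) :=
    (hp.translate L).integrable_abs_sub_mul (hq.translate L) hηi hη
  have e1 : ∫ z : ℝ × ℝ, |p (z.1 + L) - q (z.2 + L)| * η (z.1 - z.2) = kuznetsov η p q :=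
    kuznetsov_translate η p q L
  have i2 : Integrable fun z : ℝ × ℝ => |p z.1 - q z.2| * η (z.1 - z.2) :=
    hp.integrable_abs_sub_mul hq hηi hη
  have j : Integrable fun z : ℝ × ℝ => |ω L| * (|p (z.1 + L) - q (z.2 + L)| * η (z.1 - z.2)) +
      |ω 0| * (|p z.1 - q z.2| * η (z.1 - z.2)) := (i1.const_mul _).add (i2.const_mul _)
  have hpt : ∀ z : ℝ × ℝ,
      |downstreamDeriv L ω p z.1 - downstreamDeriv L ω q z.2| * η (z.1 - z.2) ≤
      (|ω L| * (|p (z.1 + L) - q (z.2 + L)| * η (z.1 - z.2)) +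
      |ω 0| * (|p z.1 - q z.2| * η (z.1 - z.2))) +
      |downstream L (derivWithin ω (Icc 0 L)) p z.1 - downstream L (derivWithin ω (Icc 0 L)) q z.2|
        * η (z.1 - z.2) := fun z => by
    have e : downstreamDeriv L ω p z.1 - downstreamDeriv L ω q z.2 =
        ω L * (p (z.1 + L) - q (z.2 + L)) - ω 0 * (p z.1 - q z.2) -
        (downstream L (derivWithin ω (Icc 0 L)) p z.1 -
          downstream L (derivWithin ω (Icc 0 L)) q z.2) := by
      simp only [downstreamDeriv, downstream]; ring
    have h6 := abs_sub (ω L * (p (z.1 + L) - q (z.2 + L)) - ω 0 * (p z.1 - q z.2))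
      (downstream L (derivWithin ω (Icc 0 L)) p z.1 - downstream L (derivWithin ω (Icc 0 L)) q z.2)
    have h7 := abs_sub (ω L * (p (z.1 + L) - q (z.2 + L))) (ω 0 * (p z.1 - q z.2))
    rw [abs_mul, abs_mul] at h7
    rw [e]
    refine (mul_le_mul_of_nonneg_right (h6.trans (add_le_add_left h7 _)) (hη0 _)).trans
      (le_of_eq ?_)
    ring
  have hm : ∀ r : ℝ → ℝ, IsProfile R M r → Measurable (downstreamDeriv L ω r) := fun r hr => by
    have m1 : Measurable (downstream L (derivWithin ω (Icc 0 L)) r) :=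
      (measurable_downstream hL (continuousOn_derivWithin_Icc hL hω) (u := fun _ => r)
        (hr.measurable.comp _root_.measurable_snd)).comp
        (measurable_const.prodMk measurable_id : Measurable fun x : ℝ => ((0 : ℝ), x))
    exact (((hr.measurable.comp (measurable_id.add_const L)).const_mul (ω L)).sub
      (hr.measurable.const_mul (ω 0))).sub m1
  have hmeas : AEStronglyMeasurable (fun z : ℝ × ℝ =>
      |downstreamDeriv L ω p z.1 - downstreamDeriv L ω q z.2| * η (z.1 - z.2)) :=
    ((((hm p hp).comp _root_.measurable_fst).sub ((hm q hq).comp _root_.measurable_snd)).abs.mul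
      (hη.comp (_root_.measurable_fst.sub _root_.measurable_snd))).aestronglyMeasurable
  have hint := (j.add i3).mono' hmeas (Eventually.of_forall fun z => by
    rw [Real.norm_of_nonneg (mul_nonneg (abs_nonneg _) (hη0 _))]; exact hpt z)
  refine ⟨hint, ?_⟩
  have h := integral_mono hint (j.add i3) hpt
  rw [integral_add' j i3, integral_add (i1.const_mul _) (i2.const_mul _), integral_const_mul,
    integral_const_mul, e1] at h
  have e2 : ∫ z : ℝ × ℝ, |p z.1 - q z.2| * η (z.1 - z.2) = kuznetsov η p q := rfl
  rw [e2] at h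
  linarith

end DownstreamRegularity


/-! ### The traffic flux satisfies the abstract hypotheses -/

/-- The speed of the traffic seen by the profile `p`. -/
noncomputable def trafficSpeed (L : ℝ) (v ω p : ℝ → ℝ) (x : ℝ) : ℝ := v (downstream L ω p x)

/-- The spatial derivative of `trafficSpeed`. -/
noncomputable def trafficSpeedDeriv (R L : ℝ) (v ω p : ℝ → ℝ) (x : ℝ) : ℝ :=
  derivWithin v (Icc 0 R) (downstream L ω p x) * downstreamDeriv L ω p x

theorem ContDiffOn.exists_abs_sub_le_Icc {L : ℝ} {k : ℝ → ℝ} (hk : ContDiffOn ℝ 1 k (Icc 0 L)) :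
    ∃ K, 0 ≤ K ∧ ∀ s ∈ Icc 0 L, ∀ t ∈ Icc 0 L, |k s - k t| ≤ K * |s - t| := by
  obtain ⟨K, hK⟩ := hk.exists_lipschitzOnWith (by decide) (convex_Icc _ _) isCompact_Icc
  refine ⟨K, K.2, fun s hs t ht => ?_⟩
  simpa [Real.dist_eq] using hK.dist_le_mul s hs t ht

theorem ContinuousOn.exists_abs_le_Icc {L : ℝ} {k : ℝ → ℝ} (hk : ContinuousOn k (Icc 0 L)) :
    ∃ K, 0 ≤ K ∧ ∀ s ∈ Icc 0 L, |k s| ≤ K := by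
  obtain ⟨K, hK⟩ := isCompact_Icc.exists_bound_of_continuousOn hk
  exact ⟨max K 0, le_max_right _ _, fun s hs => (hK s hs).trans (le_max_left _ _)⟩

namespace TrafficData

variable {R V L M : ℝ} {v f ω p q : ℝ → ℝ}

theorem downstream_mem (h : TrafficData R V L v f ω) (hp : IsProfile R M p) (x : ℝ) :
    downstream L ω p x ∈ Icc 0 R := by
  have hi := hp.intervalIntegrable_mul h.L_pos h.ω_contDiff.continuousOn x
  refine ⟨intervalIntegral.integral_nonneg h.L_pos.le fun s hs =>
    mul_nonneg (hp.nonneg _) (h.ω_nonneg s hs), ?_⟩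
  have hω : IntervalIntegrable ω volume 0 L :=
    ContinuousOn.intervalIntegrable (by
      rw [uIcc_of_le h.L_pos.le]; exact h.ω_contDiff.continuousOn)
  have := intervalIntegral.integral_mono_on h.L_pos.le hi (hω.const_mul R) fun s hs =>
    mul_le_mul_of_nonneg_right (hp.le (x + s)) (h.ω_nonneg s hs)
  rwa [intervalIntegral.integral_const_mul, h.ω_integral, mul_one] at this

theorem abs_downstream_sub_le (h : TrafficData R V L v f ω) {D : ℝ}
    (hD : ∀ s ∈ Icc 0 L, |ω s| ≤ D) (hp : IsProfile R M p) (hq : IsProfile R M q) (x : ℝ) :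
    |downstream L ω p x - downstream L ω q x| ≤ D * ∫ z, |p z - q z| := by
  have hL := h.L_pos
  have hD0 : 0 ≤ D := (abs_nonneg _).trans (hD 0 (left_mem_Icc.2 hL.le))
  have e : downstream L ω p x - downstream L ω q x =
      ∫ s in Ioc 0 L, (p (x + s) - q (x + s)) * ω s := by
    unfold downstream
    rw [← intervalIntegral.integral_sub (hp.intervalIntegrable_mul hL h.ω_contDiff.continuousOn _)
      (hq.intervalIntegrable_mul hL h.ω_contDiff.continuousOn _),
      intervalIntegral.integral_of_le hL.le]
    simp_rw [sub_mul]
  have hi : Integrable fun s => D * |p (x + s) - q (x + s)| :=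
    ((hp.integrable.comp_add_left x).sub (hq.integrable.comp_add_left x)).abs.const_mul D
  have h1 : |downstream L ω p x - downstream L ω q x| ≤
      ∫ s in Ioc 0 L, D * |p (x + s) - q (x + s)| := by
    rw [e, ← Real.norm_eq_abs]
    refine norm_integral_le_of_norm_le hi.restrict ?_
    filter_upwards [ae_restrict_mem measurableSet_Ioc] with s hs
    rw [norm_mul, mul_comm, Real.norm_eq_abs, Real.norm_eq_abs]
    exact mul_le_mul_of_nonneg_right (hD s (Ioc_subset_Icc_self hs)) (abs_nonneg _)
  have h2 := setIntegral_le_integral (s := Ioc 0 L) hi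
    (Eventually.of_forall fun s => mul_nonneg hD0 (abs_nonneg _))
  refine h1.trans (h2.trans (le_of_eq ?_))
  rw [integral_const_mul, integral_add_left_eq_self (fun z => |p z - q z|) x]

theorem continuous_f (h : TrafficData R V L v f ω) : Continuous f := by
  have : f = IccExtend h.R_pos.le ((Icc 0 R).domRestrict f) := by
    ext r
    rcases lt_or_ge r 0 with hr | hr
    · rw [IccExtend_of_le_left _ _ hr.le, domRestrict_apply, h.f_of_neg r hr, h.f_zero]
    rcases lt_or_ge R r with hr' | hr'
    · rw [IccExtend_of_right_le _ _ hr'.le, domRestrict_apply, h.f_of_gt r hr', h.f_R]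
    · rw [IccExtend_of_mem _ _ ⟨hr, hr'⟩, domRestrict_apply]
  rw [this]
  exact (continuousOn_iff_continuous_domRestrict.1 h.f_contDiff.continuousOn).Icc_extend'

theorem measurable_comp_downstream (h : TrafficData R V L v f ω) {k : ℝ → ℝ}
    (hk : ContinuousOn k (Icc 0 R)) {u : ℝ → ℝ → ℝ} (hu : Measurable (Function.uncurry u))
    (hp : ∀ t, IsProfile R M (u t)) :
    Measurable fun z : ℝ × ℝ => k (downstream L ω (u z.1) z.2) := by
  obtain ⟨k', hk'c, hk'⟩ := continuous_comp_Icc h.R_pos.le hk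
  have : (fun z : ℝ × ℝ => k (downstream L ω (u z.1) z.2)) =
      fun z : ℝ × ℝ => k' (downstream L ω (u z.1) z.2) := by
    ext z; rw [hk' _ (h.downstream_mem (hp _) _)]
  rw [this]
  exact hk'c.measurable.comp (measurable_downstream h.L_pos h.ω_contDiff.continuousOn hu)

theorem measurable_downstreamDeriv (h : TrafficData R V L v f ω) {u : ℝ → ℝ → ℝ}
    (hu : Measurable (Function.uncurry u)) :
    Measurable fun z : ℝ × ℝ => downstreamDeriv L ω (u z.1) z.2 :=
  (((hu.comp (by fun_prop : Measurable fun z : ℝ × ℝ => (z.1, z.2 + L))).const_mul (ω L)).sub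
    (hu.const_mul (ω 0))).sub
    (measurable_downstream h.L_pos (continuousOn_derivWithin_Icc h.L_pos h.ω_contDiff) hu)

theorem continuousOn_derivWithin_v (h : TrafficData R V L v f ω) :
    ContinuousOn (derivWithin v (Icc 0 R)) (Icc 0 R) :=
  h.v_contDiff.continuousOn_derivWithin (uniqueDiffOn_Icc h.R_pos) (by norm_num)

theorem hasDerivAt_trafficSpeed (h : TrafficData R V L v f ω) (hp : IsProfile R M p) :
    ∀ᵐ x, HasDerivAt (trafficSpeed L v ω p) (trafficSpeedDeriv R L v ω p x) x := by
  filter_upwards [hp.hasDerivAt_downstream h.L_pos h.ω_contDiff] with x hx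
  have hv : HasDerivWithinAt v (derivWithin v (Icc 0 R) (downstream L ω p x)) (Icc 0 R)
      (downstream L ω p x) :=
    ((h.v_contDiff.differentiableOn (by norm_num)) _ (h.downstream_mem hp x)).hasDerivWithinAt
  exact hv.comp_hasDerivAt x hx (Eventually.of_forall fun y => h.downstream_mem hp y)

/-- Only the estimate for the speed derivative `v'(A) A'` is delicate: it needs `v'` Lipschitz,
hence `v ∈ C²`, to compare the factors `v'(A)`, and the average estimates to compare the factors
`A'`. -/
theorem exists_isFlux (h : TrafficData R V L v f ω) (hM : 0 ≤ M) :
    ∃ C, IsFlux R M C (fun r => r * f r) (trafficSpeed L v ω) (trafficSpeedDeriv R L v ω) := by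
  obtain ⟨Kv, hKv0, hKv⟩ := (h.v_contDiff.of_le one_le_two).exists_abs_sub_le_Icc
  obtain ⟨K1, hK10, hK1⟩ := h.continuousOn_derivWithin_v.exists_abs_le_Icc
  obtain ⟨K2, hK20, hK2⟩ := (h.v_contDiff.derivWithin (uniqueDiffOn_Icc h.R_pos)
    (m := 1) (by norm_num)).exists_abs_sub_le_Icc
  obtain ⟨Kf, hKf0, hKf⟩ := h.f_contDiff.exists_abs_sub_le_Icc
  obtain ⟨D, hD0, hD⟩ := h.ω_contDiff.continuousOn.exists_abs_le_Icc
  obtain ⟨Cω, hCω0, hCω⟩ :=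
    (continuousOn_derivWithin_Icc h.L_pos h.ω_contDiff).exists_abs_le_Icc
  have hL := h.L_pos
  have hR := h.R_pos.le
  have hV := h.V_pos.le
  set S : ℝ := |ω L| + |ω 0| + L * Cω with hS
  have hS0 : 0 ≤ S := by positivity
  have n1 : 0 ≤ Kv * (R * S) := by positivity
  have n2 : 0 ≤ Kv * D := by positivity
  have n3 : 0 ≤ K1 * (R * S) := by positivity
  have n4 : 0 ≤ K2 * D * (S * M) := by positivity
  have n5 : 0 ≤ K2 * (R * S) * (S * M) := by positivity
  have n6 : 0 ≤ K1 * S := by positivity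
  have n7 : 0 ≤ R * Kf := by positivity
  -- The constants of the separate clauses are added. In this order they serve `α_bound`, `α_lip`,
  -- `α_sub`, `β_bound`, the three terms of `β_sub`, and finally, as `1 + R * Kf`, `g_lip`.
  obtain ⟨C, hC⟩ : ∃ C, C = V + Kv * (R * S) + Kv * D + K1 * (R * S) + K2 * D * (S * M) +
    K2 * (R * S) * (S * M) + K1 * S + 1 + R * Kf := ⟨_, rfl⟩
  refine ⟨C, ?_⟩
  have hβ : ∀ p, IsProfile R M p → ∀ x,
      |derivWithin v (Icc 0 R) (downstream L ω p x)| ≤ K1 := fun p hp x =>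
    hK1 _ (h.downstream_mem hp x)
  have hsub := fun p (hp : IsProfile R M p) x y => hp.abs_downstream_sub_le hL h.ω_contDiff hCω x y
  refine ⟨hR, hM, by linarith, continuous_id.mul h.continuous_f, fun r hr =>
    mul_nonneg hr.1 (h.f_mapsTo hr).1, fun r hr => ?_, by simp [h.f_R], fun r hr s hs => ?_,
    fun u hu hp => h.measurable_comp_downstream h.v_contDiff.continuousOn hu hp,
    fun u hu hp => (h.measurable_comp_downstream h.continuousOn_derivWithin_v hu hp).mul
      (h.measurable_downstreamDeriv hu), fun p hp x => ?_, fun p hp x => ?_, fun p hp x y => ?_,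
    fun p q hp hq x => ?_, fun p q hp hq η hη hη0 hηi hηi' => ?_⟩
  · exact mul_le_of_le_one_right hr.1 (h.f_mapsTo hr).2
  · have e : r * f r - s * f s = (r - s) * f r + s * (f r - f s) := by ring
    have h1 : |(r - s) * f r| ≤ |r - s| := by
      rw [abs_mul, abs_of_nonneg (h.f_mapsTo hr).1]
      exact mul_le_of_le_one_right (abs_nonneg _) (h.f_mapsTo hr).2
    have h2 : |s * (f r - f s)| ≤ R * (Kf * |r - s|) := by
      rw [abs_mul, abs_of_nonneg hs.1]
      exact mul_le_mul hs.2 (hKf r hr s hs) (abs_nonneg _) hR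
    calc |r * f r - s * f s| ≤ |r - s| + R * (Kf * |r - s|) := by
          rw [e]; exact (abs_add_le _ _).trans (add_le_add h1 h2)
      _ = (1 + R * Kf) * |r - s| := by ring
      _ ≤ C * |r - s| := mul_le_mul_of_nonneg_right (by linarith) (abs_nonneg _)
  · have h1 := h.v_mapsTo (h.downstream_mem hp x)
    rw [trafficSpeed, abs_of_nonneg h1.1]
    linarith [h1.2]
  · rw [trafficSpeedDeriv, abs_mul]
    have := mul_le_mul (hβ p hp x) (hp.abs_downstreamDeriv_le hL hCω x) (abs_nonneg _) hK10
    linarith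
  · have h1 := hKv _ (h.downstream_mem hp x) _ (h.downstream_mem hp y)
    have h2 := mul_le_mul_of_nonneg_left (hsub p hp x y) hKv0
    calc |trafficSpeed L v ω p x - trafficSpeed L v ω p y| ≤ Kv * (R * S) * |x - y| := by
          rw [mul_assoc]; exact h1.trans h2
      _ ≤ C * |x - y| := mul_le_mul_of_nonneg_right (by linarith) (abs_nonneg _)
  · have h1 := hKv _ (h.downstream_mem hp x) _ (h.downstream_mem hq x)
    have h2 := mul_le_mul_of_nonneg_left (h.abs_downstream_sub_le hD hp hq x) hKv0
    calc |trafficSpeed L v ω p x - trafficSpeed L v ω q x| ≤ Kv * D * ∫ z, |p z - q z| := by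
          rw [mul_assoc]; exact h1.trans h2
      _ ≤ C * ∫ z, |p z - q z| := mul_le_mul_of_nonneg_right (by linarith)
          (integral_nonneg fun z => abs_nonneg _)
  · obtain ⟨iD, hDi⟩ := hp.integral_abs_downstreamDeriv_le hL h.ω_contDiff hCω
    obtain ⟨i3, h3⟩ := hp.integral_abs_downstreamDeriv_sub_le hq hL h.ω_contDiff hCω hη hη0 hηi
    have i1 := integrable_fst_mul_sub iD.abs hηi
    have i2 := integrable_fst_mul_sub iD.abs hηi'
    have e1 := integral_fst_mul_sub iD.abs hηi
    have e2 := integral_fst_mul_sub iD.abs hηi'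
    set I := ∫ z, |p z - q z| with hI
    have hI0 : 0 ≤ I := integral_nonneg fun z => abs_nonneg _
    have hpt : ∀ z : ℝ × ℝ, |trafficSpeedDeriv R L v ω p z.1 - trafficSpeedDeriv R L v ω q z.2| *
        η (z.1 - z.2) ≤ ((K2 * D * I) * (|downstreamDeriv L ω p z.1| * η (z.1 - z.2)) +
        (K2 * (R * S)) * (|downstreamDeriv L ω p z.1| * (|z.1 - z.2| * η (z.1 - z.2)))) +
        K1 * (|downstreamDeriv L ω p z.1 - downstreamDeriv L ω q z.2| * η (z.1 - z.2)) := by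
      intro z
      set a := derivWithin v (Icc 0 R) (downstream L ω p z.1) with ha
      set b := derivWithin v (Icc 0 R) (downstream L ω q z.2) with hb
      set c := downstreamDeriv L ω p z.1
      set d := downstreamDeriv L ω q z.2
      -- The average of `q` at the first point is inserted: changing the profile costs `D I`, and
      -- changing the point costs `R S |x - y|`, which leads to the first moment of `η`.
      have h1 : |a - b| ≤ K2 * (D * I + R * S * |z.1 - z.2|) := by
        refine (hK2 _ (h.downstream_mem hp _) _ (h.downstream_mem hq _)).trans
          (mul_le_mul_of_nonneg_left ?_ hK20)
        refine (abs_sub_le _ (downstream L ω q z.1) _).trans (add_le_add ?_ (hsub q hq _ _))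
        exact h.abs_downstream_sub_le hD hp hq _
      have h2 : |a * c - b * d| ≤ K2 * (D * I + R * S * |z.1 - z.2|) * |c| + K1 * |c - d| := by
        have e : a * c - b * d = (a - b) * c + b * (c - d) := by ring
        rw [e]
        refine (abs_add_le _ _).trans (add_le_add ?_ ?_)
        · rw [abs_mul]; exact mul_le_mul_of_nonneg_right h1 (abs_nonneg _)
        · rw [abs_mul]; exact mul_le_mul_of_nonneg_right (hβ q hq _) (abs_nonneg _)
      refine (mul_le_mul_of_nonneg_right h2 (hη0 _)).trans (le_of_eq ?_)
      ring
    have j : Integrable fun z : ℝ × ℝ =>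
        (K2 * D * I) * (|downstreamDeriv L ω p z.1| * η (z.1 - z.2)) +
        (K2 * (R * S)) * (|downstreamDeriv L ω p z.1| * (|z.1 - z.2| * η (z.1 - z.2))) :=
      (i1.const_mul _).add (i2.const_mul _)
    have hm : ∀ r : ℝ → ℝ, IsProfile R M r → Measurable (trafficSpeedDeriv R L v ω r) :=
      fun r hr => ((h.measurable_comp_downstream h.continuousOn_derivWithin_v (u := fun _ => r)
        (hr.measurable.comp measurable_snd) fun _ => hr).mul (h.measurable_downstreamDeriv
          (u := fun _ => r) (hr.measurable.comp measurable_snd))).comp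
        (measurable_const.prodMk measurable_id : Measurable fun x : ℝ => ((0 : ℝ), x))
    have hint : Integrable fun z : ℝ × ℝ => |trafficSpeedDeriv R L v ω p z.1 -
        trafficSpeedDeriv R L v ω q z.2| * η (z.1 - z.2) := by
      refine (j.add (i3.const_mul K1)).mono' ?_ (Eventually.of_forall fun z => by
        rw [Real.norm_of_nonneg (mul_nonneg (abs_nonneg _) (hη0 _))]; exact hpt z)
      exact ((((hm p hp).comp measurable_fst).sub ((hm q hq).comp measurable_snd)).abs.mul
        (hη.comp (measurable_fst.sub measurable_snd))).aestronglyMeasurable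
    refine ⟨hint, ?_⟩
    have h5 := integral_mono hint (j.add (i3.const_mul K1)) hpt
    rw [integral_add' j (i3.const_mul K1), integral_add (i1.const_mul _) (i2.const_mul _),
      integral_const_mul, integral_const_mul, integral_const_mul, e1, e2] at h5
    have hη1 : 0 ≤ ∫ z, η z := integral_nonneg hη0
    have hη2 : 0 ≤ ∫ z, |z| * η z := integral_nonneg fun z => mul_nonneg (abs_nonneg _) (hη0 z)
    have hk0 : 0 ≤ kuznetsov η p q :=
      integral_nonneg fun z => mul_nonneg (abs_nonneg _) (hη0 _)
    set A := ∫ x, |downstreamDeriv L ω p x| with hA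
    have t1 : K2 * D * I * (A * ∫ z, η z) ≤ C * (I * ∫ z, η z) := by
      have : K2 * D * A ≤ C := by
        have := mul_le_mul_of_nonneg_left hDi (mul_nonneg hK20 hD0)
        linarith
      have := mul_le_mul_of_nonneg_right this (mul_nonneg hI0 hη1)
      linarith
    have t2 : K2 * (R * S) * (A * ∫ z, |z| * η z) ≤ C * ∫ z, |z| * η z := by
      have : K2 * (R * S) * A ≤ C := by
        have := mul_le_mul_of_nonneg_left hDi (mul_nonneg hK20 (mul_nonneg hR hS0))
        linarith
      have := mul_le_mul_of_nonneg_right this hη2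
      linarith
    have t3 : K1 * ∫ z : ℝ × ℝ, |downstreamDeriv L ω p z.1 - downstreamDeriv L ω q z.2| *
        η (z.1 - z.2) ≤ C * kuznetsov η p q := by
      have t4 := mul_le_mul_of_nonneg_left h3 hK10
      have : K1 * S ≤ C := by linarith
      have := mul_le_mul_of_nonneg_right this hk0
      linarith
    linarith

end TrafficData


/-! ### Change of representatives and separated test functions -/

/-- Translations preserve null sets, and delayed times that fall before `0` are covered by the
prescribed past. The speed is read at time `t - τ`, so exceptional sets of times must be shifted. -/
theorem ae_sub_of_ae_restrict_Icc {T τ : ℝ} {P : ℝ → Prop} (hτ : 0 ≤ τ)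
    (h : ∀ᵐ t ∂(volume.restrict (Icc 0 T)), P t) (h0 : ∀ t ≤ 0, P t) :
    ∀ᵐ t ∂(volume.restrict (Icc 0 T)), P (t - τ) := by
  rw [ae_restrict_iff' measurableSet_Icc] at h ⊢
  filter_upwards [(measurePreserving_sub_right volume τ).quasiMeasurePreserving.ae h] with t ht hI
  rcases le_or_gt (t - τ) 0 with h1 | h1
  · exact h0 _ h1
  · exact ht ⟨h1.le, by linarith [hI.2]⟩

theorem downstream_congr_ae {L : ℝ} {ω u w : ℝ → ℝ} (h : u =ᵐ[volume] w) (x : ℝ) :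
    downstream L ω u x = downstream L ω w x := by
  refine intervalIntegral.integral_congr_ae ?_
  filter_upwards [(measurePreserving_add_left volume x).quasiMeasurePreserving.ae h] with s hs _
  rw [hs]

theorem measurable_of_measurable_uncurry {u : ℝ → ℝ → ℝ} (hu : Measurable (Function.uncurry u))
    (t : ℝ) : Measurable (u t) :=
  hu.comp (measurable_const.prodMk measurable_id : Measurable fun x : ℝ => (t, x))

namespace IsEntropySolutionWith

variable {T R : ℝ} {v f ρ₀ r₀ : ℝ → ℝ} {A B ρ u : ℝ → ℝ → ℝ}

/-- Density and datum occur only under integrals and may change on null sets. For almost every time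
the average is required to agree at all `x`, since it is differentiated in `x`; averages of
densities that are equal almost everywhere do agree so. -/
theorem congr (h : IsEntropySolutionWith T R v f ρ₀ A ρ) (hT : 0 ≤ T) (h0 : ρ₀ =ᵐ[volume] r₀)
    (hu : Integrable (fun p : ℝ × ℝ => u p.1 p.2) ((volume.restrict (Icc 0 T)).prod volume))
    (hρ : ∀ᵐ t ∂(volume.restrict (Icc 0 T)), ρ t =ᵐ[volume] u t)
    (hA : ∀ᵐ t ∂(volume.restrict (Icc 0 T)), ∀ x, A t x = B t x) :
    IsEntropySolutionWith T R v f r₀ B u := by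
  refine ⟨hu, ?_, fun φ hφ κ => ?_⟩
  · filter_upwards [h.mem_domain, hA] with t h1 h2 x
    rw [← h2]; exact h1 x
  · have key := h.entropy φ hφ κ
    have e0 : ∫ x, |ρ₀ x - κ| * φ (0, x) = ∫ x, |r₀ x - κ| * φ (0, x) := by
      refine integral_congr_ae ?_
      filter_upwards [h0] with x hx
      rw [hx]
    rw [e0] at key
    refine key.trans (le_of_eq ?_)
    congr 1
    refine intervalIntegral.integral_congr_ae ?_
    rw [uIoc_of_le hT, ← ae_restrict_iff' measurableSet_Ioc]
    have hle : volume.restrict (Ioc 0 T) ≤ volume.restrict (Icc 0 T) :=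
      Measure.restrict_mono Ioc_subset_Icc_self le_rfl
    filter_upwards [hle.absolutelyContinuous.ae_le hρ, hle.absolutelyContinuous.ae_le hA] with t h1 h2
    refine integral_congr_ae ?_
    filter_upwards [h1] with x hx
    simp only [hx, h2]

/-- The entropy inequality for test functions with separated variables. -/
theorem entropy_mul (h : IsEntropySolutionWith T R v f ρ₀ A ρ) (hT : 0 < T) {χ ψ : ℝ → ℝ}
    (hχ : IsTimeTest T χ) (hψ : ContDiff ℝ 1 ψ) (hψc : HasCompactSupport ψ) (hψ0 : ∀ x, 0 ≤ ψ x)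
    (κ : ℝ) (ha : ∀ᵐ t ∂(volume.restrict (Icc 0 T)), Integrable fun x => |ρ t x - κ| * ψ x)
    (hb : ∀ᵐ t ∂(volume.restrict (Icc 0 T)), Integrable fun x =>
      kruzhkovFlux (fun r => r * f r) (ρ t x) κ * v (A t x) * deriv ψ x -
        Real.sign (ρ t x - κ) * (κ * f κ) * deriv (fun y => v (A t y)) x * ψ x) :
    0 ≤ (∫ t in (0 : ℝ)..T, (deriv χ t * (∫ x, |ρ t x - κ| * ψ x) +
      χ t * ∫ x, (kruzhkovFlux (fun r => r * f r) (ρ t x) κ * v (A t x) * deriv ψ x -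
        Real.sign (ρ t x - κ) * (κ * f κ) * deriv (fun y => v (A t y)) x * ψ x))) +
      χ 0 * ∫ x, |ρ₀ x - κ| * ψ x := by
  obtain ⟨T', hT', hχT⟩ := hχ.eq_zero
  -- The function `χ` vanishes near `T` but is unrestricted at negative times. This bump supplies
  -- compact support and equals `1` in a neighbourhood of `[0, T]`, so neither values nor
  -- derivatives change there.
  let c : ContDiffBump (0 : ℝ) := ⟨T + 1, T + 2, by linarith, by linarith⟩
  have hc1 : ∀ t ∈ Ioo (-(T + 1)) (T + 1), c t = 1 := fun t ht => by
    refine c.one_of_mem_closedBall ?_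
    rw [mem_closedBall_zero_iff, Real.norm_eq_abs, abs_le]
    exact ⟨ht.1.le, ht.2.le⟩
  set φ : ℝ × ℝ → ℝ := fun z => χ z.1 * c z.1 * ψ z.2 with hφ
  have hφt : IsTestFunction T φ := by
    refine ⟨((hχ.contDiff.comp contDiff_fst).mul (c.contDiff.comp contDiff_fst)).mul
      (hψ.comp contDiff_snd), ?_, ?_, fun t _ x =>
        mul_nonneg (mul_nonneg (hχ.nonneg t) c.nonneg) (hψ0 x)⟩
    · refine HasCompactSupport.intro (c.hasCompactSupport.prod hψc : IsCompact
        (tsupport c ×ˢ tsupport ψ)) fun z hz => ?_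
      by_cases h1 : z.1 ∈ tsupport c
      · have h2 : z.2 ∉ tsupport ψ := fun h2 => hz ⟨h1, h2⟩
        simp [hφ, image_eq_zero_of_notMem_tsupport h2]
      · simp [hφ, image_eq_zero_of_notMem_tsupport h1]
    · have : tsupport φ ⊆ Iic T' ×ˢ univ := by
        refine closure_minimal (fun z hz => ⟨?_, mem_univ _⟩) (isClosed_Iic.prod isClosed_univ)
        by_contra hlt
        exact hz (by simp [hφ, hχT z.1 (not_le.1 hlt).le])
      exact this.trans (prod_mono (fun t ht => lt_of_le_of_lt ht hT') subset_rfl)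
  have key := h.entropy φ hφt κ
  have e0 : ∫ x, |ρ₀ x - κ| * φ (0, x) = χ 0 * ∫ x, |ρ₀ x - κ| * ψ x := by
    rw [← integral_const_mul]
    refine integral_congr_ae (Eventually.of_forall fun x => ?_)
    simp only [hφ, hc1 0 ⟨by linarith, by linarith⟩]
    ring
  rw [e0] at key
  refine key.trans (le_of_eq ?_)
  congr 1
  refine intervalIntegral.integral_congr_ae ?_
  rw [uIoc_of_le hT.le, ← ae_restrict_iff' measurableSet_Ioc]
  have hle : volume.restrict (Ioc 0 T) ≤ volume.restrict (Icc 0 T) :=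
    Measure.restrict_mono Ioc_subset_Icc_self le_rfl
  filter_upwards [hle.absolutelyContinuous.ae_le ha, hle.absolutelyContinuous.ae_le hb,
    ae_restrict_mem measurableSet_Ioc] with t h1 h2 ht
  rw [← integral_const_mul, ← integral_const_mul, ← integral_add (h1.const_mul _) (h2.const_mul _)]
  refine integral_congr_ae (Eventually.of_forall fun x => ?_)
  have ht1 : t ∈ Ioo (-(T + 1)) (T + 1) := ⟨by linarith [ht.1], by linarith [ht.2]⟩
  have d1 : deriv (fun s => φ (s, x)) t = deriv χ t * ψ x := by
    have : (fun s => φ (s, x)) =ᶠ[𝓝 t] fun s => χ s * ψ x := by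
      filter_upwards [Ioo_mem_nhds ht1.1 ht1.2] with s hs
      simp [hφ, hc1 s hs]
    rw [this.deriv_eq, deriv_mul_const_field]
  have d2 : deriv (fun y => φ (t, y)) x = χ t * deriv ψ x := by
    simp only [hφ, hc1 t ht1, mul_one]
    rw [deriv_const_mul_field]
  simp only [d1, d2, kruzhkovFlux]
  simp only [hφ, hc1 t ht1]
  ring

end IsEntropySolutionWith

section Representative

variable {T R L M τ : ℝ} {v f ω ρ₀ r₀ : ℝ → ℝ} {ρ : ℝ → ℝ → ℝ}

theorem measurable_withPast (hr : Measurable r₀) {w : ℝ → ℝ → ℝ}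
    (hw : Measurable (Function.uncurry w)) :
    Measurable (Function.uncurry (withPast r₀ w)) :=
  Measurable.ite (measurableSet_le measurable_fst measurable_const) (hr.comp measurable_snd) hw

/-- The integrable density is replaced by a jointly measurable one whose past is exactly `r₀`. The
hypothesis `hA` isolates the only place where the delayed and the non-delayed problem differ, the
passage from `A` to the average of the new density. -/
theorem IsEntropySolutionWith.exists_measurable {A : ℝ → ℝ → ℝ} (hT : 0 < T)
    (h : IsEntropySolutionWith T R v f ρ₀ A ρ)
    (hr : Measurable r₀) (hr₀ : ρ₀ =ᵐ[volume] r₀)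
    (hA : ∀ u : ℝ → ℝ → ℝ, (∀ t ≤ 0, u t = r₀) →
      (∀ᵐ t ∂(volume.restrict (Icc 0 T)), ρ t =ᵐ[volume] u t) →
      ∀ᵐ t ∂(volume.restrict (Icc 0 T)), ∀ x, A t x = downstream L ω (u (t - τ)) x) :
    ∃ u : ℝ → ℝ → ℝ, Measurable (Function.uncurry u) ∧ (∀ t ≤ 0, u t = r₀) ∧
      (∀ᵐ t ∂(volume.restrict (Icc 0 T)), ρ t =ᵐ[volume] u t) ∧
      IsEntropySolutionWith T R v f r₀ (fun t x => downstream L ω (u (t - τ)) x) u := by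
  set w : ℝ → ℝ → ℝ := fun t x => h.integrable.aestronglyMeasurable.mk _ (t, x) with hw
  have hwm : Measurable (Function.uncurry w) :=
    h.integrable.aestronglyMeasurable.stronglyMeasurable_mk.measurable
  have hρw : ∀ᵐ t ∂(volume.restrict (Icc 0 T)), ρ t =ᵐ[volume] w t :=
    Measure.ae_ae_of_ae_prod h.integrable.aestronglyMeasurable.ae_eq_mk
  have hne : ∀ᵐ t ∂(volume.restrict (Icc 0 T)), 0 < t := by
    filter_upwards [ae_restrict_mem measurableSet_Icc,
      ae_restrict_of_ae (Measure.ae_ne volume (0 : ℝ))] with t h1 h2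
    exact lt_of_le_of_ne h1.1 (Ne.symm h2)
  have hpast : ∀ t ≤ 0, withPast r₀ w t = r₀ := fun t ht => by ext x; simp [withPast, ht]
  have hpos : ∀ t, 0 < t → withPast r₀ w t = w t := fun t ht => by
    ext x; simp [withPast, not_le.2 ht]
  have hρu : ∀ᵐ t ∂(volume.restrict (Icc 0 T)), ρ t =ᵐ[volume] withPast r₀ w t := by
    filter_upwards [hρw, hne] with t h1 h2
    rwa [hpos t h2]
  have hint : Integrable (fun p : ℝ × ℝ => withPast r₀ w p.1 p.2)
      ((volume.restrict (Icc 0 T)).prod volume) := by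
    have h1 : Integrable (Function.uncurry w) ((volume.restrict (Icc 0 T)).prod volume) :=
      h.integrable.congr h.integrable.aestronglyMeasurable.ae_eq_mk
    refine h1.congr ?_
    have h2 : ∀ᵐ p ∂((volume.restrict (Icc 0 T)).prod (volume : Measure ℝ)), 0 < p.1 :=
      Measure.quasiMeasurePreserving_fst.ae hne
    filter_upwards [h2] with p hp
    rw [hpos p.1 hp]; rfl
  exact ⟨_, measurable_withPast hr hwm, hpast, hρu, h.congr hT.le hr₀ hint hρu (hA _ hpast hρu)⟩

theorem IsDelayedEntropySolution.exists_measurable (hT : 0 < T) (hτ : 0 ≤ τ)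
    (h : IsDelayedEntropySolution T R L v f ω τ ρ₀ ρ) (hr : Measurable r₀)
    (hr₀ : ρ₀ =ᵐ[volume] r₀) :
    ∃ u : ℝ → ℝ → ℝ, Measurable (Function.uncurry u) ∧ (∀ t ≤ 0, u t = r₀) ∧
      (∀ᵐ t ∂(volume.restrict (Icc 0 T)), ρ t =ᵐ[volume] u t) ∧
      IsEntropySolutionWith T R v f r₀ (fun t x => downstream L ω (u (t - τ)) x) u := by
  refine IsEntropySolutionWith.exists_measurable hT h hr hr₀ fun u hu hρu => ?_
  have h1 : ∀ t ≤ 0, withPast ρ₀ ρ t =ᵐ[volume] u t := fun t ht => by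
    filter_upwards [hr₀] with x hx
    simp [withPast, ht, hu t ht, hx]
  have h2 : ∀ᵐ t ∂(volume.restrict (Icc 0 T)), withPast ρ₀ ρ t =ᵐ[volume] u t := by
    filter_upwards [hρu] with t ht
    rcases le_or_gt t 0 with h0 | h0
    · exact h1 t h0
    · filter_upwards [ht] with x hx
      simp [withPast, not_le.2 h0, hx]
  filter_upwards [ae_sub_of_ae_restrict_Icc hτ h2 h1] with t ht x
  exact downstream_congr_ae ht x

theorem IsNondelayedEntropySolution.exists_measurable (hT : 0 < T)
    (h : IsNondelayedEntropySolution T R L v f ω ρ₀ ρ) (hr : Measurable r₀)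
    (hr₀ : ρ₀ =ᵐ[volume] r₀) :
    ∃ u : ℝ → ℝ → ℝ, Measurable (Function.uncurry u) ∧ (∀ t ≤ 0, u t = r₀) ∧
      (∀ᵐ t ∂(volume.restrict (Icc 0 T)), ρ t =ᵐ[volume] u t) ∧
      IsEntropySolutionWith T R v f r₀ (fun t x => downstream L ω (u (t - 0)) x) u := by
  refine IsEntropySolutionWith.exists_measurable hT h hr hr₀ fun u hu hρu => ?_
  filter_upwards [hρu] with t ht x
  rw [sub_zero]
  exact downstream_congr_ae ht x

end Representative


/-! ### Spatial cutoff, mass bound and maximum principle -/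

/-- Stretching a bump by `n + 1` divides its derivative by `n + 1`. This uniform decay removes the
flux through the edge of the cutoff as soon as the flux is integrable. -/
theorem exists_cutoff : ∃ Z : ℝ, ∃ ζ : ℕ → ℝ → ℝ, 0 ≤ Z ∧ ∀ n, ContDiff ℝ 1 (ζ n) ∧
    HasCompactSupport (ζ n) ∧ (∀ x, 0 ≤ ζ n x) ∧ (∀ x, ζ n x ≤ 1) ∧
    (∀ x, |deriv (ζ n) x| ≤ Z / ((n : ℝ) + 1)) ∧ ∀ x, Tendsto (fun n => ζ n x) atTop (𝓝 1) := by
  let c : ContDiffBump (0 : ℝ) := ⟨1, 2, by norm_num, by norm_num⟩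
  have hcd : ContDiff ℝ 1 c := c.contDiff
  obtain ⟨Z, hZ⟩ := (hcd.continuous_deriv le_rfl).bounded_above_of_compact_support
    c.hasCompactSupport.deriv
  have hZ0 : 0 ≤ Z := (norm_nonneg _).trans (hZ 0)
  refine ⟨Z, fun n x => c (x / ((n : ℝ) + 1)), hZ0, fun n => ?_⟩
  have hn : (0 : ℝ) < (n : ℝ) + 1 := by positivity
  refine ⟨hcd.comp (contDiff_id.div_const _), ?_, fun x => c.nonneg, fun x => c.le_one,
    fun x => ?_, fun x => ?_⟩
  · refine HasCompactSupport.intro (isCompact_closedBall (0 : ℝ) (2 * ((n : ℝ) + 1)))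
      fun x hx => c.zero_of_le_dist ?_
    rw [mem_closedBall_zero_iff, not_le, Real.norm_eq_abs] at hx
    rw [dist_zero_right, Real.norm_eq_abs, abs_div, abs_of_pos hn, le_div_iff₀ hn]
    exact hx.le
  · have hd : HasDerivAt (fun x => c (x / ((n : ℝ) + 1)))
        (deriv c (x / ((n : ℝ) + 1)) * (1 / ((n : ℝ) + 1))) x :=
      ((hcd.differentiable (by norm_num)) _).hasDerivAt.comp x ((hasDerivAt_id x).div_const _)
    rw [hd.deriv, abs_mul, abs_of_pos (one_div_pos.2 hn), mul_one_div]
    exact div_le_div_of_nonneg_right (hZ _) hn.le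
  · refine tendsto_const_nhds.congr' ?_
    obtain ⟨N, hN⟩ := exists_nat_ge |x|
    filter_upwards [eventually_ge_atTop N] with k hk
    have hk' : (0 : ℝ) < (k : ℝ) + 1 := by positivity
    refine (c.one_of_mem_closedBall ?_).symm
    rw [mem_closedBall_zero_iff, Real.norm_eq_abs, abs_div, abs_of_pos hk', div_le_one hk']
    have : (N : ℝ) ≤ k := by exact_mod_cast hk
    linarith

theorem intervalIntegrable_integral_of_integrable_prod {T : ℝ} (hT : 0 < T) {F : ℝ → ℝ → ℝ}
    (h : Integrable (fun p : ℝ × ℝ => F p.1 p.2) ((volume.restrict (Icc 0 T)).prod volume)) :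
    IntervalIntegrable (fun t => ∫ x, F t x) volume 0 T := by
  rw [intervalIntegrable_iff_integrableOn_Icc_of_le hT.le]
  exact h.integral_prod_left

/-- Removing the spatial cutoff from a conservation law in integrated form. -/
theorem ae_integral_le_of_forall_cutoff {T K m₀ : ℝ} (hT : 0 < T) {u D F : ℝ → ℝ → ℝ}
    {D₀ : ℝ → ℝ}
    (hu : Integrable (fun p : ℝ × ℝ => u p.1 p.2) ((volume.restrict (Icc 0 T)).prod volume))
    (hD : Measurable (Function.uncurry D)) (hF : Measurable (Function.uncurry F))
    (hD0 : ∀ t x, 0 ≤ D t x) (hDu : ∀ t x, D t x ≤ |u t x|)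
    (hFu : ∀ᵐ t ∂(volume.restrict (Icc 0 T)), ∀ x, |F t x| ≤ K * |u t x|) (hK : 0 ≤ K)
    (hD₀ : ∀ ψ : ℝ → ℝ, Continuous ψ → (∀ x, 0 ≤ ψ x) → (∀ x, ψ x ≤ 1) → ∫ x, D₀ x * ψ x ≤ m₀)
    (h : ∀ χ, IsTimeTest T χ → ∀ ψ, ContDiff ℝ 1 ψ → HasCompactSupport ψ → (∀ x, 0 ≤ ψ x) →
      0 ≤ (∫ t in (0 : ℝ)..T, (deriv χ t * (∫ x, D t x * ψ x) +
        χ t * ∫ x, F t x * deriv ψ x)) + χ 0 * ∫ x, D₀ x * ψ x) :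
    ∀ᵐ t ∂(volume.restrict (Icc 0 T)), ∫ x, D t x ≤ m₀ := by
  obtain ⟨Z, ζ, hZ, hζ⟩ := exists_cutoff
  set N : ℝ := ∫ t in Icc 0 T, ∫ x, |u t x| with hN
  have hNi : Integrable (fun t => ∫ x, |u t x|) (volume.restrict (Icc 0 T)) :=
    hu.abs.integral_prod_left
  have hFu' : ∀ᵐ p ∂((volume.restrict (Icc 0 T)).prod (volume : Measure ℝ)),
      |F p.1 p.2| ≤ K * |u p.1 p.2| :=
    (Measure.quasiMeasurePreserving_fst.ae hFu).mono fun p hp => hp p.2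
  have hFi : Integrable (fun p : ℝ × ℝ => F p.1 p.2)
      ((volume.restrict (Icc 0 T)).prod volume) :=
    (hu.abs.const_mul K).mono' hF.aestronglyMeasurable hFu'
  have hDi : Integrable (fun p : ℝ × ℝ => D p.1 p.2)
      ((volume.restrict (Icc 0 T)).prod volume) := by
    refine hu.abs.mono' hD.aestronglyMeasurable (Eventually.of_forall fun p => ?_)
    rw [Real.norm_of_nonneg (hD0 _ _)]
    exact hDu _ _
  -- With the cutoff in place, the flux contributes at most `K Z N / (n + 1)`, where `N` is the norm
  -- of `u` in `L¹([0, T] × ℝ)`. There are countably many `n`, so one null set of times suffices for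
  -- the limit.
  have hn : ∀ n : ℕ, ∀ᵐ t ∂(volume.restrict (Icc 0 T)),
      ∫ x, D t x * ζ n x ≤ m₀ + K * (Z / ((n : ℝ) + 1)) * N := fun n => by
    obtain ⟨h1, h2, h3, h4, h5, -⟩ := hζ n
    have hd0 : 0 ≤ Z / ((n : ℝ) + 1) := by positivity
    have hdm : Measurable (deriv (ζ n)) := measurable_deriv _
    have i1 : Integrable (fun p : ℝ × ℝ => D p.1 p.2 * ζ n p.2)
        ((volume.restrict (Icc 0 T)).prod volume) := by
      refine hDi.mul_bdd (c := 1) (h1.continuous.measurable.comp measurable_snd).aestronglyMeasurable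
        (Eventually.of_forall fun p => ?_)
      rw [Real.norm_of_nonneg (h3 _)]
      exact h4 _
    have i2 : Integrable (fun p : ℝ × ℝ => F p.1 p.2 * deriv (ζ n) p.2)
        ((volume.restrict (Icc 0 T)).prod volume) :=
      hFi.mul_bdd (c := Z / ((n : ℝ) + 1)) (hdm.comp measurable_snd).aestronglyMeasurable
        (Eventually.of_forall fun p => h5 _)
    have j1 := intervalIntegrable_integral_of_integrable_prod hT
      (F := fun t x => D t x * ζ n x) i1
    have j2 := intervalIntegrable_integral_of_integrable_prod hT
      (F := fun t x => F t x * deriv (ζ n) x) i2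
    filter_upwards [ae_le_of_forall_isTimeTest hT j1 j2 fun χ hχ => h χ hχ (ζ n) h1 h2 h3,
      ae_restrict_mem measurableSet_Icc] with t ht htI
    refine ht.trans (add_le_add (hD₀ _ h1.continuous h3 h4) ?_)
    have hb : ∀ᵐ s ∂(volume.restrict (Icc 0 T)), ∫ x, F s x * deriv (ζ n) x ≤
        K * (Z / ((n : ℝ) + 1)) * ∫ x, |u s x| := by
      filter_upwards [hFu, hu.prod_right_ae] with s hs hsi
      refine (le_abs_self _).trans ?_
      rw [← Real.norm_eq_abs, ← integral_const_mul]
      refine norm_integral_le_of_norm_le (hsi.abs.const_mul _) (Eventually.of_forall fun x => ?_)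
      rw [norm_mul, Real.norm_eq_abs, Real.norm_eq_abs]
      calc |F s x| * |deriv (ζ n) x| ≤ (K * |u s x|) * (Z / ((n : ℝ) + 1)) :=
            mul_le_mul (hs x) (h5 x) (abs_nonneg _) (mul_nonneg hK (abs_nonneg _))
        _ = K * (Z / ((n : ℝ) + 1)) * |u s x| := by ring
    rw [intervalIntegral.integral_of_le htI.1]
    have hsub : Ioc 0 t ⊆ Icc 0 T := fun s hs => ⟨hs.1.le, hs.2.trans htI.2⟩
    have hle : volume.restrict (Ioc 0 t) ≤ volume.restrict (Icc 0 T) :=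
      Measure.restrict_mono hsub le_rfl
    calc ∫ s in Ioc 0 t, ∫ x, F s x * deriv (ζ n) x
        ≤ ∫ s in Ioc 0 t, K * (Z / ((n : ℝ) + 1)) * ∫ x, |u s x| :=
          integral_mono_ae (i2.integral_prod_left.mono_measure hle)
            ((hNi.const_mul _).mono_measure hle) (hle.absolutelyContinuous.ae_le hb)
      _ ≤ ∫ s in Icc 0 T, K * (Z / ((n : ℝ) + 1)) * ∫ x, |u s x| :=
          integral_mono_measure hle (Eventually.of_forall fun s =>
            mul_nonneg (mul_nonneg hK hd0) (integral_nonneg fun x => abs_nonneg _))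
            (hNi.const_mul _)
      _ = K * (Z / ((n : ℝ) + 1)) * N := integral_const_mul _ _
  filter_upwards [ae_all_iff.2 hn, hDi.prod_right_ae] with t ht hti
  have l1 : Tendsto (fun n => ∫ x, D t x * ζ n x) atTop (𝓝 (∫ x, D t x * 1)) := by
    refine tendsto_integral_of_dominated_convergence (fun x => D t x) (fun n =>
      (hti.aestronglyMeasurable.mul (hζ n).1.continuous.aestronglyMeasurable)) hti
      (fun n => Eventually.of_forall fun x => ?_) (Eventually.of_forall fun x =>
        ((hζ 0).2.2.2.2.2 x).const_mul _)
    rw [Real.norm_of_nonneg (mul_nonneg (hD0 _ _) ((hζ n).2.2.1 x))]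
    exact mul_le_of_le_one_right (hD0 _ _) ((hζ n).2.2.2.1 x)
  simp only [mul_one] at l1
  have l2 : Tendsto (fun n : ℕ => m₀ + K * (Z / ((n : ℝ) + 1)) * N) atTop (𝓝 (m₀ + K * 0 * N)) := by
    have : Tendsto (fun n : ℕ => Z / ((n : ℝ) + 1)) atTop (𝓝 0) := by
      simpa [div_eq_mul_inv] using tendsto_one_div_add_atTop_nhds_zero_nat.const_mul Z
    exact ((this.const_mul K).mul_const N).const_add m₀
  simpa using le_of_tendsto_of_tendsto' l1 l2 ht


/-- Distance to the interval `[0, R]`. -/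
noncomputable def excess (R a : ℝ) : ℝ := max 0 (max (-a) (a - R))

theorem excess_nonneg (R a : ℝ) : 0 ≤ excess R a := le_max_left _ _

theorem excess_le_abs {R : ℝ} (hR : 0 ≤ R) (a : ℝ) : excess R a ≤ |a| :=
  max_le (abs_nonneg a) (max_le (neg_le_abs a) (by linarith [le_abs_self a]))

/-- The entropies for `κ = 0` and `κ = R` add up to a constant plus twice the excess. Hence their
two inequalities together control the part of the density outside `[0, R]`. -/
theorem abs_add_abs_sub_eq {R : ℝ} (hR : 0 ≤ R) (a : ℝ) :
    |a - 0| + |a - R| = R + 2 * excess R a := by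
  unfold excess
  rcases le_total a 0 with h | h
  · rw [sub_zero, abs_of_nonpos h, abs_of_nonpos (by linarith : a - R ≤ 0),
      max_eq_left (by linarith : a - R ≤ -a), max_eq_right (by linarith : 0 ≤ -a)]
    ring
  rcases le_total a R with h' | h'
  · rw [sub_zero, abs_of_nonneg h, abs_of_nonpos (by linarith : a - R ≤ 0),
      max_eq_left (max_le (by linarith) (by linarith))]
    ring
  · rw [sub_zero, abs_of_nonneg h, abs_of_nonneg (by linarith : 0 ≤ a - R),
      max_eq_right (by linarith : -a ≤ a - R), max_eq_right (by linarith : 0 ≤ a - R)]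
    ring

theorem mem_Icc_of_excess_le_zero {R a : ℝ} (h : excess R a ≤ 0) : a ∈ Icc 0 R := by
  have h1 := (le_max_right _ _).trans h
  constructor
  · linarith [(le_max_left _ _).trans h1]
  · linarith [(le_max_right _ _).trans h1]

theorem continuous_excess (R : ℝ) : Continuous (excess R) :=
  continuous_const.max (continuous_neg.max (continuous_id.sub continuous_const))

namespace TrafficData

variable {R V L M T τ κ : ℝ} {v f ω r₀ : ℝ → ℝ} {u : ℝ → ℝ → ℝ}

theorem f_mem (h : TrafficData R V L v f ω) (r : ℝ) : f r ∈ Icc 0 1 := by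
  rcases lt_or_ge r 0 with hr | hr
  · rw [h.f_of_neg r hr]; simp
  rcases lt_or_ge R r with hr' | hr'
  · rw [h.f_of_gt r hr']; simp
  · exact h.f_mapsTo ⟨hr, hr'⟩

/-- This holds for all real `a`, since the extended `f` still takes values in `[0, 1]`. Before the
maximum principle is proved, the density is not known to lie in `[0, R]`. -/
theorem abs_kruzhkovFlux_le (h : TrafficData R V L v f ω) (hκ : κ * f κ = 0) (a : ℝ) :
    |kruzhkovFlux (fun r => r * f r) a κ| ≤ |a| := by
  have h1 : |Real.sign (a - κ)| * (|a| * f a) ≤ 1 * (|a| * 1) :=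
    mul_le_mul (Real.abs_sign_le _) (mul_le_mul_of_nonneg_left (h.f_mem a).2 (abs_nonneg _))
      (mul_nonneg (abs_nonneg _) (h.f_mem a).1) zero_le_one
  simp only [kruzhkovFlux, hκ, sub_zero]
  rw [abs_mul, abs_mul, abs_of_nonneg (h.f_mem a).1]
  simpa using h1

theorem measurable_flux (h : TrafficData R V L v f ω) (hu : Measurable (Function.uncurry u))
    (κ : ℝ) : Measurable fun z : ℝ × ℝ => kruzhkovFlux (fun r => r * f r) (u z.1 z.2) κ :=
  (measurable_kruzhkovFlux (continuous_id.mul h.continuous_f).measurable).comp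
    (hu.prodMk measurable_const)

theorem measurable_downstream_delay (h : TrafficData R V L v f ω)
    (hu : Measurable (Function.uncurry u)) (τ : ℝ) :
    Measurable fun z : ℝ × ℝ => downstream L ω (u (z.1 - τ)) z.2 :=
  measurable_downstream h.L_pos h.ω_contDiff.continuousOn (u := fun t => u (t - τ))
    (hu.comp (by fun_prop : Measurable fun z : ℝ × ℝ => (z.1 - τ, z.2)))

/-- The entropy inequality for a constant stationary solution `κ`. -/
theorem entropy_mul_of_flux_eq_zero (h : TrafficData R V L v f ω) (hT : 0 < T)
    (hu : Measurable (Function.uncurry u)) {v' : ℝ → ℝ} (hv'c : Continuous v')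
    (hv' : ∀ r ∈ Icc 0 R, v' r = v r)
    (hs : IsEntropySolutionWith T R v f r₀ (fun t x => downstream L ω (u (t - τ)) x) u)
    (hκ : κ * f κ = 0) {χ ψ : ℝ → ℝ} (hχ : IsTimeTest T χ) (hψ : ContDiff ℝ 1 ψ)
    (hψc : HasCompactSupport ψ) (hψ0 : ∀ x, 0 ≤ ψ x) :
    0 ≤ (∫ t in (0 : ℝ)..T, (deriv χ t * (∫ x, |u t x - κ| * ψ x) +
      χ t * ∫ x, kruzhkovFlux (fun r => r * f r) (u t x) κ *
        v' (downstream L ω (u (t - τ)) x) * deriv ψ x)) + χ 0 * ∫ x, |r₀ x - κ| * ψ x := by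
  have hψi : Integrable ψ := hψ.continuous.integrable_of_hasCompactSupport hψc
  have hψb := hψ.continuous.bounded_above_of_compact_support hψc
  have hψ'b := (hψ.continuous_deriv le_rfl).bounded_above_of_compact_support hψc.deriv
  obtain ⟨c, hc⟩ := hψb
  obtain ⟨c', hc'⟩ := hψ'b
  have ha : ∀ᵐ t ∂(volume.restrict (Icc 0 T)), Integrable fun x => |u t x - κ| * ψ x := by
    filter_upwards [hs.integrable.prod_right_ae] with t ht
    refine ((ht.abs.mul_const c).add (hψi.const_mul |κ|)).mono'
      (((measurable_of_measurable_uncurry hu t).sub_const κ).abs.mul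
        hψ.continuous.measurable).aestronglyMeasurable (Eventually.of_forall fun x => ?_)
    have h1 : |u t x| * ψ x ≤ |u t x| * c := by
      refine mul_le_mul_of_nonneg_left ?_ (abs_nonneg _)
      exact (le_abs_self _).trans (hc x)
    have h2 := mul_le_mul_of_nonneg_right (abs_sub (u t x) κ) (hψ0 x)
    rw [Real.norm_of_nonneg (mul_nonneg (abs_nonneg _) (hψ0 x))]
    simp only [Pi.add_apply]
    linarith
  have he : ∀ᵐ t ∂(volume.restrict (Icc 0 T)), ∀ x,
      kruzhkovFlux (fun r => r * f r) (u t x) κ * v (downstream L ω (u (t - τ)) x) * deriv ψ x -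
        Real.sign (u t x - κ) * (κ * f κ) *
          deriv (fun y => v (downstream L ω (u (t - τ)) y)) x * ψ x =
      kruzhkovFlux (fun r => r * f r) (u t x) κ * v' (downstream L ω (u (t - τ)) x) * deriv ψ x := by
    filter_upwards [hs.mem_domain] with t ht x
    rw [hκ, hv' _ (ht x)]
    ring
  have hb : ∀ᵐ t ∂(volume.restrict (Icc 0 T)), Integrable fun x =>
      kruzhkovFlux (fun r => r * f r) (u t x) κ * v' (downstream L ω (u (t - τ)) x) *
        deriv ψ x := by
    filter_upwards [hs.integrable.prod_right_ae, hs.mem_domain] with t ht htm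
    have hm : Measurable fun z : ℝ × ℝ => kruzhkovFlux (fun r => r * f r) (u z.1 z.2) κ *
        v' (downstream L ω (u (z.1 - τ)) z.2) * deriv ψ z.2 :=
      ((h.measurable_flux hu κ).mul (hv'c.measurable.comp (h.measurable_downstream_delay hu τ))).mul
        ((hψ.continuous_deriv le_rfl).measurable.comp measurable_snd)
    refine (ht.abs.mul_const (V * c')).mono' (hm.comp
      (measurable_const.prodMk measurable_id : Measurable fun x : ℝ => (t, x))).aestronglyMeasurable
      (Eventually.of_forall fun x => ?_)
    have hv1 := h.v_mapsTo (htm x)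
    rw [norm_mul, norm_mul, mul_assoc, Real.norm_eq_abs, Real.norm_eq_abs, hv' _ (htm x),
      abs_of_nonneg hv1.1]
    exact mul_le_mul (h.abs_kruzhkovFlux_le hκ _) (mul_le_mul hv1.2 (hc' x) (norm_nonneg _)
      h.V_pos.le) (mul_nonneg hv1.1 (norm_nonneg _)) (abs_nonneg _)
  refine (hs.entropy_mul hT hχ hψ hψc hψ0 κ ha ?_).trans (le_of_eq ?_)
  · filter_upwards [hb, he] with t h1 h2
    exact h1.congr (Eventually.of_forall fun x => (h2 x).symm)
  · congr 1
    refine intervalIntegral.integral_congr_ae ?_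
    rw [uIoc_of_le hT.le, ← ae_restrict_iff' measurableSet_Ioc]
    have hle : volume.restrict (Ioc 0 T) ≤ volume.restrict (Icc 0 T) :=
      Measure.restrict_mono Ioc_subset_Icc_self le_rfl
    filter_upwards [hle.absolutelyContinuous.ae_le he] with t ht
    simp only [ht]

/-- Conservation of mass, as an inequality. -/
theorem ae_integral_abs_le (h : TrafficData R V L v f ω) (hT : 0 < T)
    (hu : Measurable (Function.uncurry u)) (hr : IsProfile R M r₀)
    (hs : IsEntropySolutionWith T R v f r₀ (fun t x => downstream L ω (u (t - τ)) x) u) :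
    ∀ᵐ t ∂(volume.restrict (Icc 0 T)), ∫ x, |u t x| ≤ M := by
  obtain ⟨v', hv'c, hv'⟩ := continuous_comp_Icc h.R_pos.le h.v_contDiff.continuousOn
  refine ae_integral_le_of_forall_cutoff (K := V) hT (D := fun t x => |u t x|)
    (F := fun t x => kruzhkovFlux (fun r => r * f r) (u t x) 0 *
      v' (downstream L ω (u (t - τ)) x)) (D₀ := r₀) hs.integrable hu.abs
    ((h.measurable_flux hu 0).mul (hv'c.measurable.comp (h.measurable_downstream_delay hu τ)))
    (fun t x => abs_nonneg _) (fun t x => le_rfl) ?_ h.V_pos.le (fun ψ hψ h0 h1 => ?_)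
    fun χ hχ ψ hψ hψc hψ0 => ?_
  · filter_upwards [hs.mem_domain] with t ht x
    have hv1 := h.v_mapsTo (ht x)
    rw [abs_mul, hv' _ (ht x), abs_of_nonneg hv1.1, mul_comm]
    exact mul_le_mul hv1.2 (h.abs_kruzhkovFlux_le (by simp) _) (abs_nonneg _) h.V_pos.le
  · refine (integral_mono_of_nonneg (Eventually.of_forall fun x => mul_nonneg (hr.nonneg x) (h0 x))
      hr.integrable (Eventually.of_forall fun x => ?_)).trans hr.integral_le
    exact mul_le_of_le_one_right (hr.nonneg x) (h1 x)
  · have := h.entropy_mul_of_flux_eq_zero hT hu hv'c hv' hs (κ := 0) (by simp) hχ hψ hψc hψ0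
    simpa only [sub_zero, abs_of_nonneg (hr.nonneg _)] using this

/-- Maximum principle. -/
theorem ae_mem_Icc (h : TrafficData R V L v f ω) (hT : 0 < T)
    (hu : Measurable (Function.uncurry u)) (hr : IsProfile R M r₀)
    (hs : IsEntropySolutionWith T R v f r₀ (fun t x => downstream L ω (u (t - τ)) x) u) :
    ∀ᵐ t ∂(volume.restrict (Icc 0 T)), ∀ᵐ x, u t x ∈ Icc 0 R := by
  obtain ⟨v', hv'c, hv'⟩ := continuous_comp_Icc h.R_pos.le h.v_contDiff.continuousOn
  have hR := h.R_pos.le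
  have hvm := hv'c.measurable.comp (h.measurable_downstream_delay hu τ)
  have hF : ∀ κ, κ * f κ = 0 → ∀ᵐ t ∂(volume.restrict (Icc 0 T)), ∀ x,
      |kruzhkovFlux (fun r => r * f r) (u t x) κ * v' (downstream L ω (u (t - τ)) x)| ≤
        V * |u t x| := fun κ hκ => by
    filter_upwards [hs.mem_domain] with t ht x
    have hv1 := h.v_mapsTo (ht x)
    rw [abs_mul, hv' _ (ht x), abs_of_nonneg hv1.1, mul_comm]
    exact mul_le_mul hv1.2 (h.abs_kruzhkovFlux_le hκ _) (abs_nonneg _) h.V_pos.le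
  have h0 : (0 : ℝ) * f 0 = 0 := zero_mul _
  have h1 : R * f R = 0 := by rw [h.f_R, mul_zero]
  have hD : Measurable (Function.uncurry fun t x => excess R (u t x)) :=
    (continuous_excess R).measurable.comp hu
  have hDi : Integrable (fun p : ℝ × ℝ => excess R (u p.1 p.2))
      ((volume.restrict (Icc 0 T)).prod volume) := by
    refine hs.integrable.abs.mono' hD.aestronglyMeasurable (Eventually.of_forall fun p => ?_)
    rw [Real.norm_of_nonneg (excess_nonneg _ _)]
    exact excess_le_abs hR _
  have key := ae_integral_le_of_forall_cutoff (K := V) (m₀ := 0) hT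
    (D := fun t x => excess R (u t x))
    (F := fun t x => (kruzhkovFlux (fun r => r * f r) (u t x) 0 *
      v' (downstream L ω (u (t - τ)) x) + kruzhkovFlux (fun r => r * f r) (u t x) R *
      v' (downstream L ω (u (t - τ)) x)) / 2) (D₀ := fun _ => 0) hs.integrable hD
    ((((h.measurable_flux hu 0).mul hvm).add ((h.measurable_flux hu R).mul hvm)).div_const 2)
    (fun t x => excess_nonneg _ _) (fun t x => excess_le_abs hR _) ?_ h.V_pos.le
    (fun ψ _ _ _ => by simp) fun χ hχ ψ hψ hψc hψ0 => ?_
  · filter_upwards [key, hDi.prod_right_ae] with t ht hti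
    have hz : ∫ x, excess R (u t x) = 0 :=
      le_antisymm ht (integral_nonneg fun x => excess_nonneg _ _)
    have := (integral_eq_zero_iff_of_nonneg (fun x => excess_nonneg _ _) hti).1 hz
    filter_upwards [this] with x hx
    exact mem_Icc_of_excess_le_zero (le_of_eq hx)
  · filter_upwards [hF 0 h0, hF R h1] with t ht0 ht1 x
    rw [abs_div, abs_two]
    have := abs_add_le (kruzhkovFlux (fun r => r * f r) (u t x) 0 *
      v' (downstream L ω (u (t - τ)) x)) (kruzhkovFlux (fun r => r * f r) (u t x) R *
      v' (downstream L ω (u (t - τ)) x))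
    linarith [ht0 x, ht1 x]
  · have hψi : Integrable ψ := hψ.continuous.integrable_of_hasCompactSupport hψc
    obtain ⟨c, hc⟩ := hψ.continuous.bounded_above_of_compact_support hψc
    obtain ⟨c', hc'⟩ := (hψ.continuous_deriv le_rfl).bounded_above_of_compact_support hψc.deriv
    have hψm : Measurable fun z : ℝ × ℝ => ψ z.2 := hψ.continuous.measurable.comp measurable_snd
    have hψm' : Measurable fun z : ℝ × ℝ => deriv ψ z.2 :=
      (hψ.continuous_deriv le_rfl).measurable.comp measurable_snd
    have iF : ∀ κ, κ * f κ = 0 → Integrable (fun p : ℝ × ℝ =>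
        kruzhkovFlux (fun r => r * f r) (u p.1 p.2) κ * v' (downstream L ω (u (p.1 - τ)) p.2) *
          deriv ψ p.2) ((volume.restrict (Icc 0 T)).prod volume) := fun κ hκ => by
      refine Integrable.mul_bdd (c := c') ?_ hψm'.aestronglyMeasurable
        (Eventually.of_forall fun p => hc' _)
      refine (hs.integrable.abs.const_mul V).mono'
        ((h.measurable_flux hu κ).mul hvm).aestronglyMeasurable ?_
      exact (Measure.quasiMeasurePreserving_fst.ae (hF κ hκ)).mono fun p hp => hp p.2
    have iψ : Integrable (fun p : ℝ × ℝ => (1 : ℝ) * ψ p.2)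
        ((volume.restrict (Icc 0 T)).prod volume) :=
      (integrable_const (1 : ℝ)).mul_prod hψi
    have iD : ∀ κ, Integrable (fun p : ℝ × ℝ => |u p.1 p.2 - κ| * ψ p.2)
        ((volume.restrict (Icc 0 T)).prod volume) := fun κ => by
      refine ((hs.integrable.abs.mul_const c).add (iψ.const_mul |κ|)).mono'
        ((hu.sub_const κ).abs.mul hψm).aestronglyMeasurable (Eventually.of_forall fun p => ?_)
      have h1 : |u p.1 p.2| * ψ p.2 ≤ |u p.1 p.2| * c :=
        mul_le_mul_of_nonneg_left ((le_abs_self _).trans (hc _)) (abs_nonneg _)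
      have h2 := mul_le_mul_of_nonneg_right (abs_sub (u p.1 p.2) κ) (hψ0 p.2)
      rw [Real.norm_of_nonneg (mul_nonneg (abs_nonneg _) (hψ0 _))]
      simp only [Pi.add_apply]
      linarith
    have a0 := h.entropy_mul_of_flux_eq_zero hT hu hv'c hv' hs h0 hχ hψ hψc hψ0
    have a1 := h.entropy_mul_of_flux_eq_zero hT hu hv'c hv' hs h1 hχ hψ hψc hψ0
    have k : ∀ κ, κ * f κ = 0 → IntervalIntegrable (fun t =>
        deriv χ t * (∫ x, |u t x - κ| * ψ x) + χ t * ∫ x, kruzhkovFlux (fun r => r * f r) (u t x) κ *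
        v' (downstream L ω (u (t - τ)) x) * deriv ψ x) volume 0 T := fun κ hκ =>
      ((intervalIntegrable_integral_of_integrable_prod hT (F := fun t x => |u t x - κ| * ψ x)
        (iD κ)).continuousOn_mul hχ.continuous_deriv.continuousOn).add
      ((intervalIntegrable_integral_of_integrable_prod hT (F := fun t x =>
        kruzhkovFlux (fun r => r * f r) (u t x) κ * v' (downstream L ω (u (t - τ)) x) * deriv ψ x)
        (iF κ hκ)).continuousOn_mul hχ.contDiff.continuous.continuousOn)
    have iDψ : Integrable (fun p : ℝ × ℝ => excess R (u p.1 p.2) * ψ p.2)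
        ((volume.restrict (Icc 0 T)).prod volume) :=
      hDi.mul_bdd (c := c) hψm.aestronglyMeasurable (Eventually.of_forall fun p => hc _)
    have kF := (intervalIntegrable_integral_of_integrable_prod hT (F := fun t x =>
      (kruzhkovFlux (fun r => r * f r) (u t x) 0 * v' (downstream L ω (u (t - τ)) x) +
        kruzhkovFlux (fun r => r * f r) (u t x) R * v' (downstream L ω (u (t - τ)) x)) / 2 *
        deriv ψ x) (by
          refine (((iF 0 h0).add (iF R h1)).div_const 2).congr (Eventually.of_forall fun p => ?_)
          simp only [Pi.add_apply]; ring)).continuousOn_mul hχ.contDiff.continuous.continuousOn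
    have kD := (intervalIntegrable_integral_of_integrable_prod hT (F := fun t x =>
      excess R (u t x) * ψ x) iDψ).continuousOn_mul hχ.continuous_deriv.continuousOn
    have hsum := intervalIntegral.integral_add (k 0 h0) (k R h1)
    -- The constant part of the summed entropies contributes `-χ 0 * R ∫ ψ`, which cancels the datum
    -- term because `|r₀| + |r₀ - R| = R`. What is left is the inequality for the excess with zero
    -- initial value.
    have hχd : ∫ t in (0 : ℝ)..T, deriv χ t = - χ 0 := by
      obtain ⟨T', hT', hz⟩ := hχ.eq_zero
      rw [intervalIntegral.integral_deriv_eq_sub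
        (fun t _ => (hχ.contDiff.differentiable (by norm_num)) t)
        (hχ.continuous_deriv.intervalIntegrable _ _), hz T hT'.le, zero_sub]
    have hcong : ∫ t in (0 : ℝ)..T, ((deriv χ t * (∫ x, |u t x - 0| * ψ x) +
        χ t * ∫ x, kruzhkovFlux (fun r => r * f r) (u t x) 0 *
        v' (downstream L ω (u (t - τ)) x) * deriv ψ x) +
        (deriv χ t * (∫ x, |u t x - R| * ψ x) +
        χ t * ∫ x, kruzhkovFlux (fun r => r * f r) (u t x) R *
        v' (downstream L ω (u (t - τ)) x) * deriv ψ x)) =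
        ∫ t in (0 : ℝ)..T, (deriv χ t * (R * ∫ x, ψ x) +
          2 * (deriv χ t * (∫ x, excess R (u t x) * ψ x) +
          χ t * ∫ x, (kruzhkovFlux (fun r => r * f r) (u t x) 0 *
            v' (downstream L ω (u (t - τ)) x) + kruzhkovFlux (fun r => r * f r) (u t x) R *
            v' (downstream L ω (u (t - τ)) x)) / 2 * deriv ψ x)) := by
      refine intervalIntegral.integral_congr_ae ?_
      rw [uIoc_of_le hT.le, ← ae_restrict_iff' measurableSet_Ioc]
      have hle : volume.restrict (Ioc 0 T) ≤ volume.restrict (Icc 0 T) :=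
        Measure.restrict_mono Ioc_subset_Icc_self le_rfl
      filter_upwards [hle.absolutelyContinuous.ae_le (iD 0).prod_right_ae,
        hle.absolutelyContinuous.ae_le (iD R).prod_right_ae,
        hle.absolutelyContinuous.ae_le (iF 0 h0).prod_right_ae,
        hle.absolutelyContinuous.ae_le (iF R h1).prod_right_ae,
        hle.absolutelyContinuous.ae_le iDψ.prod_right_ae] with t t1 t2 t3 t4 t5
      have e1 : (∫ x, |u t x - 0| * ψ x) + ∫ x, |u t x - R| * ψ x =
          R * (∫ x, ψ x) + 2 * ∫ x, excess R (u t x) * ψ x := by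
        rw [← integral_add t1 t2, ← integral_const_mul, ← integral_const_mul,
          ← integral_add (hψi.const_mul R) (t5.const_mul 2)]
        refine integral_congr_ae (Eventually.of_forall fun x => ?_)
        have := abs_add_abs_sub_eq hR (u t x)
        beta_reduce
        rw [← add_mul, this]; ring
      have e2 : 2 * ∫ x, (kruzhkovFlux (fun r => r * f r) (u t x) 0 *
            v' (downstream L ω (u (t - τ)) x) + kruzhkovFlux (fun r => r * f r) (u t x) R *
            v' (downstream L ω (u (t - τ)) x)) / 2 * deriv ψ x =
          (∫ x, kruzhkovFlux (fun r => r * f r) (u t x) 0 *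
            v' (downstream L ω (u (t - τ)) x) * deriv ψ x) +
          ∫ x, kruzhkovFlux (fun r => r * f r) (u t x) R *
            v' (downstream L ω (u (t - τ)) x) * deriv ψ x := by
        rw [← integral_add t3 t4, ← integral_const_mul]
        refine integral_congr_ae (Eventually.of_forall fun x => ?_)
        beta_reduce
        ring
      linear_combination deriv χ t * e1 - χ t * e2
    have e0 : (∫ x, |r₀ x - 0| * ψ x) + ∫ x, |r₀ x - R| * ψ x = R * ∫ x, ψ x := by
      have e1 : ∀ x, |r₀ x - 0| = r₀ x := fun x => by rw [sub_zero, abs_of_nonneg (hr.nonneg x)]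
      have e2 : ∀ x, |r₀ x - R| = R - r₀ x := fun x => by
        rw [abs_of_nonpos (by linarith [hr.le x])]; ring
      simp_rw [e1, e2]
      have i1 : Integrable fun x => r₀ x * ψ x :=
        hr.integrable.mul_bdd (c := c) hψ.continuous.aestronglyMeasurable
          (Eventually.of_forall hc)
      have i2 : Integrable fun x => (R - r₀ x) * ψ x :=
        ((hψi.const_mul R).sub i1).congr (Eventually.of_forall fun x => by simp [sub_mul])
      rw [← integral_add i1 i2, ← integral_const_mul]
      refine integral_congr_ae (Eventually.of_forall fun x => ?_)
      beta_reduce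
      ring
    have kc : IntervalIntegrable (fun t => deriv χ t * (R * ∫ x, ψ x)) volume 0 T :=
      (hχ.continuous_deriv.mul continuous_const).intervalIntegrable _ _
    rw [hcong, intervalIntegral.integral_add kc ((kD.add kF).const_mul 2), intervalIntegral.integral_mul_const,
      intervalIntegral.integral_const_mul, hχd] at hsum
    simp only [zero_mul, integral_zero, mul_zero, add_zero]
    have e3 : χ 0 * (∫ x, |r₀ x - 0| * ψ x) + χ 0 * ∫ x, |r₀ x - R| * ψ x =
      χ 0 * (R * ∫ x, ψ x) := by rw [← mul_add, e0]
    linarith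

end TrafficData


/-! ### From entropy solutions to Kruzhkov solutions -/

/-- Passing from compactly supported to integrable spatial test functions. -/
theorem nonneg_of_forall_hasCompactSupport {T K : ℝ} {a b₁ b₂ : ℝ → ℝ → ℝ}
    {a₀ χ : ℝ → ℝ} (ha : Measurable (Function.uncurry a)) (hb₁ : Measurable (Function.uncurry b₁))
    (hb₂ : Measurable (Function.uncurry b₂)) (ha₀ : Measurable a₀) (haK : ∀ t x, |a t x| ≤ K)
    (hbK₁ : ∀ t x, |b₁ t x| ≤ K) (hbK₂ : ∀ t x, |b₂ t x| ≤ K) (haK₀ : ∀ x, |a₀ x| ≤ K)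
    (hχ : IsTimeTest T χ)
    (h : ∀ ψ, ContDiff ℝ 1 ψ → HasCompactSupport ψ → (∀ x, 0 ≤ ψ x) →
      0 ≤ (∫ t in (0 : ℝ)..T, (deriv χ t * (∫ x, a t x * ψ x) +
        χ t * ∫ x, (b₁ t x * deriv ψ x - b₂ t x * ψ x))) + χ 0 * ∫ x, a₀ x * ψ x)
    {ψ : ℝ → ℝ} (hψ : ContDiff ℝ 1 ψ) (hψ0 : ∀ x, 0 ≤ ψ x) (hψi : Integrable ψ)
    (hψi' : Integrable (deriv ψ)) :
    0 ≤ (∫ t in (0 : ℝ)..T, (deriv χ t * (∫ x, a t x * ψ x) +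
        χ t * ∫ x, (b₁ t x * deriv ψ x - b₂ t x * ψ x))) + χ 0 * ∫ x, a₀ x * ψ x := by
  obtain ⟨Z, ζ, hZ, hζ⟩ := exists_cutoff
  have hK : 0 ≤ K := (abs_nonneg _).trans (haK₀ 0)
  have hd : ∀ n x, deriv (fun x => ζ n x * ψ x) x = deriv (ζ n) x * ψ x + ζ n x * deriv ψ x :=
    fun n x => deriv_fun_mul ((hζ n).1.differentiable (by norm_num) x)
      (hψ.differentiable (by norm_num) x)
  -- The derivative of the cutoff multiplies only `ψ`, so the extra term tends to zero. Dominated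
  -- convergence applies in `x` and then in `t`, with `ψ` and its derivative as integrable
  -- majorants.
  have hdn : ∀ x, Tendsto (fun n => deriv (ζ n) x) atTop (𝓝 0) := fun x => by
    have : Tendsto (fun n : ℕ => Z / ((n : ℝ) + 1)) atTop (𝓝 0) := by
      simpa [div_eq_mul_inv] using tendsto_one_div_add_atTop_nhds_zero_nat.const_mul Z
    exact squeeze_zero_norm (fun n => (hζ n).2.2.2.2.1 x) this
  have hdZ : ∀ n x, |deriv (ζ n) x| ≤ Z := fun n x =>
    ((hζ n).2.2.2.2.1 x).trans (div_le_self hZ (by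
      have : (0 : ℝ) ≤ n := n.cast_nonneg
      linarith))
  have hζ1 : ∀ n x, |ζ n x| ≤ 1 := fun n x => by
    rw [abs_of_nonneg ((hζ n).2.2.1 x)]; exact (hζ n).2.2.2.1 x
  have hψm := hψ.continuous.measurable
  have hψm' : Measurable (deriv ψ) := measurable_deriv _
  have hζm : ∀ n, Measurable (ζ n) := fun n => (hζ n).1.continuous.measurable
  have hζm' : ∀ n, Measurable (deriv (ζ n)) := fun n => measurable_deriv _
  have bnd1 : ∀ (c : ℝ) n x, |c| ≤ K → ‖c * (ζ n x * ψ x)‖ ≤ K * ψ x := fun c n x hc => by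
    rw [norm_mul, norm_mul, Real.norm_eq_abs, Real.norm_eq_abs, Real.norm_of_nonneg (hψ0 x)]
    exact mul_le_mul hc (mul_le_of_le_one_left (hψ0 x) (hζ1 n x))
      (mul_nonneg (abs_nonneg _) (hψ0 x)) hK
  have bnd2 : ∀ (c c' : ℝ) n x, |c| ≤ K → |c'| ≤ K →
      ‖c * (deriv (ζ n) x * ψ x + ζ n x * deriv ψ x) - c' * (ζ n x * ψ x)‖ ≤
        K * (Z * ψ x + |deriv ψ x|) + K * ψ x := fun c c' n x hc hc' => by
    refine (norm_sub_le _ _).trans (add_le_add ?_ (bnd1 c' n x hc'))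
    rw [norm_mul]
    refine mul_le_mul hc ((norm_add_le _ _).trans (add_le_add ?_ ?_)) (norm_nonneg _) hK
    · rw [norm_mul, Real.norm_of_nonneg (hψ0 x)]
      exact mul_le_mul_of_nonneg_right (hdZ n x) (hψ0 x)
    · rw [norm_mul]
      exact mul_le_of_le_one_left (abs_nonneg _) (hζ1 n x)
  have i1 : Integrable fun x => K * ψ x := hψi.const_mul K
  have i2 : Integrable fun x => K * (Z * ψ x + |deriv ψ x|) + K * ψ x :=
    (((hψi.const_mul Z).add hψi'.abs).const_mul K).add i1
  have t1 : ∀ {c : ℝ → ℝ}, Measurable c → (∀ x, |c x| ≤ K) →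
      Tendsto (fun n => ∫ x, c x * (ζ n x * ψ x)) atTop (𝓝 (∫ x, c x * ψ x)) := fun {c} hc hcK => by
    refine tendsto_integral_of_dominated_convergence _
      (fun n => (hc.mul ((hζm n).mul hψm)).aestronglyMeasurable) i1
      (fun n => Eventually.of_forall fun x => bnd1 _ n x (hcK x)) (Eventually.of_forall fun x => ?_)
    simpa using (((hζ 0).2.2.2.2.2 x).mul_const (ψ x)).const_mul (c x)
  have t2 : ∀ {c c' : ℝ → ℝ}, Measurable c → Measurable c' → (∀ x, |c x| ≤ K) → (∀ x, |c' x| ≤ K) →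
      Tendsto (fun n => ∫ x, (c x * (deriv (ζ n) x * ψ x + ζ n x * deriv ψ x) -
        c' x * (ζ n x * ψ x))) atTop (𝓝 (∫ x, (c x * deriv ψ x - c' x * ψ x))) :=
    fun {c c'} hc hc' hcK hcK' => by
    refine tendsto_integral_of_dominated_convergence _
      (fun n => ((hc.mul (((hζm' n).mul hψm).add ((hζm n).mul hψm'))).sub
        (hc'.mul ((hζm n).mul hψm))).aestronglyMeasurable) i2
      (fun n => Eventually.of_forall fun x => bnd2 _ _ n x (hcK x) (hcK' x))
      (Eventually.of_forall fun x => ?_)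
    have l1 := ((hdn x).mul_const (ψ x)).add (((hζ 0).2.2.2.2.2 x).mul_const (deriv ψ x))
    have l2 := ((hζ 0).2.2.2.2.2 x).mul_const (ψ x)
    simpa using (l1.const_mul (c x)).sub (l2.const_mul (c' x))
  have hsec : ∀ {c : ℝ → ℝ → ℝ}, Measurable (Function.uncurry c) → ∀ t, Measurable (c t) :=
    fun hc t => measurable_of_measurable_uncurry hc t
  set I1 : ℝ := ∫ x, K * ψ x
  set I2 : ℝ := ∫ x, (K * (Z * ψ x + |deriv ψ x|) + K * ψ x)
  have hlim : Tendsto (fun n => ∫ t in (0 : ℝ)..T, (deriv χ t * (∫ x, a t x * (ζ n x * ψ x)) +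
      χ t * ∫ x, (b₁ t x * (deriv (ζ n) x * ψ x + ζ n x * deriv ψ x) - b₂ t x * (ζ n x * ψ x))))
      atTop (𝓝 (∫ t in (0 : ℝ)..T, (deriv χ t * (∫ x, a t x * ψ x) +
        χ t * ∫ x, (b₁ t x * deriv ψ x - b₂ t x * ψ x)))) := by
    refine intervalIntegral.tendsto_integral_filter_of_dominated_convergence
      (fun t => |deriv χ t| * I1 + |χ t| * I2) (Eventually.of_forall fun n => ?_)
      (Eventually.of_forall fun n => Eventually.of_forall fun t _ => ?_) ?_
      (Eventually.of_forall fun t _ => ?_)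
    · have m1 : Measurable fun z : ℝ × ℝ => a z.1 z.2 * (ζ n z.2 * ψ z.2) :=
        ha.mul (((hζm n).comp measurable_snd).mul (hψm.comp measurable_snd))
      have m2 : Measurable fun z : ℝ × ℝ => b₁ z.1 z.2 * (deriv (ζ n) z.2 * ψ z.2 +
          ζ n z.2 * deriv ψ z.2) - b₂ z.1 z.2 * (ζ n z.2 * ψ z.2) :=
        (hb₁.mul ((((hζm' n).comp measurable_snd).mul (hψm.comp measurable_snd)).add
          (((hζm n).comp measurable_snd).mul (hψm'.comp measurable_snd)))).sub
          (hb₂.mul (((hζm n).comp measurable_snd).mul (hψm.comp measurable_snd)))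
      exact (((measurable_deriv χ).mul m1.stronglyMeasurable.integral_prod_right'.measurable).add
        (hχ.contDiff.continuous.measurable.mul
          m2.stronglyMeasurable.integral_prod_right'.measurable)).aestronglyMeasurable
    · refine (norm_add_le _ _).trans (add_le_add ?_ ?_)
      · rw [norm_mul]
        exact mul_le_mul_of_nonneg_left (norm_integral_le_of_norm_le i1
          (Eventually.of_forall fun x => bnd1 _ n x (haK t x))) (norm_nonneg _)
      · rw [norm_mul]
        exact mul_le_mul_of_nonneg_left (norm_integral_le_of_norm_le i2
          (Eventually.of_forall fun x => bnd2 _ _ n x (hbK₁ t x) (hbK₂ t x))) (norm_nonneg _)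
    · exact ((hχ.continuous_deriv.abs.mul continuous_const).add
        (hχ.contDiff.continuous.abs.mul continuous_const)).intervalIntegrable _ _
    · exact ((t1 (hsec ha t) (haK t)).const_mul _).add
        ((t2 (hsec hb₁ t) (hsec hb₂ t) (hbK₁ t) (hbK₂ t)).const_mul _)
  refine ge_of_tendsto' (hlim.add ((t1 ha₀ haK₀).const_mul (χ 0))) fun n => ?_
  have := h (fun x => ζ n x * ψ x) ((hζ n).1.mul hψ) ((hζ n).2.1.mul_right)
    fun x => mul_nonneg ((hζ n).2.2.1 x) (hψ0 x)
  simpa only [hd] using this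

namespace TrafficData

variable {R V L M T τ : ℝ} {v f ω r₀ : ℝ → ℝ} {u : ℝ → ℝ → ℝ}

/-- Once all slices are profiles, every coefficient of the entropy inequality is bounded. The test
functions may then be merely integrable with integrable derivative, as the mollifiers without
compact support require. The derivative of `v(A)` equals `trafficSpeedDeriv` almost everywhere,
which is enough under the integral. -/
theorem isKruzhkovSolution (h : TrafficData R V L v f ω) (hT : 0 < T) (hM : 0 ≤ M) (hτ : 0 ≤ τ)
    (hu : Measurable (Function.uncurry u)) (hp : ∀ t, IsProfile R M (u t))
    (hpast : ∀ t ≤ 0, u t = r₀)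
    (hs : IsEntropySolutionWith T R v f r₀ (fun t x => downstream L ω (u (t - τ)) x) u) :
    IsKruzhkovSolution T R M τ (fun r => r * f r) (trafficSpeed L v ω)
      (trafficSpeedDeriv R L v ω) r₀ u := by
  refine ⟨hτ, hu, hp, hpast, fun χ hχ ψ hψ hψ0 hψi hψi' κ hκ => ?_⟩
  obtain ⟨C, hC⟩ := h.exists_isFlux hM
  have hC0 := hC.C_nonneg
  have hR := h.R_pos.le
  have hr : IsProfile R M r₀ := hpast 0 le_rfl ▸ hp 0
  have hud : Measurable (Function.uncurry fun t => u (t - τ)) :=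
    hu.comp (by fun_prop : Measurable fun z : ℝ × ℝ => (z.1 - τ, z.2))
  have hαm := hC.α_measurable _ hud fun t => hp _
  have hβm := hC.β_measurable _ hud fun t => hp _
  have hsub : ∀ r ∈ Icc 0 R, |r - κ| ≤ R := fun r hr' => by
    rw [abs_le]; constructor <;> linarith [hr'.1, hr'.2, hκ.1, hκ.2]
  have hF : ∀ r ∈ Icc 0 R, |kruzhkovFlux (fun r => r * f r) r κ| ≤ C * R := fun r hr' => by
    rw [kruzhkovFlux, abs_mul]
    have h1 := (hC.g_lip r hr' κ hκ).trans (mul_le_mul_of_nonneg_left (hsub r hr') hC0)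
    exact (mul_le_of_le_one_left (abs_nonneg _) (Real.abs_sign_le _)).trans h1
  have hg : ∀ r, |Real.sign (r - κ) * (κ * f κ)| ≤ R := fun r => by
    rw [abs_mul]
    refine (mul_le_of_le_one_left (abs_nonneg _) (Real.abs_sign_le _)).trans ?_
    rw [abs_of_nonneg (hC.g_nonneg κ hκ)]
    exact (hC.g_le κ hκ).trans hκ.2
  have ma : Measurable (Function.uncurry fun t x => |u t x - κ|) := (hu.sub_const κ).abs
  have mb₁ : Measurable (Function.uncurry fun t x => kruzhkovFlux (fun r => r * f r) (u t x) κ *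
      trafficSpeed L v ω (u (t - τ)) x) := (h.measurable_flux hu κ).mul hαm
  have mb₂ : Measurable (Function.uncurry fun t x => Real.sign (u t x - κ) * (κ * f κ) *
      trafficSpeedDeriv R L v ω (u (t - τ)) x) :=
    ((Real.measurable_sign.comp (hu.sub_const κ)).mul_const _).mul hβm
  have ba : ∀ t x, |(|u t x - κ|)| ≤ R + C * R * C + R * C := fun t x => by
    rw [abs_abs]
    have : 0 ≤ C * R * C + R * C := by positivity
    linarith [hsub _ ((hp t).mem_Icc x)]
  have bb₁ : ∀ t x, |kruzhkovFlux (fun r => r * f r) (u t x) κ *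
      trafficSpeed L v ω (u (t - τ)) x| ≤ R + C * R * C + R * C := fun t x => by
    rw [abs_mul]
    have h1 := mul_le_mul (hF _ ((hp t).mem_Icc x)) (hC.α_bound _ (hp (t - τ)) x) (abs_nonneg _)
      (mul_nonneg hC0 hR)
    have : 0 ≤ R + R * C := by positivity
    linarith
  have bb₂ : ∀ t x, |Real.sign (u t x - κ) * (κ * f κ) *
      trafficSpeedDeriv R L v ω (u (t - τ)) x| ≤ R + C * R * C + R * C := fun t x => by
    rw [abs_mul]
    have h1 := mul_le_mul (hg (u t x)) (hC.β_bound _ (hp (t - τ)) x) (abs_nonneg _) hR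
    have : 0 ≤ R + C * R * C := by positivity
    linarith
  have key := nonneg_of_forall_hasCompactSupport (K := R + C * R * C + R * C) ma mb₁ mb₂
    (hr.measurable.sub_const κ).abs ba bb₁ bb₂ (fun x => by rw [← hpast 0 le_rfl]; exact ba 0 x)
    hχ (fun ψ hψ hψc hψ0 => ?_) hψ hψ0 hψi hψi'
  · exact key
  have hψi : Integrable ψ := hψ.continuous.integrable_of_hasCompactSupport hψc
  have hψi' : Integrable (deriv ψ) :=
    (hψ.continuous_deriv le_rfl).integrable_of_hasCompactSupport hψc.deriv
  have hβ : ∀ t, ∀ᵐ x, deriv (fun y => v (downstream L ω (u (t - τ)) y)) x =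
      trafficSpeedDeriv R L v ω (u (t - τ)) x := fun t => by
    filter_upwards [h.hasDerivAt_trafficSpeed (hp (t - τ))] with x hx using hx.deriv
  have hcong : ∀ t, (fun x => kruzhkovFlux (fun r => r * f r) (u t x) κ *
      trafficSpeed L v ω (u (t - τ)) x * deriv ψ x -
        Real.sign (u t x - κ) * (κ * f κ) * trafficSpeedDeriv R L v ω (u (t - τ)) x * ψ x)
      =ᵐ[volume] fun x => kruzhkovFlux (fun r => r * f r) (u t x) κ *
        v (downstream L ω (u (t - τ)) x) * deriv ψ x - Real.sign (u t x - κ) * (κ * f κ) *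
        deriv (fun y => v (downstream L ω (u (t - τ)) y)) x * ψ x := fun t => by
    filter_upwards [hβ t] with x hx
    rw [hx]; rfl
  have hint : ∀ t, Integrable fun x => kruzhkovFlux (fun r => r * f r) (u t x) κ *
      trafficSpeed L v ω (u (t - τ)) x * deriv ψ x -
        Real.sign (u t x - κ) * (κ * f κ) * trafficSpeedDeriv R L v ω (u (t - τ)) x * ψ x :=
    fun t => (hψi'.bdd_mul (measurable_of_measurable_uncurry mb₁ t).aestronglyMeasurable
      (Eventually.of_forall (bb₁ t))).sub
      (hψi.bdd_mul (measurable_of_measurable_uncurry mb₂ t).aestronglyMeasurable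
      (Eventually.of_forall (bb₂ t)))
  have := hs.entropy_mul hT hχ hψ hψc hψ0 κ
    (Eventually.of_forall fun t => hψi.bdd_mul
      (measurable_of_measurable_uncurry ma t).aestronglyMeasurable (Eventually.of_forall (ba t)))
    (Eventually.of_forall fun t => (hint t).congr (hcong t))
  simp_rw [fun t => (integral_congr_ae (hcong t)).symm] at this
  exact this

/-- Entropy solutions have a representative with values in the set of admissible profiles. -/
theorem exists_isKruzhkovSolution (h : TrafficData R V L v f ω) (hT : 0 < T) (hτ : 0 ≤ τ)
    (hr : IsProfile R M r₀) (hu : Measurable (Function.uncurry u)) (hpast : ∀ t ≤ 0, u t = r₀)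
    (hs : IsEntropySolutionWith T R v f r₀ (fun t x => downstream L ω (u (t - τ)) x) u) :
    ∃ w, IsKruzhkovSolution T R M τ (fun r => r * f r) (trafficSpeed L v ω)
      (trafficSpeedDeriv R L v ω) r₀ w ∧
      ∀ᵐ t ∂(volume.restrict (Icc 0 T)), u t =ᵐ[volume] w t := by
  classical
  have hR := h.R_pos.le
  have hM : 0 ≤ M := hr.integral_nonneg.trans hr.integral_le
  set p : ℝ → ℝ → ℝ := fun t x => max 0 (min R (u t x)) with hpdef
  have hpm : Measurable (Function.uncurry p) := measurable_const.max (measurable_const.min hu)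
  have hpI : ∀ t x, p t x ∈ Icc 0 R := fun t x => ⟨le_max_left _ _, max_le hR (min_le_left _ _)⟩
  have hp_eq : ∀ t x, u t x ∈ Icc 0 R → p t x = u t x := fun t x hx => by
    simp only [hpdef]
    rw [min_eq_right hx.2, max_eq_right hx.1]
  -- These are the positive times at which the truncated slice has mass at most `M`; the lower
  -- integral makes the set measurable and yields integrability as well. At all other times the
  -- slice becomes `r₀`, which within `[0, T]` affects only a null set apart from time `0`, where
  -- the value is already `r₀`.
  set G : Set ℝ := Ioi 0 ∩ {t | ∫⁻ x, ENNReal.ofReal (p t x) ≤ ENNReal.ofReal M} with hG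
  have hGm : MeasurableSet G := by
    refine measurableSet_Ioi.inter (measurableSet_le ?_ measurable_const)
    exact (ENNReal.measurable_ofReal.comp hpm).lintegral_prod_right'
  set w : ℝ → ℝ → ℝ := fun t x => if t ∈ G then p t x else r₀ x with hw
  have hwm : Measurable (Function.uncurry w) :=
    Measurable.ite (measurable_fst hGm) hpm (hr.measurable.comp measurable_snd)
  have hw1 : ∀ t ∈ G, w t = p t := fun t ht => by ext x; simp [hw, ht]
  have hw2 : ∀ t ∉ G, w t = r₀ := fun t ht => by ext x; simp [hw, ht]
  have hwp : ∀ t, IsProfile R M (w t) := fun t => by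
    by_cases ht : t ∈ G
    · rw [hw1 t ht]
      have hm := measurable_of_measurable_uncurry hpm t
      have h0 : 0 ≤ᵐ[volume] p t := Eventually.of_forall fun x => (hpI t x).1
      refine ⟨hm, hpI t, ⟨hm.aestronglyMeasurable, ?_⟩, ?_⟩
      · rw [hasFiniteIntegral_iff_ofReal h0]
        exact ht.2.trans_lt ENNReal.ofReal_lt_top
      · rw [integral_eq_lintegral_of_nonneg_ae h0 hm.aestronglyMeasurable]
        exact ENNReal.toReal_le_of_le_ofReal hM ht.2
    · rw [hw2 t ht]; exact hr
  have hwpast : ∀ t ≤ 0, w t = r₀ := fun t ht => hw2 t fun h' => not_lt.2 ht h'.1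
  have hae : ∀ᵐ t ∂(volume.restrict (Icc 0 T)), u t =ᵐ[volume] w t := by
    filter_upwards [h.ae_mem_Icc hT hu hr hs, h.ae_integral_abs_le hT hu hr hs,
      hs.integrable.prod_right_ae, ae_restrict_mem measurableSet_Icc] with t h1 h2 h3 h4
    rcases h4.1.eq_or_lt with h0 | h0
    · rw [hwpast t h0.ge, hpast t h0.ge]
    have hpu : u t =ᵐ[volume] p t := by
      filter_upwards [h1] with x hx using (hp_eq t x hx).symm
    have hGt : t ∈ G := by
      refine ⟨h0, ?_⟩
      have e : ∫⁻ x, ENNReal.ofReal (p t x) = ∫⁻ x, ENNReal.ofReal |u t x| := by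
        refine lintegral_congr_ae ?_
        filter_upwards [h1] with x hx
        rw [hp_eq t x hx, abs_of_nonneg hx.1]
      rw [mem_ofPred_eq, e, ← ofReal_integral_eq_lintegral_ofReal h3.abs
        (Eventually.of_forall fun x => abs_nonneg _)]
      exact ENNReal.ofReal_le_ofReal h2
    rw [hw1 t hGt]
    exact hpu
  have hwi : Integrable (fun z : ℝ × ℝ => w z.1 z.2) ((volume.restrict (Icc 0 T)).prod volume) := by
    have := integrable_indicator_of_forall_isProfile hwm hwp 0 T
    rwa [integrable_indicator_iff (measurableSet_Icc.prod MeasurableSet.univ), IntegrableOn,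
      Measure.volume_eq_prod, ← Measure.prod_restrict, Measure.restrict_univ] at this
  refine ⟨w, h.isKruzhkovSolution hT hM hτ hwm hwp hwpast ?_, hae⟩
  refine hs.congr hT.le (EventuallyEq.refl _ _) hwi hae ?_
  have hd : ∀ t ≤ 0, u t =ᵐ[volume] w t := fun t ht => by rw [hwpast t ht, hpast t ht]
  filter_upwards [ae_sub_of_ae_restrict_Icc hτ hae hd] with t ht x
  exact downstream_congr_ae ht x

end TrafficData


/-! ### Data of bounded variation -/

/-- The integrals over the common part cancel. Two end intervals of length `h` remain, each
contributing at most `B h`, uniformly in `N`. -/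
theorem Monotone.integral_translate_sub_le {P : ℝ → ℝ} {B h N : ℝ} (hP : Monotone P)
    (hB : ∀ x, |P x| ≤ B) (hh : 0 ≤ h) :
    ∫ x in -N..N, (P (x + h) - P x) ≤ 2 * B * h := by
  have hi : ∀ a b, IntervalIntegrable P volume a b := fun a b => hP.intervalIntegrable
  have hi' : IntervalIntegrable (fun x => P (x + h)) volume (-N) N :=
    (hP.comp (fun x y hxy => add_le_add_left hxy h : Monotone fun x : ℝ => x + h)).intervalIntegrable
  rw [intervalIntegral.integral_sub hi' (hi _ _), intervalIntegral.integral_comp_add_right]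
  have hb : ∀ a, |∫ x in a..a + h, P x| ≤ B * h := fun a => by
    have := intervalIntegral.norm_integral_le_of_norm_le_const (a := a) (b := a + h) (f := P)
      (C := B) fun x _ => hB x
    rwa [add_sub_cancel_left, abs_of_nonneg hh] at this
  have e1 := intervalIntegral.integral_add_adjacent_intervals (hi (-N) (-N + h)) (hi (-N + h) (N + h))
  have e2 := intervalIntegral.integral_add_adjacent_intervals (hi (-N) N) (hi N (N + h))
  linarith [(abs_le.1 (hb (-N))).1, (abs_le.1 (hb N)).2]

/-- Translation estimate in `L¹` for functions of bounded variation. -/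
theorem BoundedVariationOn.exists_integral_abs_translate_sub_le {g r : ℝ → ℝ}
    (hg : BoundedVariationOn g univ) (hr : Integrable r) (hrg : r =ᵐ[volume] g) :
    ∃ B, 0 ≤ B ∧ ∀ h, ∫ x, |r (x + h) - r x| ≤ B * |h| := by
  have hloc := hg.locallyBoundedVariationOn
  -- The signed variation from `0` is monotone and bounded by the total variation, and its
  -- increments dominate those of `g`. This reduces the estimate to the monotone case.
  set P : ℝ → ℝ := variationOnFromTo g univ 0 with hPdef
  have hP : Monotone P := monotoneOn_univ.1 (variationOnFromTo.monotoneOn hloc (mem_univ 0))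
  set B : ℝ := (eVariationOn g univ).toReal with hBdef
  have hvar : ∀ a b, (eVariationOn g (univ ∩ Icc a b)).toReal ≤ B := fun a b =>
    ENNReal.toReal_mono hg (eVariationOn.mono g inter_subset_left)
  have hB : ∀ x, |P x| ≤ B := fun x => by
    simp only [hPdef, variationOnFromTo]
    split_ifs
    · rw [abs_of_nonneg ENNReal.toReal_nonneg]; exact hvar _ _
    · rw [abs_neg, abs_of_nonneg ENNReal.toReal_nonneg]; exact hvar _ _
  have hgP : ∀ x y, x ≤ y → |g y - g x| ≤ P y - P x := fun x y hxy => by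
    have e := variationOnFromTo.add hloc (mem_univ 0) (mem_univ x) (mem_univ y)
    have e2 : variationOnFromTo g univ x y = P y - P x := by simp only [hPdef]; linarith
    rw [← e2, variationOnFromTo.eq_of_le _ _ hxy, ← Real.dist_eq, ← ENNReal.ofReal_le_iff_le_toReal
      (ne_top_of_le_ne_top hg (eVariationOn.mono g inter_subset_left)), ← edist_dist]
    exact eVariationOn.edist_le g ⟨mem_univ _, hxy, le_rfl⟩ ⟨mem_univ _, le_rfl, hxy⟩
  have hpos : ∀ h, 0 ≤ h → ∫ x, |r (x + h) - r x| ≤ 2 * B * h := fun h hh => by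
    have hi : Integrable fun x => |r (x + h) - r x| := ((hr.comp_add_right h).sub hr).abs
    have hlim := intervalIntegral_tendsto_integral hi tendsto_neg_atTop_atBot tendsto_id
    refine le_of_tendsto hlim ?_
    filter_upwards [eventually_ge_atTop 0] with N hN
    refine le_trans ?_ (hP.integral_translate_sub_le (N := N) hB hh)
    have hi' : IntervalIntegrable (fun x => P (x + h)) volume (-N) N :=
      (hP.comp (fun x y hxy => add_le_add_left hxy h : Monotone fun x : ℝ => x + h)).intervalIntegrable
    refine intervalIntegral.integral_mono_ae (by simp only [id]; linarith) hi.intervalIntegrable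
      (hi'.sub hP.intervalIntegrable) ?_
    filter_upwards [hrg, (measurePreserving_add_right volume h).quasiMeasurePreserving.ae hrg]
      with x h1 h2
    rw [h1, h2]
    exact hgP x (x + h) (by linarith)
  refine ⟨2 * B, mul_nonneg zero_le_two ENNReal.toReal_nonneg, fun h => ?_⟩
  rcases le_total 0 h with hh | hh
  · rw [abs_of_nonneg hh]; exact hpos h hh
  · rw [abs_of_nonpos hh]
    have e := integral_add_right_eq_self (μ := volume) (fun x => |r (x + h) - r x|) (-h)
    rw [← e]
    refine le_trans (le_of_eq ?_) (hpos (-h) (by linarith))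
    refine integral_congr_ae (Eventually.of_forall fun x => ?_)
    beta_reduce
    rw [neg_add_cancel_right, abs_sub_comm]

/-- With `x = y + z` the functional is an average of translation errors with weight `η(z)`. The
linear bound in `|z|` turns it into the first moment of `η`, which is of order `ε`. -/
theorem IsProfile.kuznetsov_self_le {R M B m ε : ℝ} {r η : ℝ → ℝ} (hr : IsProfile R M r)
    (hη : IsMollifier m ε η) (hB : 0 ≤ B) (h : ∀ z, ∫ x, |r (x + z) - r x| ≤ B * |z|) :
    kuznetsov η r r ≤ B * m * ε := by
  have hηm := hη.contDiff.continuous.measurable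
  have i0 : Integrable fun z : ℝ × ℝ => |r z.1 - r z.2| * η (z.1 - z.2) :=
    hr.integrable_abs_sub_mul hr hη.integrable hηm
  have hzi : ∀ z, Integrable fun x => |r (x + z) - r x| := fun z =>
    ((hr.integrable.comp_add_right z).sub hr.integrable).abs
  have hb : ∀ z, η z * ∫ x, |r (x + z) - r x| ≤ B * (|z| * η z) := fun z => by
    have := mul_le_mul_of_nonneg_left (h z) (hη.nonneg z)
    linarith
  have mG : Measurable fun z : ℝ × ℝ => η z.1 * |r (z.2 + z.1) - r z.2| :=
    (hηm.comp _root_.measurable_fst).mul ((hr.measurable.comp (by fun_prop)).sub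
      (hr.measurable.comp _root_.measurable_snd)).abs
  have mI : Measurable fun z => η z * ∫ x, |r (x + z) - r x| := by
    simp_rw [← integral_const_mul]
    exact mG.stronglyMeasurable.integral_prod_right'.measurable
  have i2 : Integrable fun z => η z * ∫ x, |r (x + z) - r x| := by
    refine (hη.integrable_abs_mul.const_mul B).mono' mI.aestronglyMeasurable
      (Eventually.of_forall fun z => ?_)
    rw [Real.norm_of_nonneg (mul_nonneg (hη.nonneg z)
      (MeasureTheory.integral_nonneg fun x => abs_nonneg _))]
    exact hb z
  have i1 : Integrable (fun z : ℝ × ℝ => η z.1 * |r (z.2 + z.1) - r z.2|)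
      ((volume : Measure ℝ).prod volume) := by
    rw [integrable_prod_iff mG.aestronglyMeasurable]
    refine ⟨Eventually.of_forall fun z => (hzi z).const_mul (η z), ?_⟩
    refine i2.congr (Eventually.of_forall fun z => ?_)
    beta_reduce
    rw [← integral_const_mul]
    refine integral_congr_ae (Eventually.of_forall fun x => ?_)
    exact (Real.norm_of_nonneg (mul_nonneg (hη.nonneg z) (abs_nonneg _))).symm
  have e : kuznetsov η r r = ∫ z, η z * ∫ x, |r (x + z) - r x| := by
    rw [Measure.volume_eq_prod] at i0
    rw [kuznetsov, Measure.volume_eq_prod, integral_prod_symm _ i0]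
    simp_rw [← integral_const_mul]
    rw [integral_integral_swap (f := fun z x => η z * |r (x + z) - r x|) i1]
    refine integral_congr_ae (Eventually.of_forall fun y => ?_)
    beta_reduce
    rw [← integral_add_right_eq_self (μ := volume) (fun x => |r x - r y| * η (x - y)) y]
    refine integral_congr_ae (Eventually.of_forall fun x => ?_)
    beta_reduce
    rw [add_sub_cancel_right, mul_comm, add_comm x y]
  rw [e]
  calc ∫ z, η z * ∫ x, |r (x + z) - r x| ≤ ∫ z, B * (|z| * η z) :=
        integral_mono i2 (hη.integrable_abs_mul.const_mul B) hb
    _ = B * ∫ z, |z| * η z := integral_const_mul _ _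
    _ ≤ B * (m * ε) := mul_le_mul_of_nonneg_left hη.integral_abs_mul hB
    _ = B * m * ε := by ring

theorem IsBVDatum.exists_isProfile {R : ℝ} {ρ₀ : ℝ → ℝ} (hR : 0 ≤ R) (h : IsBVDatum R ρ₀) :
    ∃ r M B, IsProfile R M r ∧ ρ₀ =ᵐ[volume] r ∧ 0 ≤ B ∧
      ∀ z, ∫ x, |r (x + z) - r x| ≤ B * |z| := by
  obtain ⟨hi, hmem, g, hg, hgv⟩ := h
  set s := hi.aestronglyMeasurable.mk ρ₀ with hs
  have hsm : Measurable s := hi.aestronglyMeasurable.stronglyMeasurable_mk.measurable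
  set r : ℝ → ℝ := fun x => max 0 (min R (s x)) with hr
  have hρr : ρ₀ =ᵐ[volume] r := by
    filter_upwards [hi.aestronglyMeasurable.ae_eq_mk, hmem] with x h1 h2
    simp only [hr]
    rw [hs, ← h1, min_eq_right h2.2, max_eq_right h2.1]
  have hri : Integrable r := hi.congr hρr
  obtain ⟨B, hB, hBr⟩ := hgv.exists_integral_abs_translate_sub_le hri (hρr.symm.trans hg)
  exact ⟨r, ∫ x, r x, B, ⟨measurable_const.max (measurable_const.min hsm),
    fun x => ⟨le_max_left _ _, max_le hR (min_le_left _ _)⟩, hri, le_rfl⟩, hρr, hB, hBr⟩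


/-! ### Versions continuous in time -/

/-- A set of full measure is dense, so statements valid for almost every time extend by continuity
to every time, the end points included. -/
theorem Icc_subset_closure_of_ae {T : ℝ} (hT : 0 < T) {S : Set ℝ}
    (h : ∀ᵐ t ∂(volume.restrict (Icc 0 T)), t ∈ S) : Icc 0 T ⊆ closure (S ∩ Icc 0 T) := by
  rw [ae_restrict_iff' measurableSet_Icc] at h
  have hsub := (Measure.dense_of_ae h).open_subset_closure_inter (isOpen_Ioo (a := 0) (b := T))
  have hcl : closure (Ioo 0 T) ⊆ closure (S ∩ Icc 0 T) :=
    closure_minimal (hsub.trans (closure_mono fun t ht =>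
      ⟨ht.2 (Ioo_subset_Icc_self ht.1), Ioo_subset_Icc_self ht.1⟩)) isClosed_closure
  rwa [closure_Ioo hT.ne] at hcl

theorem ContinuousOn.le_of_ae_le_Icc {T b : ℝ} (hT : 0 < T) {F : ℝ → ℝ}
    (hF : ContinuousOn F (Icc 0 T)) (h : ∀ᵐ t ∂(volume.restrict (Icc 0 T)), F t ≤ b) {t : ℝ}
    (ht : t ∈ Icc 0 T) : F t ≤ b := by
  have : (𝓝[{t | F t ≤ b} ∩ Icc 0 T] t).NeBot :=
    mem_closure_iff_nhdsWithin_neBot.1 (Icc_subset_closure_of_ae hT h ht)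
  exact le_of_tendsto ((hF t ht).mono_left
    (nhdsWithin_mono t (inter_subset_right : {t | F t ≤ b} ∩ Icc 0 T ⊆ Icc 0 T)))
    (eventually_nhdsWithin_of_forall fun s hs => hs.1)

/-- A map uniformly continuous on a dense set extends continuously when the target is complete. It
is continuous on the dense set itself, so the extension keeps its values there. -/
theorem exists_continuousOn_of_modulus {X : Type*} [MetricSpace X] [CompleteSpace X] {T : ℝ}
    (hT : 0 < T) {E : ℝ → X} {S : Set ℝ} (hS : ∀ᵐ t ∂(volume.restrict (Icc 0 T)), t ∈ S)
    (h : ∀ e > 0, ∃ d > 0, ∀ t ∈ S ∩ Icc 0 T, ∀ s ∈ S ∩ Icc 0 T, |t - s| < d →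
      dist (E t) (E s) < e) :
    ∃ U : ℝ → X, ContinuousOn U (Icc 0 T) ∧ ∀ᵐ t ∂(volume.restrict (Icc 0 T)), U t = E t := by
  have hcl := Icc_subset_closure_of_ae hT hS
  refine ⟨extendFrom (S ∩ Icc 0 T) E, continuousOn_extendFrom hcl fun t ht => ?_, ?_⟩
  · have := mem_closure_iff_nhdsWithin_neBot.1 (hcl ht)
    refine cauchy_map_iff_exists_tendsto.1 (Metric.cauchy_iff.2 ⟨inferInstance, fun e he => ?_⟩)
    obtain ⟨d, hd, hdE⟩ := h e he
    refine ⟨E '' (Metric.ball t (d / 2) ∩ (S ∩ Icc 0 T)), image_mem_map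
      (inter_mem (mem_nhdsWithin_of_mem_nhds (Metric.ball_mem_nhds t (half_pos hd)))
        self_mem_nhdsWithin), ?_⟩
    rintro _ ⟨a, ha, rfl⟩ _ ⟨b, hb, rfl⟩
    refine hdE a ha.2 b hb.2 ?_
    have h1 := Metric.mem_ball.1 ha.1
    have h2 := Metric.mem_ball'.1 hb.1
    rw [← Real.dist_eq]
    linarith [dist_triangle a t b]
  · have hc : ContinuousOn E (S ∩ Icc 0 T) := fun t ht => by
      refine Metric.tendsto_nhdsWithin_nhds.2 fun e he => ?_
      obtain ⟨d, hd, hdE⟩ := h e he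
      exact ⟨d, hd, fun {s} hs hst => hdE s hs t ht (by rwa [← Real.dist_eq])⟩
    filter_upwards [hS, ae_restrict_mem measurableSet_Icc] with t h1 h2
    exact extendFrom_extends hc t ⟨h1, h2⟩

theorem norm_Lp_sub_eq_integral {U W : Lp ℝ 1 (volume : Measure ℝ)} {p q : ℝ → ℝ}
    (hU : U =ᵐ[volume] p) (hW : W =ᵐ[volume] q) : ‖U - W‖ = ∫ x, |p x - q x| := by
  rw [L1.norm_eq_integral_norm]
  refine integral_congr_ae ?_
  filter_upwards [Lp.coeFn_sub U W, hU, hW] with x h1 h2 h3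
  rw [h1, Pi.sub_apply, h2, h3, Real.norm_eq_abs]

namespace IsKruzhkovSolution

variable {T R M C c m τ : ℝ} {g r₀ : ℝ → ℝ} {α β : (ℝ → ℝ) → ℝ → ℝ} {u w : ℝ → ℝ → ℝ}

/-- The modulus at scale `ε` does not vanish with the time gap, but its first term is `O(ε)`.
Choosing first `ε` and then the gap gives uniform continuity in `L¹` on a set of full measure. -/
theorem exists_isTimeContinuousVersion (hu : IsKruzhkovSolution T R M τ g α β r₀ u)
    (h : IsFlux R M C g α β) (hT : 0 < T) (hc : 0 ≤ c)
    (hη : ∀ ε : ℝ, 0 < ε → ∃ η, IsMollifier m ε η ∧ kuznetsov η r₀ r₀ ≤ c * ε ∧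
      ∀ᵐ t ∂(volume.restrict (Icc 0 T)), kuznetsov η (u t) (u t) ≤ c * ε) :
    ∃ U, IsTimeContinuousVersion T u U := by
  have hmod : ∀ n : ℕ, ∃ S : Set ℝ, 0 ∈ S ∧ (∀ᵐ t ∂(volume.restrict (Icc 0 T)), t ∈ S) ∧
      ∀ t ∈ S, ∀ t' ∈ S, 0 ≤ t' → t' ≤ t → t ≤ T → ∫ x, |u t x - u t' x| ≤
        2 * c * (1 / ((n : ℝ) + 1)) + 2 * C * M / (1 / ((n : ℝ) + 1)) * (t - t') := fun n => by
    obtain ⟨η, h1, h2, h3⟩ := hη (1 / ((n : ℝ) + 1)) Nat.one_div_pos_of_nat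
    exact hu.exists_modulus h h1 hT h2 h3
  choose S hS0 hS hSm using hmod
  have hC := h.C_nonneg
  have hM := h.M_nonneg
  set E : ℝ → Lp ℝ 1 (volume : Measure ℝ) := fun t => (hu.isProfile t).integrable.toL1 (u t) with hE
  have hEu : ∀ t, E t =ᵐ[volume] u t := fun t => Integrable.coeFn_toL1 _
  have hd : ∀ t s, dist (E t) (E s) = ∫ x, |u t x - u s x| := fun t s => by
    rw [dist_eq_norm, norm_Lp_sub_eq_integral (hEu t) (hEu s)]
  -- The exceptional times depend on the scale. Restricting to the scales `1/(n + 1)` keeps their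
  -- union null.
  obtain ⟨U, hUc, hUE⟩ := exists_continuousOn_of_modulus hT (E := E) (S := ⋂ n, S n)
    (by simpa only [mem_iInter] using ae_all_iff.2 hS) fun e he => by
      obtain ⟨n, hn⟩ := exists_nat_one_div_lt (show 0 < e / 2 / (2 * c + 1) by positivity)
      set ε : ℝ := 1 / ((n : ℝ) + 1) with hε
      have hε0 : 0 < ε := Nat.one_div_pos_of_nat
      have h1 : 2 * c * ε < e / 2 := by
        have := (lt_div_iff₀ (by positivity)).1 hn
        nlinarith
      set Q := 2 * C * M / ε with hQ
      have hQ0 : 0 ≤ Q := by positivity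
      have hlt : ∀ t ∈ S n ∩ Icc 0 T, ∀ s ∈ S n ∩ Icc 0 T, s ≤ t → |t - s| < e / 2 / (Q + 1) →
          dist (E t) (E s) < e := fun t ht s hs hst hts => by
        rw [hd]
        have h2 := hSm n t ht.1 s hs.1 hs.2.1 hst ht.2.2
        change _ ≤ 2 * c * ε + Q * (t - s) at h2
        rw [abs_of_nonneg (sub_nonneg.2 hst), lt_div_iff₀ (by positivity)] at hts
        have h3 : Q * (t - s) ≤ (t - s) * (Q + 1) := by linarith
        linarith
      refine ⟨e / 2 / (Q + 1), by positivity, fun t ht s hs hts => ?_⟩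
      have ht' : t ∈ S n ∩ Icc 0 T := ⟨mem_iInter.1 ht.1 n, ht.2⟩
      have hs' : s ∈ S n ∩ Icc 0 T := ⟨mem_iInter.1 hs.1 n, hs.2⟩
      rcases le_total s t with hst | hst
      · exact hlt t ht' s hs' hst hts
      · rw [dist_comm]
        exact hlt s hs' t ht' hst (by rwa [abs_sub_comm])
  refine ⟨U, hUc, ?_⟩
  filter_upwards [hUE] with t ht
  rw [ht]
  exact hEu t

/-- Distance of a solution of the delayed problem to a solution of the non-delayed one. -/
theorem ae_integral_abs_sub_le_sqrt (hu : IsKruzhkovSolution T R M 0 g α β r₀ u)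
    (hw : IsKruzhkovSolution T R M τ g α β r₀ w) (h : IsFlux R M C g α β) (hm : 0 ≤ m)
    (hT : 0 < T) (hτ : 0 < τ) (hc : 0 ≤ c)
    (hη : ∀ ε : ℝ, 0 < ε → ∃ η, IsMollifier m ε η ∧ kuznetsov η r₀ r₀ ≤ c * ε ∧
      ∀ᵐ t ∂(volume.restrict (Icc 0 T)), kuznetsov η (u t) (u t) ≤ c * ε) :
    ∀ᵐ t ∂(volume.restrict (Icc 0 T)), ∫ x, |u t x - w t x| ≤
      distBound ((5 * C ^ 2 + R * C) * (1 + m)) T c * (1 + 2 * c + 2 * C * M) * √τ := by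
  have hs : 0 < √τ := Real.sqrt_pos.2 hτ
  -- The scale `ε = √τ` balances the smoothing error `2 c ε` against the flux term `2 C M τ / ε`.
  obtain ⟨η, h1, h2, h3⟩ := hη (√τ) hs
  obtain ⟨S, hS0, hS, hSm⟩ := hu.exists_modulus h h1 hT h2 h3
  have hC := h.C_nonneg
  have hM := h.M_nonneg
  have hδ : ∀ᵐ t ∂(volume.restrict (Icc 0 T)), ∫ x, |u t x - u (t - τ) x| ≤
      2 * c * √τ + 2 * C * M * √τ := by
    have hP : ∀ᵐ t ∂(volume.restrict (Icc 0 T)), t - τ ≤ 0 ∨ t - τ ∈ S :=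
      ae_sub_of_ae_restrict_Icc (P := fun s => s ≤ 0 ∨ s ∈ S) hτ.le (hS.mono fun t ht => Or.inr ht)
        fun t ht => Or.inl ht
    have hle : ∀ s, s ≤ τ → 2 * C * M / √τ * s ≤ 2 * C * M * √τ := fun s hs' => by
      have h4 : 2 * C * M / √τ * s ≤ 2 * C * M / √τ * τ :=
        mul_le_mul_of_nonneg_left hs' (by positivity)
      have h5 : 2 * C * M / √τ * τ = 2 * C * M * (τ / √τ) := by ring
      rw [h5, Real.div_sqrt] at h4
      exact h4
    filter_upwards [hS, hP, ae_restrict_mem measurableSet_Icc] with t h4 h5 h6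
    rcases le_or_gt (t - τ) 0 with h7 | h7
    -- For `t ≤ τ` the delayed slice is the datum, hence the slice at time `0`, which is why `0 ∈ S`
    -- was arranged in `exists_modulus`.
    · rw [hu.past _ h7, ← hu.past 0 le_rfl]
      have := hSm t h4 0 hS0 le_rfl h6.1 h6.2
      linarith [hle (t - 0) (by linarith)]
    · have := hSm t h4 (t - τ) (h5.resolve_left (not_le.2 h7)) h7.le (by linarith) h6.2
      linarith [hle (t - (t - τ)) (by linarith)]
  filter_upwards [hu.ae_integral_abs_sub_le hw h h1 hm hT h2 h3 hδ (by positivity)] with t ht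
  refine ht.trans (le_of_eq ?_)
  ring

end IsKruzhkovSolution


/-! ### Conclusion -/

theorem mainTheorem3 (R V L : ℝ) (v f ω : ℝ → ℝ) (hdata : TrafficData R V L v f ω)
    (ρ₀ : ℝ → ℝ) (hρ₀ : IsBVDatum R ρ₀) (T : ℝ) (hT : 0 < T)
    (ρτ : ℝ → ℝ → ℝ → ℝ)
    (hρτ : ∀ τ : ℝ, 0 < τ → IsDelayedEntropySolution T R L v f ω τ ρ₀ (ρτ τ))
    (ρ : ℝ → ℝ → ℝ) (hρ : IsNondelayedEntropySolution T R L v f ω ρ₀ ρ) :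
    (∀ τ : ℝ, 0 < τ → ∃ U, IsTimeContinuousVersion T (ρτ τ) U) ∧
    (∃ U, IsTimeContinuousVersion T ρ U) ∧
    ∀ (Uτ : ℝ → ℝ → Lp ℝ 1 (volume : Measure ℝ)) (U : ℝ → Lp ℝ 1 (volume : Measure ℝ)),
      (∀ τ : ℝ, 0 < τ → IsTimeContinuousVersion T (ρτ τ) (Uτ τ)) →
      IsTimeContinuousVersion T ρ U →
      ∀ t ∈ Icc 0 T, Tendsto (fun τ => ‖Uτ τ t - U t‖) (𝓝[>] 0) (𝓝 0) := by
  have hR := hdata.R_pos.le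
  obtain ⟨r₀, M, B, hr, hρr, hB, hBr⟩ := hρ₀.exists_isProfile hR
  have hM : 0 ≤ M := hr.integral_nonneg.trans hr.integral_le
  obtain ⟨C, hC⟩ := hdata.exists_isFlux hM
  obtain ⟨m, hm, hmol⟩ := exists_isMollifier
  have hC0 := hC.C_nonneg
  set K := (5 * C ^ 2 + R * C) * (1 + m) with hK
  have hK0 : 0 ≤ K := by positivity
  -- One constant controls the self functional of the datum and of every solution at every scale,
  -- independently of the delay. This is what makes the final rate uniform in `τ`.
  set c := selfBound K T (B * m) with hc
  have hBm : 0 ≤ B * m := mul_nonneg hB hm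
  have hcB : B * m ≤ c := le_selfBound hK0 hT.le hBm
  have hc0 : 0 ≤ c := hBm.trans hcB
  have hmoll : ∀ τ w, IsKruzhkovSolution T R M τ (fun r => r * f r) (trafficSpeed L v ω)
      (trafficSpeedDeriv R L v ω) r₀ w → ∀ ε : ℝ, 0 < ε → ∃ η, IsMollifier m ε η ∧
      kuznetsov η r₀ r₀ ≤ c * ε ∧
      ∀ᵐ t ∂(volume.restrict (Icc 0 T)), kuznetsov η (w t) (w t) ≤ c * ε := fun τ w hw ε hε => by
    obtain ⟨η, hη⟩ := hmol ε hε
    have h0 := hr.kuznetsov_self_le hη hB hBr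
    exact ⟨η, hη, h0.trans (mul_le_mul_of_nonneg_right hcB hε.le),
      hw.ae_kuznetsov_self_le hC hη hm hT h0⟩
  have hdel : ∀ τ : ℝ, 0 < τ → ∃ w, IsKruzhkovSolution T R M τ (fun r => r * f r)
      (trafficSpeed L v ω) (trafficSpeedDeriv R L v ω) r₀ w ∧
      ∀ᵐ t ∂(volume.restrict (Icc 0 T)), ρτ τ t =ᵐ[volume] w t := fun τ hτ => by
    obtain ⟨u, hu, hp, hρu, hs⟩ := (hρτ τ hτ).exists_measurable hT hτ.le hr.measurable hρr
    obtain ⟨w, hw, huw⟩ := hdata.exists_isKruzhkovSolution hT hτ.le hr hu hp hs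
    exact ⟨w, hw, by filter_upwards [hρu, huw] with t h1 h2 using h1.trans h2⟩
  obtain ⟨w₀, hw₀, hρw₀⟩ : ∃ w, IsKruzhkovSolution T R M 0 (fun r => r * f r)
      (trafficSpeed L v ω) (trafficSpeedDeriv R L v ω) r₀ w ∧
      ∀ᵐ t ∂(volume.restrict (Icc 0 T)), ρ t =ᵐ[volume] w t := by
    obtain ⟨u, hu, hp, hρu, hs⟩ := hρ.exists_measurable hT hr.measurable hρr
    obtain ⟨w, hw, huw⟩ := hdata.exists_isKruzhkovSolution hT le_rfl hr hu hp hs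
    exact ⟨w, hw, by filter_upwards [hρu, huw] with t h1 h2 using h1.trans h2⟩
  refine ⟨fun τ hτ => ?_, ?_, fun Uτ U hUτ hU t ht => ?_⟩
  · obtain ⟨w, hw, hρw⟩ := hdel τ hτ
    obtain ⟨U, hU, hUw⟩ := hw.exists_isTimeContinuousVersion hC hT hc0 (hmoll τ w hw)
    exact ⟨U, hU, by filter_upwards [hρw, hUw] with t h1 h2 using h2.trans h1.symm⟩
  · obtain ⟨U, hU, hUw⟩ := hw₀.exists_isTimeContinuousVersion hC hT hc0 (hmoll 0 w₀ hw₀)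
    exact ⟨U, hU, by filter_upwards [hρw₀, hUw] with t h1 h2 using h2.trans h1.symm⟩
  · set Q := distBound K T c * (1 + 2 * c + 2 * C * M) with hQ
    have hlim : Tendsto (fun τ : ℝ => Q * √τ) (𝓝[>] 0) (𝓝 0) := by
      have : Tendsto (fun τ : ℝ => Q * √τ) (𝓝 0) (𝓝 (Q * √0)) :=
        (Real.continuous_sqrt.const_mul Q).tendsto 0
      rw [Real.sqrt_zero, mul_zero] at this
      exact this.mono_left nhdsWithin_le_nhds
    refine squeeze_zero' (Eventually.of_forall fun τ => norm_nonneg _) ?_ hlim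
    filter_upwards [self_mem_nhdsWithin] with τ hτ
    obtain ⟨w, hw, hρw⟩ := hdel τ hτ
    -- The estimate holds only for almost every time, with exceptional times depending on `τ`.
    -- Continuity of both versions gives it at the prescribed `t`.
    refine ContinuousOn.le_of_ae_le_Icc hT ((hUτ τ hτ).1.sub hU.1).norm ?_ ht
    filter_upwards [hw₀.ae_integral_abs_sub_le_sqrt hw hC hm hT hτ hc0 (hmoll 0 w₀ hw₀), hρw, hρw₀,
      (hUτ τ hτ).2, hU.2] with s h1 h2 h3 h4 h5
    rw [Pi.sub_apply, norm_sub_rev, norm_Lp_sub_eq_integral (h5.trans h3) (h4.trans h2)]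
    exact h1
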